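/- **Setting.** Let $k$ be an algebraically closed field and let $0\neq f\in k[x_1^{\pm1},y^{\pm1}]$ define a smooth curve $C_0:f=0$ in $\mathbb G_m^2$ (not necessarily connected), with ring of rational functions $k(C_0)$. *Charts.* Let $\Omega$ be the set of pairs $\alpha=(v,(g_2,\dots,g_m))$ with $m\ge1$, $v\in\mathbb Z^{m+1}$ primitive and $g_i\in k[x_1^{\pm1},y^{\pm1}]$, such that the open subscheme $C_{0,\alpha}=\{g_2\cdots g_m\ne0\}$ of $C_0$ is dense. Embed $C_{0,\alpha}$ in $\mathbb G_m^{m+1}$ by $(x_1,g_2,\dots,g_m,y)$. For $M\in\mathrm{SL}_{m+1}(\mathbb Z)$ with last row $v$ ("attached to $v$") let $(X_1,\dots,X_m,Y)$ be the coordinates with $(x_1,\dots,x_m,y)=(X_1,\dots,X_m,Y)\bullet M$, i.e. the $i$-th old coordinate is the Laurent monomial in the new ones with exponents the $i$-th column of $M$. Let $C_\alpha$ be the Zariski closure of $C_{0,\alpha}$ in $\operatorname{Spec}k[X_1^{\pm1},\dots,X_m^{\pm1},Y]$, and $\bar C_\alpha=C_\alpha\cap\{Y=0\}$ (scheme-theoretically).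 For a finite set $\Sigma_n\subset\Omega$, let $C_n=C_0\cup\bigcup_{\gamma\in\Sigma_n}C_\gamma$ be the scheme obtained by glueing $C_0$ and the $C_\gamma$ along the largest open subschemes on which the natural birational maps between them are open immersions. Each $\gamma\in\Sigma_n$ carries a matrix $M_\gamma$ attached to its vector, an index $j_\gamma$ and a polynomial $\mathcal F_\gamma\in k[X_{j_\gamma},Y]$ with $Y\nmid\mathcal F_\gamma$; put $f|_\gamma(X_{j_\gamma})=\mathcal F_\gamma(X_{j_\gamma},0)$. *The set $\Sigma_1$.* It consists of all $(v,())$, with $v\in\mathbb Z^2$ the primitive inward normal vector of an edge of the Newton polygon of $f$ (a segment counts as two edges, with opposite normal vectors). For such an element choose $M$ attached to $v$, take $j=1$, and choose $\mathcal F\in k[X_1,Y]$, $Y\nmid\mathcal F$, with $f((X_1,Y)\bullet M)=X_1^{*}Y^{*}\mathcal F(X_1,Y)$. *From $\Sigma_n$ to $\Sigma_{n+1}$.* Choose $\alpha=(v,(g_2,\dots,g_m))\in\Sigma_n$ and a finite, possibly empty, set $\mathcal S$ of singular points of $\bar C_\alpha$. For $p\in\mathcal S$ choose $\tilde{\mathcal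 G}_p=X_{j_\alpha}-q_p(\tilde Y)$ with $q_p\in k[\tilde Y]$, where $\tilde Y$ denotes the coordinate $Y$ of the chart $\alpha$, such that $X_{j_\alpha}-q_p(0)$ vanishes at $p$ and $\tilde{\mathcal G}_p\nmid\mathcal F_\alpha$. Let $g_p\in k[x_1,\dots,x_m,y]$ be the polynomial, divisible by no variable, that equals $\tilde{\mathcal G}_p((x_1,\dots,x_m,y)\bullet M_\alpha^{-1})$ up to a Laurent monomial factor. For $g\in k[x_1,\dots,x_m,y]$ and $\beta=(\beta_1,\beta_2)$ primitive put $$\beta\circ_g\alpha=\big((\beta_2v_1,\dots,\beta_2v_m,\ \beta_1+\beta_2\operatorname{ord}_v(g),\ \beta_2v_{m+1}),\ (g_2,\dots,g_m,g(x_1,g_2,\dots,g_m,y))\big),$$ where $\operatorname{ord}_v(g)$ is the minimum of $v\cdot i$ over the exponent vectors $i$ of $g$. Put $\tilde\alpha=(0,1)\circ_{\prod_{p\in\mathcal S}g_p}\alpha$, and for $p\in\mathcal S$ let $\Sigma_p$ be the set of all $\gamma=\beta\circ_{g_p}\alpha$ with $\beta\in\mathbb Z_{>0}^2$ primitive and $C_{0,\gamma}\subsetneq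 C_\gamma$. Then $$\Sigma_{n+1}=(\Sigma_n\setminus\{\alpha\})\cup\{\tilde\alpha\}\cup\bigcup_{p\in\mathcal S}\Sigma_p .$$ The data are as follows. Elements of $\Sigma_n\setminus\{\alpha\}$ keep theirs. Let $g$ be $g_p$ or $\prod_{p\in\mathcal S}g_p$, and correspondingly $\tilde{\mathcal G}=\tilde{\mathcal G}_p$ or $\prod_{p\in\mathcal S}\tilde{\mathcal G}_p$, and write $g=X_1^{n_1}\cdots X_m^{n_m}\tilde Y^{\operatorname{ord}_v(g)}\,\tilde{\mathcal G}$ via $M_\alpha$. Let $M_{\alpha,g}$ be the matrix obtained from $M_\alpha$ by inserting, before the last column, the column $(n_1,\dots,n_m,\operatorname{ord}_v(g))^T$ and then, before the last row, the row $(0,\dots,0,1,0)$. For $\tilde\alpha$ take $M_{\tilde\alpha}=M_{\alpha,g}$ (with $g=\prod_{p\in\mathcal S} g_p$), $j_{\tilde\alpha}=j_\alpha$ and $\mathcal F_{\tilde\alpha}=\mathcal F_\alpha$. For $\gamma=\beta\circ_{g_p}\alpha\in\Sigma_p$ choose $M_\beta\in\mathrm{SL}_2(\mathbb Z)$ attached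 to $\beta$, and take $M_\gamma=(I_m\oplus M_\beta)M_{\alpha,g_p}$, $j_\gamma=m+1$ and $\mathcal F_\gamma\in k[X_{m+1},Y]$ with $Y\nmid\mathcal F_\gamma$ and $\mathcal F_{\alpha,p}((X_{m+1},Y)\bullet M_\beta)=X_{m+1}^{*}Y^{*}\mathcal F_\gamma(X_{m+1},Y)$, where $\mathcal F_{\alpha,p}(\tilde X,\tilde Y)=\mathcal F_\alpha(\tilde X+q_p(\tilde Y),\tilde Y)$. A *simple Baker's resolution* of $C_0$ is a sequence $(C_n)_{n\ge1}$ obtained from such sets $\Sigma_n$. The curve $C_n$ is *outer regular* if $\bar C_\gamma$ is regular for every $\gamma\in\Sigma_n$. **Theorem.** Let $(C_n)_{n\ge1}$ be a simple Baker's resolution of $C_0$, let $n\ge1$, and suppose that $C_n$ is outer regular. Then there is a bijection $$C_n(k)\setminus C_0(k)\ \longleftrightarrow\ \bigsqcup_{\gamma\in\Sigma_n}\{\text{simple roots of } f|_\gamma\text{ in }k^\times\},$$ which is natural in the following sense: for $\gamma\in\Sigma_n$ and a simple root $r\in k^\times$ of $f|_\gamma$, there is exactly one $k$-rational point of $C_\gamma$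 with coordinates $Y=0$ and $X_{j_\gamma}=r$, and its image in $C_n$ is the point that corresponds to $(\gamma,r)$. -/

import Mathlib

open CategoryTheory AlgebraicGeometry Polynomial

universe u

namespace BakerModel

section Gluing

/- Glueing of affine charts along the birational maps between them.  Here `K` is a ring of
rational functions and the charts are the spectra of a family of subrings `B i` of `K`. -/

variable {k K : Type u} [Field k] [CommRing K] [Algebra k K]
variable {J : Type u} (B : J → Subalgebra k K)

/-- The `i`-th chart, `Spec (B i)`. -/
noncomputable abbrev chart (i : J) : Scheme.{u} := Spec (CommRingCat.of (B i))

/-- The morphism `Spec K ⟶ Spec (B i)`.  If `K` is the total ring of fractions of the reduced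
noetherian ring `B i`, its image is the set of generic points of the chart. -/
noncomputable def generic (i : J) : Spec (CommRingCat.of K) ⟶ chart B i :=
  Spec.map (CommRingCat.ofHom (B i).val.toRingHom)

instance (i : J) : IsSchemeTheoreticallyDominant (generic B i) := by
  constructor
  refine Scheme.IdealSheafData.ext_of_isAffine ?_
  rw [Scheme.Hom.ker_apply, Scheme.IdealSheafData.ideal_bot, Pi.bot_apply,
    ← RingHom.injective_iff_ker_eq_bot]
  let φ := CommRingCat.ofHom (B i).val.toRingHom
  have h : Function.Injective φ := Subtype.val_injective
  have h2 := Scheme.ΓSpecIso_naturality φ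
  rw [← Iso.eq_comp_inv] at h2
  change Function.Injective (Spec.map φ).appTop
  rw [h2]
  intro x y hxy
  simp only [CommRingCat.comp_apply] at hxy
  have e1 := (Scheme.ΓSpecIso (CommRingCat.of K)).symm.commRingCatIsoToRingEquiv.injective
  have e2 := (Scheme.ΓSpecIso (CommRingCat.of (B i))).commRingCatIsoToRingEquiv.injective
  exact e2 (h (e1 hxy))

/-- A dense open subscheme of one of the charts: an open set that contains all generic points. -/
structure Piece where
  idx : J
  U : (chart B idx).Opens
  dense : Set.range (generic B idx) ⊆ U

namespace Piece
variable {B}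

/-- The morphism from `Spec K` to a dense open subscheme of a chart. -/
noncomputable def gen (P : Piece B) : Spec (CommRingCat.of K) ⟶ P.U.toScheme :=
  IsOpenImmersion.lift P.U.ι (generic B P.idx) (by simpa using P.dense)

@[simp]
lemma gen_ι (P : Piece B) : P.gen ≫ P.U.ι = generic B P.idx := IsOpenImmersion.lift_fac _ _ _

@[simp]
lemma gen_ι_assoc (P : Piece B) {Z : Scheme.{u}} (h : chart B P.idx ⟶ Z) :
    P.gen ≫ P.U.ι ≫ h = generic B P.idx ≫ h := by
  rw [← Category.assoc, gen_ι]

/-- An open immersion from a dense open subscheme of one chart to a dense open subscheme of another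
(or the same) chart which, as a rational map, is the birational map between the two charts, i.e. which
is compatible with the morphisms from `Spec K`. -/
@[ext]
structure Hom (P Q : Piece B) where
  hom : P.U.toScheme ⟶ Q.U.toScheme
  isOpenImmersion : IsOpenImmersion hom
  gen_hom : P.gen ≫ hom = Q.gen


lemma isPullback_gen (P : Piece B) : IsPullback (𝟙 _) P.gen (generic B P.idx) P.U.ι := by
  refine ⟨⟨by simp⟩, ⟨?_⟩⟩
  refine Limits.PullbackCone.IsLimit.mk _ (fun s => s.fst) (fun s => by simp) (fun s => ?_)
    (fun s m h _ => by simpa using h)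
  rw [← cancel_mono P.U.ι, Category.assoc, gen_ι, s.condition]

instance (P : Piece B) : QuasiCompact P.gen :=
  MorphismProperty.of_isPullback P.isPullback_gen
    (by unfold generic chart; infer_instance : QuasiCompact (generic B P.idx))

instance (P : Piece B) : IsSchemeTheoreticallyDominant P.gen :=
  have : QuasiCompact (generic B P.idx) := by unfold generic chart; infer_instance
  .of_isPullback P.isPullback_gen

lemma hom_unique {P : Piece B} {Z : Scheme.{u}} [IsAffine Z] {f g : P.U.toScheme ⟶ Z}
    (h : P.gen ≫ f = P.gen ≫ g) : f = g := by
  refine ext_of_isAffine ?_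
  have h1 := congr(Scheme.Hom.appTop $h)
  rw [Scheme.Hom.comp_appTop, Scheme.Hom.comp_appTop] at h1
  ext x
  apply P.gen.app_injective ⊤
  exact congr($h1 x)

instance (P Q : Piece B) : Subsingleton (Hom P Q) := ⟨fun f g => by
  ext1
  rw [← cancel_mono Q.U.ι]
  apply hom_unique
  simp [reassoc_of% f.gen_hom, reassoc_of% g.gen_hom]⟩

/-- Dense open subschemes of the charts, with the open immersions that represent the birational maps
between the charts.  There is at most one such immersion between two given open subschemes. -/
noncomputable instance : Category (Piece B) where
  Hom := Hom
  id P := ⟨𝟙 _, inferInstance, by simp⟩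
  comp f g := ⟨f.hom ≫ g.hom, by have := f.2; have := g.2; infer_instance,
    by rw [← Category.assoc, f.gen_hom, g.gen_hom]⟩

instance : Quiver.IsThin (Piece B) := fun P Q => inferInstanceAs (Subsingleton (Hom P Q))

end Piece

/-- The diagram of all dense open subschemes of the charts. -/
@[simps]
noncomputable def diagram : Piece B ⥤ Scheme.{u} where
  obj P := P.U.toScheme
  map f := f.hom

instance {P Q : Piece B} (f : P ⟶ Q) : IsOpenImmersion ((diagram B).map f) := f.isOpenImmersion

instance : ((diagram B) ⋙ Scheme.forget).IsLocallyDirected := by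
  constructor
  intro P Q R f g x y h
  have := f.isOpenImmersion
  have := g.isOpenImmersion
  replace h : f.hom x = g.hom y := h
  let O : P.U.toScheme.Opens := f.hom ⁻¹ᵁ g.hom.opensRange
  have hx : x ∈ O := ⟨y, h.symm⟩
  have hgen : Set.range P.gen ⊆ (O : Set P.U.toScheme) := by
    rintro _ ⟨w, rfl⟩
    refine ⟨Q.gen w, ?_⟩
    rw [← Scheme.Hom.comp_apply, ← Scheme.Hom.comp_apply, f.gen_hom, g.gen_hom]
  let S : Piece B := ⟨P.idx, P.U.ι ''ᵁ O, by
    rintro _ ⟨w, rfl⟩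
    refine ⟨P.gen w, hgen ⟨w, rfl⟩, ?_⟩
    change P.U.ι _ = _
    rw [← Scheme.Hom.comp_apply, Piece.gen_ι]⟩
  let a : S.U.toScheme ⟶ P.U.toScheme := (chart B P.idx).homOfLE (P.U.ι_image_le O)
  have ha : S.gen ≫ a = P.gen := by
    rw [← cancel_mono P.U.ι]; simp [a, S, Piece.gen]
  have har : Set.range (a ≫ f.hom) ⊆ Set.range g.hom := by
    rintro _ ⟨w, rfl⟩
    obtain ⟨o, ho, how⟩ := w.2
    have : a w = o := by
      apply P.U.ι.isOpenEmbedding.injective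
      rw [← Scheme.Hom.comp_apply]
      simp only [a, Scheme.homOfLE_ι]
      exact how.symm
    rw [Scheme.Hom.comp_apply, this]
    exact ho
  let b : S.U.toScheme ⟶ Q.U.toScheme := IsOpenImmersion.lift g.hom (a ≫ f.hom) har
  have hb : b ≫ g.hom = a ≫ f.hom := IsOpenImmersion.lift_fac _ _ _
  have hbo : IsOpenImmersion b := by
    have : IsOpenImmersion (b ≫ g.hom) := by rw [hb]; infer_instance
    exact .of_comp b g.hom
  let x' : S.U.toScheme := ⟨P.U.ι x, ⟨x, hx, rfl⟩⟩
  have hax : a x' = x := by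
    apply P.U.ι.isOpenEmbedding.injective
    rw [← Scheme.Hom.comp_apply]
    simp only [a, Scheme.homOfLE_ι]
    rfl
  refine ⟨S, ⟨a, inferInstance, ha⟩, ⟨b, hbo, ?_⟩, x', hax, ?_⟩
  · rw [← cancel_mono g.hom, Category.assoc, hb, reassoc_of% ha, f.gen_hom, g.gen_hom]
  · apply g.hom.isOpenEmbedding.injective
    change g.hom (b x') = g.hom y
    rw [← Scheme.Hom.comp_apply, hb, Scheme.Hom.comp_apply, hax, h]

instance : Small.{u} (Piece B) := inferInstance

/-- The scheme obtained by glueing the charts: `Spec (B i)` and `Spec (B j)` are glued along the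
largest open subscheme of `Spec (B i)` on which the birational map to `Spec (B j)` is an open immersion
(see `ι_eq_ι_iff`).  It is the colimit of the diagram of all dense open subschemes of the charts. -/
noncomputable def glued : Scheme.{u} := Limits.colimit (diagram B)

/-- The `i`-th chart as an open subscheme of itself. -/
noncomputable abbrev Piece.whole (i : J) : Piece B := ⟨i, ⊤, by simp⟩

/-- The inclusion (an open immersion) of the `i`-th chart in the glued scheme. -/
noncomputable def ι (i : J) : chart B i ⟶ glued B :=
  (chart B i).topIso.inv ≫ Limits.colimit.ι (diagram B) (Piece.whole B i)

/-- The structure morphism of a chart over `k`. -/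
noncomputable def chartOver (i : J) : chart B i ⟶ Spec (CommRingCat.of k) :=
  Spec.map (CommRingCat.ofHom (algebraMap k (B i)))

lemma generic_chartOver (i : J) : generic B i ≫ chartOver B i =
    Spec.map (CommRingCat.ofHom (algebraMap k K)) :=
  (Spec.map_comp _ _).symm

lemma Piece.Hom.over {P Q} (f : Piece.Hom (B := B) P Q) :
    f.hom ≫ Q.U.ι ≫ chartOver B Q.idx = P.U.ι ≫ chartOver B P.idx := by
  apply P.hom_unique
  rw [reassoc_of% f.gen_hom, Piece.gen_ι_assoc, Piece.gen_ι_assoc, generic_chartOver,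
    generic_chartOver]

/-- The structure morphism over `k` of the glued scheme. -/
noncomputable def gluedOver : glued B ⟶ Spec (CommRingCat.of k) :=
  Limits.colimit.desc (diagram B)
    { pt := Spec (CommRingCat.of k)
      ι := { app := fun P => P.U.ι ≫ chartOver B P.idx
             naturality := fun P Q f => (Piece.Hom.over B f).trans (Category.comp_id _).symm } }

lemma whole_ι (i : J) :
    (Piece.whole B i).U.ι ≫ ι B i = Limits.colimit.ι (diagram B) (Piece.whole B i) :=
  (chart B i).topIso.hom_inv_id_assoc _

lemma ι_apply (i : J) (x : chart B i) :
    ι B i x = Limits.colimit.ι (diagram B) (Piece.whole B i)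
      (⟨x, trivial⟩ : (⊤ : (chart B i).Opens)) := by
  rw [← whole_ι]; rfl

/-- Two points `x`, `y` of the charts `i`, `j` coincide in the glued scheme if and only if `x` lies in a
(dense) open `U` of the `i`-th chart on which the birational map to the `j`-th chart is an open
immersion `φ`, and `φ x = y`. -/
theorem ι_eq_ι_iff (i j : J) (x : chart B i) (y : chart B j) :
    ι B i x = ι B j y ↔ ∃ (U : (chart B i).Opens) (hU : Set.range (generic B i) ⊆ U)
      (φ : U.toScheme ⟶ chart B j) (hx : x ∈ U), IsOpenImmersion φ ∧
      Piece.gen ⟨i, U, hU⟩ ≫ φ = generic B j ∧ φ ⟨x, hx⟩ = y := by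
  rw [ι_apply, ι_apply]
  refine (Scheme.IsLocallyDirected.ι_eq_ι_iff (diagram B) (i := Piece.whole B i)
    (j := Piece.whole B j)).trans ?_
  constructor
  · rintro ⟨P, f, g, (z : P.U.toScheme), hf, hg⟩
    have := f.isOpenImmersion
    have := g.isOpenImmersion
    let F : P.U.toScheme ⟶ chart B i := f.hom ≫ (Piece.whole B i).U.ι
    let G : P.U.toScheme ⟶ chart B j := g.hom ≫ (Piece.whole B j).U.ι
    have hF : P.gen ≫ F = generic B i := by
      simp only [F, ← Category.assoc]; erw [f.gen_hom]; exact Piece.gen_ι _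
    have hG : P.gen ≫ G = generic B j := by
      simp only [G, ← Category.assoc]; erw [g.gen_hom]; exact Piece.gen_ι _
    have hzF : F z = x := congr_arg Subtype.val hf
    have hzG : G z = y := congr_arg Subtype.val hg
    have hU : Set.range (generic B i) ⊆ F.opensRange := by
      rw [← hF]
      rintro _ ⟨w, rfl⟩
      exact ⟨P.gen w, rfl⟩
    refine ⟨F.opensRange, hU, F.isoOpensRange.inv ≫ G, ⟨z, hzF⟩, inferInstance, ?_, ?_⟩
    · have : Piece.gen ⟨i, F.opensRange, hU⟩ = P.gen ≫ F.isoOpensRange.hom := by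
        rw [← cancel_mono F.opensRange.ι, Category.assoc, Scheme.Hom.isoOpensRange_hom_ι, hF]
        exact Piece.gen_ι _
      rw [this]; simpa using hG
    · have : F.isoOpensRange.hom z = ⟨x, ⟨z, hzF⟩⟩ := by
        apply F.opensRange.ι.isOpenEmbedding.injective
        rw [← Scheme.Hom.comp_apply, Scheme.Hom.isoOpensRange_hom_ι, hzF]
        rfl
      rw [← this, ← Scheme.Hom.comp_apply]
      simpa using hzG
  · rintro ⟨U, hU, φ, hx, h1, h2, h3⟩
    let P : Piece B := ⟨i, U, hU⟩
    let f : U.toScheme ⟶ (⊤ : (chart B i).Opens) := (chart B i).homOfLE le_top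
    let g : U.toScheme ⟶ (⊤ : (chart B j).Opens) := φ ≫ (chart B j).topIso.inv
    have hf : P.gen ≫ f = (Piece.whole B i).gen := by
      rw [← cancel_mono (Piece.whole B i).U.ι, Piece.gen_ι, Category.assoc]
      simp only [f, Scheme.homOfLE_ι]
      exact Piece.gen_ι P
    have hg : P.gen ≫ g = (Piece.whole B j).gen := by
      rw [← cancel_mono (Piece.whole B j).U.ι, Piece.gen_ι, Category.assoc]
      simp only [g, Category.assoc]
      erw [Iso.inv_hom_id, Category.comp_id]
      exact h2
    refine ⟨P, ⟨f, inferInstance, hf⟩, ⟨g, inferInstance, hg⟩, ⟨x, hx⟩, ?_, ?_⟩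
    · have h : (f ≫ (⊤ : (chart B i).Opens).ι) ⟨x, hx⟩ = x := by
        simp only [f, Scheme.homOfLE_ι]; rfl
      exact Subtype.ext h
    · have h : (g ≫ (chart B j).topIso.hom) ⟨x, hx⟩ = y := by
        simp only [g, Category.assoc, Iso.inv_hom_id, Category.comp_id]; exact h3
      exact Subtype.ext h

end Gluing

section Laurent

variable (k : Type u) [Field k]

/-- Laurent polynomials over `k` in `N` variables. -/
abbrev Laurent (N : ℕ) : Type u := AddMonoidAlgebra k (Fin N → ℤ)

variable {k}

/-- The Laurent monomial with exponent vector `i`. -/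
noncomputable def mono {N : ℕ} (i : Fin N → ℤ) : Laurent k N := AddMonoidAlgebra.single i 1

/-- The variable `x₁` of `k[x₁^±, y^±]`. -/
noncomputable def xVar : Laurent k 2 := mono (Pi.single 0 1)

/-- The variable `y` of `k[x₁^±, y^±]`. -/
noncomputable def yVar : Laurent k 2 := mono (Pi.single 1 1)

/-- The value `F(x, y)` of a polynomial `F ∈ k[X, Y]`, written as an element of `k[Y][X]`
(outer variable `X`, inner variable `Y`), at elements `x, y` of a `k`-algebra. -/
noncomputable def biEval {R : Type*} [CommRing R] [Algebra k R] (F : k[X][X]) (x y : R) : R :=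
  F.eval₂ (aeval (R := k) y : k[X] →ₐ[k] R).toRingHom x

/-- The Newton polygon of a Laurent polynomial in two variables: the convex hull of its
exponent vectors. -/
def newtonPolygon (f : Laurent k 2) : Set (Fin 2 → ℝ) :=
  convexHull ℝ ((fun (i : Fin 2 → ℤ) (t : Fin 2) => (i t : ℝ)) '' (f.coeff.support : Set _))

/-- `v` is the (primitive, inward) normal vector of an edge of the polygon `P`: the face of `P` on
which the linear form `v` is minimal is not reduced to a point.  If `P` is a segment then `P`
counts as two edges, with opposite normal vectors. -/
def IsEdgeNormal (P : Set (Fin 2 → ℝ)) (v : Fin 2 → ℤ) : Prop :=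
  IsCoprime (v 0) (v 1) ∧
    {a ∈ P | ∀ b ∈ P, v 0 * a 0 + v 1 * a 1 ≤ v 0 * b 0 + v 1 * b 1}.Nontrivial

end Laurent

section Matrices

/-- The position, among `x₁, …, x_{m+1}, y`, of the new variable `x_{m+1}` (here `m = l + 1`). -/
def newPos (l : ℕ) : Fin (l + 3) := (Fin.last (l + 1)).castSucc

/-- Insert into `M` a row and a column for the new variable `x_{m+1}`, just before those of `y`:
the new row is the unit vector `(0, …, 0, 1, 0)` and the rest of the new column is `c`. -/
def borderedMatrix {l : ℕ} (M : Matrix (Fin (l + 2)) (Fin (l + 2)) ℤ) (c : Fin (l + 2) → ℤ) :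
    Matrix (Fin (l + 3)) (Fin (l + 3)) ℤ :=
  Matrix.of ((newPos l).insertNth (α := fun _ => Fin (l + 3) → ℤ) (Pi.single (newPos l) 1)
    (fun i => (newPos l).insertNth (α := fun _ => ℤ) (c i) (M i)))

lemma det_borderedMatrix {l : ℕ} (M : Matrix (Fin (l + 2)) (Fin (l + 2)) ℤ)
    (c : Fin (l + 2) → ℤ) : (borderedMatrix M c).det = M.det := by
  rw [Matrix.det_succ_row _ (newPos l), Finset.sum_eq_single (newPos l)]
  · have : (borderedMatrix M c).submatrix (newPos l).succAbove (newPos l).succAbove = M := by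
      ext i j
      simp [borderedMatrix, Matrix.submatrix_apply]
    rw [this]
    simp [borderedMatrix, ← two_mul]
  · intro b _ hb
    simp [borderedMatrix, Pi.single_eq_of_ne hb]
  · simp

/-- `borderedMatrix` as an element of the special linear group. -/
def bordered {l : ℕ} (M : Matrix.SpecialLinearGroup (Fin (l + 2)) ℤ) (c : Fin (l + 2) → ℤ) :
    Matrix.SpecialLinearGroup (Fin (l + 3)) ℤ :=
  ⟨borderedMatrix M.1 c, by rw [det_borderedMatrix, M.2]⟩

/-- The block diagonal matrix `I_m ⊕ N`, where `m = l + 1`. -/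
def idBlock (l : ℕ) (N : Matrix.SpecialLinearGroup (Fin 2) ℤ) :
    Matrix.SpecialLinearGroup (Fin (l + 3)) ℤ :=
  ⟨Matrix.reindex (finSumFinEquiv (m := l + 1) (n := 2)) (finSumFinEquiv (m := l + 1) (n := 2))
    (Matrix.fromBlocks 1 0 0 N.1), by rw [Matrix.det_reindex_self]; simp⟩

end Matrices

section Charts

variable {k : Type u} [Field k]

variable (k) in
/-- A pair `α = (v, (g₂, …, g_m))`, where `v ∈ ℤ^{m+1}` is primitive and the `g_i` are Laurent
polynomials in `x₁, y`, together with the data that the construction attaches to it.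
Here `m = l + 1`; the variables `x₁, …, x_m, y` are indexed by `Fin (l + 2)`, with `y` last. -/
structure Chart : Type u where
  /-- one less than the number `m` of variables `x₁, …, x_m` -/
  l : ℕ
  /-- the tuple `(g₂, …, g_m)` -/
  g : Fin l → Laurent k 2
  /-- the matrix `M_α` attached to `v`, i.e. with last row `v`; it defines the change of variables
  `(x₁, …, x_m, y) = (X₁, …, X_m, Y) • M_α` -/
  M : Matrix.SpecialLinearGroup (Fin (l + 2)) ℤ
  /-- the index `j_α` -/
  j : Fin (l + 1)
  /-- the polynomial `ℱ_α ∈ k[X_{j_α}, Y]`, as an element of `k[Y][X_{j_α}]` -/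
  F : k[X][X]

namespace Chart

/-- The primitive vector `v`. -/
def v (α : Chart k) : Fin (α.l + 2) → ℤ := α.M.1 (Fin.last _)

/-- The Laurent polynomials in `x₁, y` to which `x₁, x₂, …, x_m, y` are congruent modulo the
ideal `(x₂ - g₂, …, x_m - g_m)`, namely `x₁, g₂, …, g_m, y`. -/
noncomputable def vars (α : Chart k) : Fin (α.l + 2) → Laurent k 2 :=
  Fin.snoc (α := fun _ => Laurent k 2) (Fin.cons (α := fun _ => Laurent k 2) xVar α.g) yVar

/-- The polynomial `f|_α(X) = ℱ_α(X, 0)`. -/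
noncomputable def restr (α : Chart k) : k[X] := α.F.map (evalRingHom 0)

/-- The exponent vector, in the variables `x₁, …, x_m, y`, of the `t`-th of the coordinates
`(X₁, …, X_m, Y) = (x₁, …, x_m, y) • M_α⁻¹`. -/
def coordExp (α : Chart k) (t : Fin (α.l + 2)) : Fin (α.l + 2) → ℤ := fun s => (α.M⁻¹).1 s t

end Chart

/-- The coordinate ring of the curve `C₀ : f = 0` in `𝔾_m²`. -/
abbrev CoordRing (f : Laurent k 2) : Type u := Laurent k 2 ⧸ Ideal.span {f}

/-- The ring `k(C₀)` of rational functions on `C₀`: the total ring of fractions of `k[C₀]`. -/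
def FunctionRing (f : Laurent k 2) : Type u := FractionRing (CoordRing f)

noncomputable instance (f : Laurent k 2) : CommRing (FunctionRing f) :=
  inferInstanceAs (CommRing (FractionRing (CoordRing f)))

noncomputable instance (f : Laurent k 2) : Algebra k (FunctionRing f) :=
  inferInstanceAs (Algebra k (FractionRing (CoordRing f)))

noncomputable instance (f : Laurent k 2) : Algebra (CoordRing f) (FunctionRing f) :=
  inferInstanceAs (Algebra (CoordRing f) (FractionRing (CoordRing f)))

instance (f : Laurent k 2) : IsScalarTower k (CoordRing f) (FunctionRing f) :=
  inferInstanceAs (IsScalarTower k (CoordRing f) (FractionRing (CoordRing f)))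

instance (f : Laurent k 2) : IsFractionRing (CoordRing f) (FunctionRing f) :=
  inferInstanceAs (IsFractionRing (CoordRing f) (FractionRing (CoordRing f)))

/-- The rational function on `C₀` given by a Laurent polynomial. -/
noncomputable def toFunction (f : Laurent k 2) : Laurent k 2 →ₐ[k] FunctionRing f :=
  (IsScalarTower.toAlgHom k (CoordRing f) (FunctionRing f)).comp
    (Ideal.Quotient.mkₐ k (Ideal.span {f}))

/-- The set `Ω`: those `α` for which the open subscheme `C_{0,α}` of `C₀`, on which `g₂, …, g_m`
are invertible, is dense in `C₀`.  As `C₀` is reduced, this means that no `g_i` is a zero divisor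
in `k[C₀]`. -/
def Omega (f : Laurent k 2) : Type u :=
  {α : Chart k // ∀ i, Ideal.Quotient.mk (Ideal.span {f}) (α.g i) ∈ nonZeroDivisors (CoordRing f)}

namespace Omega

variable {f : Laurent k 2} (α : Omega f)

lemma isUnit_mono (i : Fin 2 → ℤ) : IsUnit (mono i : Laurent k 2) :=
  IsUnit.of_mul_eq_one (mono (-i)) (by
    simp [mono, AddMonoidAlgebra.single_mul_single, AddMonoidAlgebra.one_def])

lemma isUnit_vars (t : Fin (α.1.l + 2)) : IsUnit (toFunction f (α.1.vars t)) := by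
  induction t using Fin.lastCases with
  | last =>
    simp only [Chart.vars, Fin.snoc_last]
    exact (isUnit_mono _).map _
  | cast t =>
    simp only [Chart.vars, Fin.snoc_castSucc]
    induction t using Fin.cases with
    | zero => exact (isUnit_mono _).map _
    | succ t => exact IsLocalization.map_units (FunctionRing f) ⟨_, α.2 t⟩

/-- The coordinate `X₁, …, X_m` or `Y` of the chart `C_α`, as an invertible rational function
on `C₀`. -/
noncomputable def coord (t : Fin (α.1.l + 2)) : (FunctionRing f)ˣ :=
  ∏ s, (α.isUnit_vars s).unit ^ α.1.coordExp t s

/-- The coordinate ring of `C_{0,α}` inside `k(C₀)`: the image of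
`k[X₁^±, …, X_m^±, Y^±] ≃ k[x₁^±, …, x_m^±, y^±]`. -/
noncomputable def openRing : Subalgebra k (FunctionRing f) :=
  Algebra.adjoin k {z | ∃ t, z = α.coord t ∨ z = ↑(α.coord t)⁻¹}

/-- The coordinate ring of `C_α` inside `k(C₀)`.  The chart `C_α` is the Zariski closure of
`C_{0,α}` in the toric variety `Spec k[X₁^±, …, X_m^±, Y]`, so its coordinate ring is the image of
`k[X₁^±, …, X_m^±, Y]` in the coordinate ring of `C_{0,α}`. -/
noncomputable def ring : Subalgebra k (FunctionRing f) :=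
  Algebra.adjoin k ({z | ∃ t : Fin (α.1.l + 1), z = α.coord t.castSucc ∨
    z = ↑(α.coord t.castSucc)⁻¹} ∪ {↑(α.coord (Fin.last _))})

/-- The coordinate `Y` on `C_α`. -/
noncomputable def Y : α.ring :=
  ⟨α.coord (Fin.last _), Algebra.subset_adjoin (Or.inr rfl)⟩

/-- The coordinate `X_{j_α}` on `C_α`. -/
noncomputable def Xj : α.ring :=
  ⟨α.coord α.1.j.castSucc, Algebra.subset_adjoin (Or.inl ⟨_, Or.inl rfl⟩)⟩

/-- The coordinate ring of `C̄_α`, the scheme-theoretic intersection of `C_α` with the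
divisor `Y = 0` of the toric variety. -/
abbrev barRing : Type u := α.ring ⧸ Ideal.span {α.Y}

/-- The simple roots of `f|_α` in `k^×`. -/
abbrev SimpleRoots : Type u := {r : k // r ≠ 0 ∧ α.1.restr.rootMultiplicity r = 1}

end Omega

end Charts

section Resolution

variable {k : Type u} [Field k]

/-- The choices made in the construction of `Σ₁`: for every normal vector `v` of an edge of the
Newton polygon of `f`, a matrix attached to `v` and a polynomial `ℱ_α ∈ k[X₁, Y]` such that
`f((X₁, Y) • M_α) = X₁^* Y^* ℱ_α(X₁, Y)` and `Y ∤ ℱ_α`. -/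
structure FirstChoice (f : Laurent k 2) : Type u where
  M : (Fin 2 → ℤ) → Matrix.SpecialLinearGroup (Fin 2) ℤ
  F : (Fin 2 → ℤ) → k[X][X]
  attached : ∀ v, IsEdgeNormal (newtonPolygon f) v → (M v).1 1 = v
  /-- the defining equality, written in the variables `x₁, y`; the columns of `M_α⁻¹` are the
  exponents of `X₁` and `Y` -/
  eq : ∀ v, IsEdgeNormal (newtonPolygon f) v → ∃ s : Fin 2 → ℤ,
    f = mono s * biEval (F v) (mono fun t => ((M v)⁻¹).1 t 0) (mono fun t => ((M v)⁻¹).1 t 1)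
  not_dvd : ∀ v, IsEdgeNormal (newtonPolygon f) v → (F v).map (evalRingHom 0) ≠ 0

/-- The element `(v, ())` of `Ω₁`, with `j_α = 1`. -/
def FirstChoice.chart {f : Laurent k 2} (c : FirstChoice f) (v : Fin 2 → ℤ) : Chart k where
  l := 0
  g := Fin.elim0
  M := c.M v
  j := 0
  F := c.F v

/-- The set `Σ₁` of all `(v, ())`, where `v` is the normal vector of an edge of the Newton polygon
of `f`. -/
def FirstChoice.charts {f : Laurent k 2} (c : FirstChoice f) : Set (Omega f) :=
  {α | ∃ v, IsEdgeNormal (newtonPolygon f) v ∧ α.1 = c.chart v}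

namespace Chart

/-- `g ∈ k[x₁, …, x_m, y]` is related by `M_α` to `G̃ = X_{j_α} - q(Y)`, with monomial factor
`𝐱^s`: one has `g = 𝐱^s · G̃((x₁, …, x_m, y) • M_α⁻¹)`, and no variable divides `g`. -/
def IsRelated (α : Chart k) (q : k[X]) (s : Fin (α.l + 2) → ℤ)
    (g : MvPolynomial (Fin (α.l + 2)) k) : Prop :=
  MvPolynomial.aeval (fun t => (mono (Pi.single t 1) : Laurent k (α.l + 2))) g =
      mono s * (mono (α.coordExp α.j.castSucc) - aeval (mono (α.coordExp (Fin.last _))) q) ∧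
    ∀ t, ¬ MvPolynomial.X t ∣ g

/-- The tuple `(g₂, …, g_m, g_{m+1})`, where `g_{m+1}` is the Laurent polynomial in `x₁, y`
congruent to `g ∈ k[x₁, …, x_m, y]` modulo `(x₂ - g₂, …, x_m - g_m)`. -/
noncomputable def extendTuple (α : Chart k) (g : MvPolynomial (Fin (α.l + 2)) k) :
    Fin (α.l + 1) → Laurent k 2 :=
  Fin.snoc (α := fun _ => Laurent k 2) α.g (MvPolynomial.aeval α.vars g)

/-- The matrix `M_{α_p}` (or `M_{α̃}`) attached to `(0,1) ∘_g v`, where `g = 𝐱^s · G̃` via `M_α`.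
As `𝐱^s = X₁^{n₁} ⋯ X_m^{n_m} Y^{ord_v(g)}` with `(n₁, …, n_m, ord_v(g)) = M_α s`, this vector is
what has to be put into the column of `x_{m+1}`; then `x_{m+1} = 𝐱^s · X̃_{m+1}`. -/
def extendMatrix (α : Chart k) (s : Fin (α.l + 2) → ℤ) :
    Matrix.SpecialLinearGroup (Fin (α.l + 3)) ℤ :=
  bordered α.M (α.M.1.mulVec s)

/-- The element `α̃ = (0,1) ∘_g α`, with `j_{α̃} = j_α` and `ℱ_{α̃} = ℱ_α`. -/
noncomputable def remove (α : Chart k) (g : MvPolynomial (Fin (α.l + 2)) k)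
    (s : Fin (α.l + 2) → ℤ) : Chart k where
  l := α.l + 1
  g := α.extendTuple g
  M := α.extendMatrix s
  j := α.j.castSucc
  F := α.F

/-- The element `γ = β ∘_g α`, where `β` is the last row of `N = M_β`, with
`M_γ = (I_m ⊕ M_β) · M_{α_p}`, `j_γ = m + 1` and `ℱ_γ = F`. -/
noncomputable def blowup (α : Chart k) (g : MvPolynomial (Fin (α.l + 2)) k)
    (s : Fin (α.l + 2) → ℤ) (N : Matrix.SpecialLinearGroup (Fin 2) ℤ) (F : k[X][X]) : Chart k where
  l := α.l + 1
  g := α.extendTuple g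
  M := idBlock α.l N * α.extendMatrix s
  j := Fin.last _
  F := F

/-- The normal form `ℱ_{α,p} ∈ k[X̃_{m+1}, Ỹ]` of `ℱ_α` by `X̃_{m+1} - G̃_p` with respect to the
lexicographic order `X_{j_α} > X̃_{m+1} > Ỹ`.  As `G̃_p = X_{j_α} - q(Ỹ)`, it is
`ℱ_α(X̃_{m+1} + q(Ỹ), Ỹ)`. -/
noncomputable def normalForm (α : Chart k) (q : k[X]) : k[X][X] := α.F.comp (X + C q)

end Chart

/-- A point of an affine scheme at which the scheme is singular. -/
def IsSingularPoint {R : Type*} [CommRing R] (p : PrimeSpectrum R) : Prop :=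
  ¬ IsRegularLocalRing (Localization.AtPrime p.asIdeal)

/-- A primitive vector with positive entries. -/
def IsPositivePrimitive (β : Fin 2 → ℤ) : Prop := IsCoprime (β 0) (β 1) ∧ 0 < β 0 ∧ 0 < β 1

/-- The choices made in the construction of `Σ_{n+1}` from `Σ_n`. -/
structure ResolvingData {f : Laurent k 2} (Sig : Set (Omega f)) : Type u where
  α : Omega f
  α_mem : α ∈ Sig
  /-- a finite set `𝒮` of points of `C̄_α` -/
  S : Finset (PrimeSpectrum α.barRing)
  /-- every point of `𝒮` is a singular point of `C̄_α` -/
  singular : ∀ p ∈ S, IsSingularPoint p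
  /-- the polynomial `q_p ∈ k[Y]` such that `G̃_p = X_{j_α} - q_p(Y)` -/
  q : PrimeSpectrum α.barRing → k[X]
  /-- `Ḡ_p = X_{j_α} - q_p(0)`, which is congruent to `G̃_p` modulo `Y`, vanishes at `p` -/
  q_spec : ∀ p ∈ S,
    Ideal.Quotient.mk _ (α.Xj - algebraMap k α.ring ((q p).eval 0)) ∈ p.asIdeal
  /-- `G̃_p ∤ ℱ_α` -/
  not_dvd : ∀ p ∈ S, ¬ (X - C (q p)) ∣ α.1.F
  /-- the polynomial `g_p` related to `G̃_p` by `M_α`, and the corresponding monomial factor -/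
  g : PrimeSpectrum α.barRing → MvPolynomial (Fin (α.1.l + 2)) k
  s : PrimeSpectrum α.barRing → Fin (α.1.l + 2) → ℤ
  related : ∀ p ∈ S, α.1.IsRelated (q p) (s p) (g p)
  /-- a matrix attached to `β`, for every primitive `β ∈ ℤ₊²` -/
  M : PrimeSpectrum α.barRing → (Fin 2 → ℤ) → Matrix.SpecialLinearGroup (Fin 2) ℤ
  attached : ∀ p ∈ S, ∀ β, IsPositivePrimitive β → (M p β).1 1 = β
  /-- the polynomial `ℱ_γ ∈ k[X_{m+1}, Y]`, where `γ = β ∘_{g_p} α` -/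
  F : PrimeSpectrum α.barRing → (Fin 2 → ℤ) → k[X][X]
  /-- `ℱ_{α,p}((X_{m+1}, Y) • M_β) = X_{m+1}^* Y^* ℱ_γ(X_{m+1}, Y)` -/
  eq : ∀ p ∈ S, ∀ β, IsPositivePrimitive β → ∃ n : Fin 2 → ℤ,
    biEval (α.1.normalForm (q p)) (mono fun t => (M p β).1 t 0) (mono fun t => (M p β).1 t 1) =
      (mono n * biEval (F p β) xVar yVar : Laurent k 2)
  /-- `Y ∤ ℱ_γ` -/
  not_Y_dvd : ∀ p ∈ S, ∀ β, IsPositivePrimitive β → (F p β).map (evalRingHom 0) ≠ 0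

namespace ResolvingData

variable {f : Laurent k 2} {Sig : Set (Omega f)} (d : ResolvingData Sig)

/-- The element `α̃ = (0,1) ∘_{g_𝒮} α`, where `g_𝒮` is the product of the `g_p` for `p ∈ 𝒮`. -/
noncomputable def tilde : Chart k := d.α.1.remove (∏ p ∈ d.S, d.g p) (∑ p ∈ d.S, d.s p)

/-- The element `β ∘_{g_p} α`. -/
noncomputable def blowup (p : PrimeSpectrum d.α.barRing) (β : Fin 2 → ℤ) : Chart k :=
  d.α.1.blowup (d.g p) (d.s p) (d.M p β) (d.F p β)

/-- The set `Σ_{n+1} = (Σ_n ∖ {α}) ∪ {α̃} ∪ ⋃_{p ∈ 𝒮} Σ_p`, where `Σ_p` is the set of all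
`γ = β ∘_{g_p} α` with `β ∈ ℤ₊²` primitive and `C_{0,γ} ⊊ C_γ`. -/
def next : Set (Omega f) :=
  (Sig \ {d.α}) ∪ {γ | γ.1 = d.tilde} ∪
    {γ | ∃ p ∈ d.S, ∃ β, IsPositivePrimitive β ∧ γ.1 = d.blowup p β ∧ γ.ring ≠ γ.openRing}

end ResolvingData

/-- A simple Baker's resolution of `C₀ : f = 0`, given by the sets `Σ_n ⊂ Ω`, `n ≥ 1`, which
determine the curves `C_n`; the value at `n = 0` is irrelevant. -/
structure SimpleBakerResolution (f : Laurent k 2) : Type u where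
  Sig : ℕ → Set (Omega f)
  first : ∃ c : FirstChoice f, Sig 1 = c.charts
  step : ∀ n, 1 ≤ n → ∃ d : ResolvingData (Sig n), Sig (n + 1) = d.next

variable {f : Laurent k 2}

/-- The coordinate rings, inside `k(C₀)`, of the charts of `C_n`: those of `C₀` (index `none`) and
of `C_γ` for `γ ∈ Σ_n`. -/
noncomputable def chartRing (Sig : Set (Omega f)) : Option Sig → Subalgebra k (FunctionRing f)
  | none => (toFunction f).range
  | some γ => γ.1.ring

/-- The curve `C_n = ⋃_{γ ∈ Σ_n} C_γ ∪ C₀`. -/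
noncomputable def curve (Sig : Set (Omega f)) : Scheme.{u} := glued (chartRing Sig)

/-- The structure morphism of `C_n`. -/
noncomputable def curveOver (Sig : Set (Omega f)) : curve Sig ⟶ Spec (CommRingCat.of k) :=
  gluedOver (chartRing Sig)

/-- The set `C_n(k)` of `k`-rational points. -/
abbrev curvePoints (Sig : Set (Omega f)) : Type u :=
  {P : Spec (CommRingCat.of k) ⟶ curve Sig // P ≫ curveOver Sig = 𝟙 _}

/-- The point of `C_n` belongs to the open subscheme `C₀`. -/
def InC₀ {Sig : Set (Omega f)} (P : curvePoints Sig) : Prop :=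
  ∃ Q : Spec (CommRingCat.of k) ⟶ chart (chartRing Sig) none, Q ≫ ι (chartRing Sig) none = P.1

/-- The curve `C_n` is outer regular: `C̄_γ` is regular for all `γ ∈ Σ_n`. -/
def OuterRegular (Sig : Set (Omega f)) : Prop := ∀ γ ∈ Sig, IsRegularRing γ.barRing

/-- The `k`-rational point of `C_n` given by a `k`-rational point of the chart `C_γ`, i.e. by a
homomorphism of `k`-algebras `k[C_γ] → k`. -/
noncomputable def chartPoint {Sig : Set (Omega f)} (γ : Sig) (Q : γ.1.ring →ₐ[k] k) :
    Spec (CommRingCat.of k) ⟶ curve Sig :=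
  Spec.map (CommRingCat.ofHom Q.toRingHom) ≫ ι (chartRing Sig) (some γ)

end Resolution

end BakerModel

/-! Although `C_γ` is embedded in a space of dimension `m + 1`, it is an open part of a plane curve.
Inside `k(C₀)` its coordinate ring is `(k[X, Y]/(ℱ_γ))[1/h]`, with `X = X_{j_γ}` and a suitable
polynomial `h` divisible by `X`; this is `IsPlaneModel`. The model is carried along the
construction. For `Σ₁` one has `h = X`. Passing to `α̃` multiplies `h` by the `X - q_p(Y)`. For `β
∘_{g_p} α` the equations `X - q_p(Y) = z^* w^{β₁}`, `Y = z^* w^{β₂}` express the old coordinates in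
the new ones `z`, `w`, and `h` is rewritten in `z`, `w`.

Setting `Y = 0`, the scheme `C̄_γ` is open in the scheme of zeros of `f|_γ`
(`IsPlaneModel.isLineModel`), and it is regular at a rational point exactly when the root is simple.
No nonzero simple root is lost through `h`, because only centres of singular points, that is
multiple roots, are removed. So under outer regularity the rational points of `C̄_γ` are the nonzero
simple roots of `f|_γ`.

It remains to see that the points of `C_n` outside `C₀` are the disjoint union of the points of the
`C̄_γ`. A point of `C_γ` with `Y ≠ 0` lies in `C_{0,γ} ⊆ C₀`. A point with `Y = 0` is not in `C₀`,
since a unit of `k[x₁^±, y^±]` is a multiple of `Y` and vanishes there. Points of different charts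
stay different in the glueing: coinciding points are `Joint`, so a function vanishing at one of them
cannot have an inverse that is regular at the other. Testing this on monomials recovers `v` for
`Σ₁`, and `β` for a given centre; different centres are separated by the value of `X_{j_α}`.

`IsGoodSet` collects the model, the unit and the separation of charts;
`SimpleBakerResolution.isGoodSet` proves it by induction and `IsGoodSet.exists_bijection` draws the
conclusion. -/

namespace BakerModel

/-! ### Evaluation of polynomials in two variables. -/

section BiEval

variable {k : Type u} [Field k] {R S : Type*} [CommRing R] [Algebra k R] [CommRing S] [Algebra k S]

/-- Evaluation `F ↦ F(x, y)` as a homomorphism of algebras. -/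
noncomputable def biAeval (x y : R) : k[X][X] →ₐ[k] R :=
  { eval₂RingHom (aeval (R := k) y : k[X] →ₐ[k] R).toRingHom x with
    commutes' := fun c => by
      change eval₂ _ _ (C (C c)) = _
      rw [eval₂_C]
      exact (aeval (R := k) y).commutes c }

@[simp]
lemma biAeval_X (x y : R) : biAeval x y (X : k[X][X]) = x := eval₂_X _ _

@[simp]
lemma biAeval_C (x y : R) (p : k[X]) : biAeval x y (C p) = aeval y p := eval₂_C _ _

lemma biAeval_unique (φ : k[X][X] →ₐ[k] R) : φ = biAeval (φ X) (φ (C X)) := by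
  refine Polynomial.algHom_ext' ?_ (by simp)
  refine Polynomial.algHom_ext ?_
  simp

lemma map_biAeval (φ : R →ₐ[k] S) (x y : R) (F : k[X][X]) :
    φ (biAeval x y F) = biAeval (φ x) (φ y) F := by
  have := biAeval_unique (φ.comp (biAeval (k := k) x y))
  simpa using congr($this F)

lemma biAeval_comp (x y : R) (F G : k[X][X]) :
    biAeval x y (F.comp G) = biAeval (biAeval x y G) y F := by
  induction F using Polynomial.induction_on' with
  | add p q hp hq => simp [hp, hq]
  | monomial n p => simp [← C_mul_X_pow_eq_monomial]

lemma biAeval_zero_right (r : k) (F : k[X][X]) :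
    biAeval r (0 : k) F = (F.map (evalRingHom 0)).eval r := by
  induction F using Polynomial.induction_on' with
  | add p q hp hq => simp [hp, hq]
  | monomial n p => simp [← C_mul_X_pow_eq_monomial, Polynomial.aeval_def, ← eval₂_id]

lemma aeval_zero_eq (q : k[X]) : aeval (0 : k) q = q.eval 0 := by
  simp [Polynomial.aeval_def, ← eval₂_id]

/-- In `k[Y][X]` the variable `Y` is `C X`, and `F.map (evalRingHom 0)` is `F(X, 0)`; the condition
`Y ∤ F` is used below in the form `F(X, 0) ≠ 0`. -/
lemma C_X_dvd_iff (F : k[X][X]) : C X ∣ F ↔ F.map (evalRingHom 0) = 0 := by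
  rw [C_dvd_iff_dvd_coeff, Polynomial.ext_iff]
  simp [X_dvd_iff, coeff_zero_eq_eval_zero]

lemma exists_eq_map_C_add (F : k[X][X]) :
    ∃ G : k[X][X], F = (F.map (evalRingHom 0)).map C + C X * G := by
  obtain ⟨G, hG⟩ := (C_X_dvd_iff (F - (F.map (evalRingHom 0)).map C)).2 (by
    rw [Polynomial.map_sub, Polynomial.map_map]
    have : (evalRingHom 0).comp C = RingHom.id k := by ext; simp
    rw [this, Polynomial.map_id, sub_self])
  exact ⟨G, by rw [← hG]; ring⟩

lemma biAeval_map_C (x y : R) (p : k[X]) : biAeval x y (p.map C) = aeval x p := by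
  induction p using Polynomial.induction_on' with
  | add p q hp hq => simp [hp, hq]
  | monomial n p =>
    simp [← C_mul_X_pow_eq_monomial]

lemma prime_C_X : Prime (C X : k[X][X]) := Polynomial.prime_C_iff.2 Polynomial.prime_X

lemma dvd_of_dvd_C_X_pow_mul {F a : k[X][X]} (hF : F.map (evalRingHom 0) ≠ 0) (n : ℕ)
    (h : F ∣ C X ^ n * a) : F ∣ a := by
  have hF' : ¬ C X ∣ F := fun h => hF ((C_X_dvd_iff F).1 h)
  obtain ⟨c, hc⟩ := h
  have : C X ^ n ∣ c := by
    refine (prime_C_X).pow_dvd_of_dvd_mul_left n hF' ?_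
    exact ⟨a, hc.symm⟩
  obtain ⟨d, rfl⟩ := this
  refine ⟨d, ?_⟩
  have h0 : (C X : k[X][X]) ^ n ≠ 0 := pow_ne_zero _ prime_C_X.ne_zero
  apply mul_left_cancel₀ h0
  rw [hc]; ring

end BiEval

/-! ### Laurent polynomials, monomial substitutions and clearing of denominators. -/

section LaurentRing

variable {k : Type u} [Field k] {N : ℕ}

lemma mono_mul_mono (a b : Fin N → ℤ) : (mono a * mono b : Laurent k N) = mono (a + b) := by
  simp [mono, AddMonoidAlgebra.single_mul_single]

lemma mono_zero : (mono 0 : Laurent k N) = 1 := rfl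

lemma mono_pow (a : Fin N → ℤ) (n : ℕ) : (mono a ^ n : Laurent k N) = mono (n • a) := by
  simp [mono, AddMonoidAlgebra.single_pow]

/-- The unit of the ring of Laurent polynomials given by a monomial. -/
noncomputable def monoUnit (a : Fin N → ℤ) : (Laurent k N)ˣ :=
  ⟨mono a, mono (-a), by rw [mono_mul_mono, add_neg_cancel, mono_zero],
    by rw [mono_mul_mono, neg_add_cancel, mono_zero]⟩

@[simp]
lemma val_monoUnit (a : Fin N → ℤ) : ((monoUnit a : (Laurent k N)ˣ) : Laurent k N) = mono a := rfl

lemma monoUnit_zpow (a : Fin N → ℤ) (n : ℤ) :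
    (monoUnit a : (Laurent k N)ˣ) ^ n = monoUnit (n • a) := by
  have hm : ∀ a b : Fin N → ℤ, (monoUnit a * monoUnit b : (Laurent k N)ˣ) = monoUnit (a + b) :=
    fun a b => Units.ext (mono_mul_mono a b)
  let φ : Multiplicative (Fin N → ℤ) →* (Laurent k N)ˣ :=
    { toFun := fun a => monoUnit a.toAdd
      map_one' := Units.ext mono_zero
      map_mul' := fun a b => (hm _ _).symm }
  exact (map_zpow φ (Multiplicative.ofAdd a) n).symm

/-- The change of variables `𝐱^e ↦ 𝐱^{A e}`. -/
noncomputable def laurentMap (A : Matrix (Fin N) (Fin N) ℤ) : Laurent k N →ₐ[k] Laurent k N :=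
  AddMonoidAlgebra.mapDomainAlgHom k k (A.mulVecLin).toAddMonoidHom

lemma laurentMap_mono (A : Matrix (Fin N) (Fin N) ℤ) (e : Fin N → ℤ) :
    laurentMap A (mono e : Laurent k N) = mono (A.mulVec e) := by
  simp [laurentMap, mono]

/-- The homomorphism from the ring of Laurent polynomials that takes the variables to given units. -/
noncomputable def laurentEval {K : Type*} [CommRing K] [Algebra k K] (z : Fin N → Kˣ) :
    Laurent k N →ₐ[k] K :=
  AddMonoidAlgebra.lift k K (Fin N → ℤ)
    { toFun := fun e => ((∏ i, z i ^ (e.toAdd i) : Kˣ) : K)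
      map_one' := by simp
      map_mul' := fun a b => by
        rw [← Units.val_mul, ← Finset.prod_mul_distrib]
        simp [zpow_add] }

lemma laurentEval_mono {K : Type*} [CommRing K] [Algebra k K] (z : Fin N → Kˣ) (e : Fin N → ℤ) :
    laurentEval z (mono e : Laurent k N) = ((∏ i, z i ^ e i : Kˣ) : K) := by
  simp [laurentEval, mono]

lemma xVar_pow_mul_yVar_pow (i j : ℕ) : (xVar ^ i * yVar ^ j : Laurent k 2) = mono ![i, j] := by
  rw [xVar, yVar, mono_pow, mono_pow, mono_mul_mono]
  congr 1
  ext t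
  fin_cases t <;> simp

/-- The coefficients of a polynomial in the variables of the ring of Laurent polynomials. -/
lemma coeff_biAeval_vars (a : k[X][X]) (i j : ℕ) :
    (biAeval xVar yVar a : Laurent k 2).coeff ![i, j] = (a.coeff i).coeff j := by
  induction a using Polynomial.induction_on' with
  | add p q hp hq => simp [hp, hq]
  | monomial n p =>
    induction p using Polynomial.induction_on' with
    | add p q hp hq => simp [map_add, hp, hq]
    | monomial m c =>
      rw [← C_mul_X_pow_eq_monomial, map_mul, map_pow, biAeval_X, biAeval_C, aeval_monomial,
        mul_assoc, mul_comm (yVar ^ m), xVar_pow_mul_yVar_pow, ← Algebra.smul_def,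
        C_mul_X_pow_eq_monomial, coeff_monomial]
      have : (![(n : ℤ), m] = ![(i : ℤ), j]) ↔ n = i ∧ m = j := by
        constructor
        · intro h
          have h0 := congr_fun h 0
          have h1 := congr_fun h 1
          simp at h0 h1
          exact ⟨h0, h1⟩
        · rintro ⟨rfl, rfl⟩; rfl
      by_cases h1 : n = i <;> by_cases h2 : m = j <;>
        simp [mono, AddMonoidAlgebra.coeff_single, this, h1, h2,
          coeff_monomial]

lemma biAeval_vars_injective :
    Function.Injective (biAeval xVar yVar : k[X][X] →ₐ[k] Laurent k 2) := by
  rw [injective_iff_map_eq_zero]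
  intro a ha
  ext i j
  rw [← coeff_biAeval_vars, ha]
  simp

lemma exists_clear_denominators (a : Laurent k 2) :
    ∃ (i j : ℕ) (A : k[X][X]), xVar ^ i * yVar ^ j * a = biAeval xVar yVar A := by
  induction a using AddMonoidAlgebra.induction_linear with
  | zero => exact ⟨0, 0, 0, by simp⟩
  | add a b ha hb =>
    obtain ⟨i, j, A, hA⟩ := ha
    obtain ⟨i', j', B, hB⟩ := hb
    refine ⟨i + i', j + j', X ^ i' * C X ^ j' * A + X ^ i * C X ^ j * B, ?_⟩
    simp only [map_add, map_mul, map_pow, ← hA, ← hB, biAeval_X, biAeval_C, aeval_X]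
    ring
  | single e c =>
    refine ⟨(-e 0).toNat, (-e 1).toNat,
      C (C c) * X ^ (e 0).toNat * C X ^ (e 1).toNat, ?_⟩
    have : (AddMonoidAlgebra.single e c : Laurent k 2) = algebraMap k _ c * mono e := by
      rw [← Algebra.smul_def]; simp [mono]
    rw [this]
    simp only [map_mul, map_pow, biAeval_X, biAeval_C, aeval_X, aeval_C, mul_assoc]
    rw [mul_left_comm _ (algebraMap k _ c), mul_left_comm _ (algebraMap k _ c)]
    congr 1
    rw [xVar_pow_mul_yVar_pow, ← mul_assoc, xVar_pow_mul_yVar_pow, mono_mul_mono]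
    congr 1
    ext t
    fin_cases t <;> simp <;> omega

/-- Divisibility in the ring of Laurent polynomials, in terms of polynomials. -/
lemma dvd_of_biAeval_vars_dvd {F h a : k[X][X]} (hF : F.map (evalRingHom 0) ≠ 0) (hX : X ∣ h)
    (hd : (biAeval xVar yVar F : Laurent k 2) ∣ biAeval xVar yVar a) : ∃ n, F ∣ h ^ n * a := by
  obtain ⟨c, hc⟩ := hd
  obtain ⟨i, j, A, hA⟩ := exists_clear_denominators c
  have h1 : C X ^ j * (X ^ i * a) = F * A := by
    apply biAeval_vars_injective
    simp only [map_mul, map_pow, biAeval_X, biAeval_C, aeval_X, hc, ← hA]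
    ring
  -- Powers of `Y` cancel because `Y ∤ F`. Powers of `X` may not, and are absorbed into `h`, which
  -- `X` divides.
  have h2 : F ∣ X ^ i * a := dvd_of_dvd_C_X_pow_mul hF j ⟨A, h1⟩
  exact ⟨i, h2.trans (mul_dvd_mul_right (pow_dvd_pow_of_dvd hX i) a)⟩

end LaurentRing

/-! ### Open parts of plane curves and their rational points on `Y = 0`. -/

section PlaneModel

variable {k : Type u} [Field k] {K : Type u} [CommRing K] [Algebra k K]

/-- The elements `b` of `K` with `h(x, y)^N b = a(x, y)` for some `N` and some polynomial `a`. -/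
noncomputable def fracSub (x y : K) (h : k[X][X]) : Subalgebra k K where
  carrier := {b | ∃ (N : ℕ) (a : k[X][X]), biAeval x y h ^ N * b = biAeval x y a}
  mul_mem' := by
    rintro b b' ⟨N, a, e⟩ ⟨N', a', e'⟩
    exact ⟨N + N', a * a', by rw [map_mul, ← e, ← e']; ring⟩
  add_mem' := by
    rintro b b' ⟨N, a, e⟩ ⟨N', a', e'⟩
    exact ⟨N + N', h ^ N' * a + h ^ N * a', by
      rw [map_add, map_mul, map_mul, map_pow, map_pow, ← e, ← e']; ring⟩
  algebraMap_mem' c := ⟨0, algebraMap k _ c, by simp only [AlgHom.commutes]; simp⟩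

lemma biAeval_mem_fracSub (x y : K) (h a : k[X][X]) : biAeval x y a ∈ fracSub x y h :=
  ⟨0, a, by simp⟩

lemma left_mem_fracSub (x y : K) (h : k[X][X]) : x ∈ fracSub x y h := ⟨0, X, by simp⟩

lemma right_mem_fracSub (x y : K) (h : k[X][X]) : y ∈ fracSub x y h := ⟨0, C X, by simp⟩

lemma inv_mem_fracSub {x y : K} {h g : k[X][X]} (hg : g ∣ h) {c : K}
    (hc : biAeval x y g * c = 1) : c ∈ fracSub x y h := by
  obtain ⟨a, rfl⟩ := hg
  exact ⟨1, a, by rw [map_mul, pow_one, mul_right_comm, hc, one_mul]⟩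

lemma biAeval_mem {B : Subalgebra k K} {x y : K} (hx : x ∈ B) (hy : y ∈ B) (a : k[X][X]) :
    biAeval x y a ∈ B := by
  have := map_biAeval B.val ⟨x, hx⟩ ⟨y, hy⟩ a
  change _ = biAeval x y a at this
  rw [← this]
  exact Subtype.property _

/-- The subalgebra `B` of `K` is the coordinate ring `k[x, y, 1/h(x, y)]` of an open subscheme of the
plane curve `F(x, y) = 0`, which contains all points `(r, 0)` with `r ≠ 0` a simple root of
`F(X, 0)`. -/
structure IsPlaneModel (B : Subalgebra k K) (x y : K) (F h : k[X][X]) : Prop where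
  x_mem : x ∈ B
  y_mem : y ∈ B
  eval_eq_zero : biAeval x y F = 0
  exists_inv : ∃ c ∈ B, biAeval x y h * c = 1
  X_dvd : X ∣ h
  restr_ne_zero : F.map (evalRingHom 0) ≠ 0
  le_fracSub : B ≤ fracSub x y h
  dvd_of_eval_eq_zero : ∀ a, biAeval x y a = 0 → ∃ N, F ∣ h ^ N * a
  ne_zero_of_simple : ∀ r ≠ 0, (F.map (evalRingHom 0)).rootMultiplicity r = 1 →
    biAeval r (0 : k) h ≠ 0

namespace IsPlaneModel

variable {B : Subalgebra k K} {x y : K} {F h : k[X][X]}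

section Points

variable (H : IsPlaneModel B x y F h)
include H

lemma exists_inv' : ∃ c : B, biAeval (⟨x, H.x_mem⟩ : B) ⟨y, H.y_mem⟩ h * c = 1 := by
  obtain ⟨c, hc, h1⟩ := H.exists_inv
  refine ⟨⟨c, hc⟩, Subtype.val_injective ?_⟩
  have := map_biAeval B.val (⟨x, H.x_mem⟩ : B) ⟨y, H.y_mem⟩ h
  change (biAeval (⟨x, H.x_mem⟩ : B) ⟨y, H.y_mem⟩ h : K) = _ at this
  change (biAeval (⟨x, H.x_mem⟩ : B) ⟨y, H.y_mem⟩ h : K) * c = 1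
  rw [this]
  exact h1

/-- Since `h(x, y)` is a unit of `B`, every element of `B` is a fraction `a(x, y) / h(x, y)^N`, so a
point is determined by its two coordinates. -/
lemma hom_ext {Q Q' : B →ₐ[k] k} (hy : Q ⟨y, H.y_mem⟩ = Q' ⟨y, H.y_mem⟩)
    (hx : Q ⟨x, H.x_mem⟩ = Q' ⟨x, H.x_mem⟩) : Q = Q' := by
  ext b
  obtain ⟨N, a, e⟩ := H.le_fracSub b.2
  obtain ⟨c, hc⟩ := H.exists_inv'
  have e' : biAeval (⟨x, H.x_mem⟩ : B) ⟨y, H.y_mem⟩ h ^ N * b =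
      biAeval (⟨x, H.x_mem⟩ : B) ⟨y, H.y_mem⟩ a := by
    apply Subtype.val_injective
    have := map_biAeval B.val (⟨x, H.x_mem⟩ : B) ⟨y, H.y_mem⟩ h
    have h2 := map_biAeval B.val (⟨x, H.x_mem⟩ : B) ⟨y, H.y_mem⟩ a
    change (biAeval (⟨x, H.x_mem⟩ : B) ⟨y, H.y_mem⟩ h : K) = _ at this
    change (biAeval (⟨x, H.x_mem⟩ : B) ⟨y, H.y_mem⟩ a : K) = _ at h2
    rw [h2]
    change (biAeval (⟨x, H.x_mem⟩ : B) ⟨y, H.y_mem⟩ h : K) ^ N * b = _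
    rw [this]
    exact e
  have e1 := congr_arg Q e'
  have e2 := congr_arg Q' e'
  have c1 := congr_arg Q hc
  simp only [map_mul, map_pow, map_biAeval, map_one] at e1 e2 c1
  rw [← hx, ← hy, ← e1] at e2
  exact (mul_left_cancel₀ (pow_ne_zero _ (left_ne_zero_of_mul_eq_one c1)) e2).symm

/-- The point is `a(x, y) / h(x, y)^N ↦ a(r, 0) / h(r, 0)^N`, which makes sense because `h(r, 0) ≠
0` at a simple root. -/
lemma exists_hom {r : k} (hr : r ≠ 0) (hs : (F.map (evalRingHom 0)).rootMultiplicity r = 1) :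
    ∃ Q : B →ₐ[k] k, Q ⟨y, H.y_mem⟩ = 0 ∧ Q ⟨x, H.x_mem⟩ = r := by
  have hh := H.ne_zero_of_simple r hr hs
  have hF : biAeval r (0 : k) F = 0 := by
    rw [biAeval_zero_right, ← IsRoot.def, ← rootMultiplicity_pos H.restr_ne_zero, hs]
    exact one_pos
  choose N a hNa using fun b : B => H.le_fracSub b.2
  -- Independence of the chosen fraction: two numerators over a common denominator differ by a
  -- multiple of `F`, up to powers of `h`, and `F(r, 0) = 0`. Each homomorphism axiom then amounts
  -- to exhibiting one suitable fraction.
  have key : ∀ (b : B) (N' : ℕ) (a' : k[X][X]), biAeval x y h ^ N' * b = biAeval x y a' →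
      biAeval r (0 : k) (a b) / biAeval r (0 : k) h ^ N b =
        biAeval r (0 : k) a' / biAeval r (0 : k) h ^ N' := by
    intro b N' a' e
    obtain ⟨M, c, hc⟩ := H.dvd_of_eval_eq_zero (h ^ N' * a b - h ^ N b * a') (by
      simp only [map_sub, map_mul, map_pow, ← hNa, ← e]; ring)
    have := congr_arg (biAeval r (0 : k)) hc
    simp only [map_sub, map_mul, map_pow, hF, zero_mul] at this
    have := (mul_eq_zero.1 this).resolve_left (pow_ne_zero _ hh)
    rw [div_eq_div_iff (pow_ne_zero _ hh) (pow_ne_zero _ hh)]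
    linear_combination this
  refine ⟨{ toFun := fun b => biAeval r (0 : k) (a b) / biAeval r (0 : k) h ^ N b
            map_one' := ?_, map_mul' := ?_, map_zero' := ?_, map_add' := ?_, commutes' := ?_ },
    ?_, ?_⟩
  · rw [key 1 0 1 (by simp)]; simp
  · intro b b'
    rw [key (b * b') (N b + N b') (a b * a b') (by
      rw [map_mul, ← hNa, ← hNa, Subalgebra.coe_mul]; ring), map_mul, pow_add]
    field_simp
  · rw [key 0 0 0 (by simp)]; simp
  · intro b b'
    rw [key (b + b') (N b + N b') (h ^ N b' * a b + h ^ N b * a b') (by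
      simp only [map_add, map_mul, map_pow, ← hNa, Subalgebra.coe_add]; ring)]
    simp only [map_add, map_mul, map_pow, pow_add]
    field_simp
  · intro c
    rw [key (algebraMap k B c) 0 (algebraMap k _ c) (by rw [AlgHom.commutes]; simp)]
    rw [AlgHom.commutes]; simp
  · refine (key _ 0 (C X) (by simp)).trans (by simp)
  · refine (key _ 0 X (by simp)).trans (by simp)

end Points

end IsPlaneModel

end PlaneModel

/-! ### Regularity at a principal prime that is locally nilpotent. -/

section Regularity

variable {A : Type*} [CommRing A] (p : Ideal A) [p.IsPrime] {t : A}

lemma map_prime_span_singleton (hp : p = Ideal.span {t}) :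
    IsLocalRing.maximalIdeal (Localization.AtPrime p) =
      Ideal.span {algebraMap A (Localization.AtPrime p) t} := by
  rw [← IsLocalization.AtPrime.map_eq_maximalIdeal p (Localization.AtPrime p)]
  rw [← Set.image_singleton, ← Ideal.map_span]
  exact congr_arg _ hp

/-- If a principal prime ideal is nilpotent locally at this prime, and if the localization is regular,
then the localization is a field. -/
lemma exists_mul_eq_zero_of_isRegularLocalRing (hp : p = Ideal.span {t}) {u : A} (hu : u ∉ p)
    {m : ℕ} (h : u * t ^ m = 0) (hreg : IsRegularLocalRing (Localization.AtPrime p)) :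
    ∃ s, s ∉ p ∧ s * t = 0 := by
  let R := Localization.AtPrime p
  have hmax := map_prime_span_singleton p hp
  have hnil : algebraMap A R t ^ m = 0 := by
    have hunit : IsUnit (algebraMap A R u) := IsLocalization.map_units R (⟨u, hu⟩ : p.primeCompl)
    refine (hunit.mul_right_eq_zero).1 ?_
    rw [← map_pow, ← map_mul, h, map_zero]
  -- The generator of the maximal ideal is nilpotent, hence lies in every prime. In dimension zero,
  -- regularity says that the maximal ideal needs no generators, so it vanishes.
  have hdim : Ring.KrullDimLE 0 R := by
    refine Ring.KrullDimLE.mk₀ fun I hI => ?_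
    have h1 : algebraMap A R t ∈ I := hI.mem_of_pow_mem m (by rw [hnil]; exact I.zero_mem)
    have h2 : IsLocalRing.maximalIdeal R ≤ I := by
      rw [hmax, Ideal.span_singleton_le_iff_mem]; exact h1
    rw [← (IsLocalRing.maximalIdeal.isMaximal R).eq_of_le hI.ne_top h2]
    exact IsLocalRing.maximalIdeal.isMaximal R
  have h0 : (IsLocalRing.maximalIdeal R).spanFinrank = 0 := by
    have h1 := hreg.spanFinrank_maximalIdeal
    have h2 : ((IsLocalRing.maximalIdeal R).spanFinrank : WithBot ℕ∞) ≤ 0 :=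
      h1.le.trans (Ring.krullDimLE_iff.1 hdim)
    exact_mod_cast le_antisymm h2 (by exact_mod_cast Nat.zero_le _)
  rw [Submodule.spanFinrank_eq_zero_iff_eq_bot (IsNoetherian.noetherian _), hmax,
    Ideal.span_singleton_eq_bot, IsLocalization.map_eq_zero_iff p.primeCompl] at h0
  obtain ⟨s, hs⟩ := h0
  exact ⟨s, s.2, hs⟩

/-- If a prime ideal is principal and zero locally at this prime, the localization is regular. -/
lemma isRegularLocalRing_of_mul_eq_zero (hp : p = Ideal.span {t}) {s : A} (hs : s ∉ p)
    (h : s * t = 0) : IsRegularLocalRing (Localization.AtPrime p) := by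
  have h0 : algebraMap A (Localization.AtPrime p) t = 0 :=
    (IsLocalization.map_eq_zero_iff p.primeCompl _ t).2 ⟨⟨s, hs⟩, h⟩
  have hf : IsField (Localization.AtPrime p) := by
    rw [IsLocalRing.isField_iff_maximalIdeal_eq, map_prime_span_singleton p hp, h0,
      Ideal.span_singleton_eq_bot]
  let := hf.toField
  have : IsDomain (Localization.AtPrime p) := hf.isDomain
  have : IsPrincipalIdealRing (Localization.AtPrime p) := inferInstance
  infer_instance

end Regularity

/-! ### Open parts of the scheme of zeros of a polynomial in one variable. -/

section LineModel

variable {k : Type u} [Field k] {A : Type*} [CommRing A] [Algebra k A]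

/-- The `k`-algebra `A` is the coordinate ring `k[x, 1/h(x)]` of an open subscheme of the scheme of
zeros `F(x) = 0` of a nonzero polynomial in one variable. -/
structure IsLineModel (A : Type*) [CommRing A] [Algebra k A] (x : A) (F h : k[X]) : Prop where
  ne_zero : F ≠ 0
  isUnit : IsUnit (aeval x h)
  aeval_eq_zero : aeval x F = 0
  exists_num : ∀ b : A, ∃ (N : ℕ) (a : k[X]), aeval x h ^ N * b = aeval x a
  dvd_of_aeval_eq_zero : ∀ a, aeval x a = 0 → ∃ N, F ∣ h ^ N * a

namespace IsLineModel

variable {x : A} {F h : k[X]} (H : IsLineModel A x F h)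

lemma sub_dvd_aeval_sub (r : k) (a : k[X]) :
    x - algebraMap k A r ∣ aeval x a - algebraMap k A (a.eval r) := by
  have : X - C r ∣ a - C (a.eval r) := by
    rw [dvd_iff_isRoot]; simp
  simpa using map_dvd (aeval x) this

variable {p : Ideal A} [hp : p.IsPrime] {r : k} (hr : x - algebraMap k A r ∈ p)
include hr

/-- Modulo `p` the element `a(x)` is the constant `a(r)`, and a nonzero constant is a unit. -/
lemma aeval_mem_iff (a : k[X]) : aeval x a ∈ p ↔ a.eval r = 0 := by
  have h1 : aeval x a - algebraMap k A (a.eval r) ∈ p :=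
    Ideal.mem_of_dvd p (sub_dvd_aeval_sub r a) hr
  constructor
  · intro h2
    by_contra h3
    apply hp.ne_top
    have h4 : algebraMap k A (a.eval r) ∈ p := by
      have := p.sub_mem h2 h1
      simpa using this
    exact Ideal.eq_top_of_isUnit_mem _ h4 ((isUnit_iff_ne_zero.2 h3).map _)
  · intro h2
    simpa [h2] using h1

include H

lemma eval_ne_zero : h.eval r ≠ 0 := by
  intro h0
  exact hp.ne_top (Ideal.eq_top_of_isUnit_mem _ ((aeval_mem_iff hr h).2 h0) H.isUnit)

lemma eval_eq_zero : F.eval r = 0 := by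
  rw [← aeval_mem_iff hr, H.aeval_eq_zero]
  exact p.zero_mem

/-- Up to a unit an element of `p` is some `a(x)` with `a(r) = 0`, hence a multiple of `x - r`. In
particular `r` determines `p`. -/
lemma eq_span : p = Ideal.span {x - algebraMap k A r} := by
  refine le_antisymm (fun b hb => ?_) ((Ideal.span_singleton_le_iff_mem _).2 hr)
  obtain ⟨N, a, e⟩ := H.exists_num b
  have h1 : a.eval r = 0 := by
    rw [← aeval_mem_iff hr, ← e]
    exact p.mul_mem_left _ hb
  have h2 := sub_dvd_aeval_sub (x := x) r a
  rw [h1, map_zero, sub_zero, ← e, (H.isUnit.pow N).dvd_mul_left] at h2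
  exact Ideal.mem_span_singleton.2 h2

/-- At a regular point, the polynomial has a simple root. -/
lemma rootMultiplicity_eq_one (hreg : IsRegularLocalRing (Localization.AtPrime p)) :
    F.rootMultiplicity r = 1 := by
  obtain ⟨u, hu, hur⟩ := exists_eq_pow_rootMultiplicity_mul_and_not_dvd F H.ne_zero r
  have hpos : 0 < F.rootMultiplicity r :=
    (rootMultiplicity_pos H.ne_zero).2 (H.eval_eq_zero hr)
  -- Write `F = (X - r)^m u` with `u(r) ≠ 0`. Then `u(x) ∉ p` kills `(x - r)^m`, so `x - r` is
  -- locally nilpotent, and regularity makes it locally zero.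
  obtain ⟨s, hs, hs0⟩ := exists_mul_eq_zero_of_isRegularLocalRing p (H.eq_span hr)
    (u := aeval x u) (m := F.rootMultiplicity r) (by
      rw [aeval_mem_iff hr]; rwa [dvd_iff_isRoot] at hur) (by
      have := H.aeval_eq_zero
      rw [hu] at this
      rw [mul_comm]
      simpa using this) hreg
  obtain ⟨N, a, e⟩ := H.exists_num s
  have ha : a.eval r ≠ 0 := by
    rw [Ne, ← aeval_mem_iff hr, ← e]
    exact fun h => (hp.mem_or_mem h).elim
      (fun h => hp.ne_top (Ideal.eq_top_of_isUnit_mem _ h (H.isUnit.pow N))) hs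
  obtain ⟨M, hM⟩ := H.dvd_of_aeval_eq_zero (a * (X - C r)) (by
    rw [map_mul, ← e]
    simp only [map_sub, aeval_X, aeval_C]
    rw [mul_assoc, hs0, mul_zero])
  by_contra hne
  -- At a multiple root, `X - r` would divide `h^M a`, neither factor of which vanishes at `r`.
  have h2 : (X - C r) ^ 2 ∣ F := by
    rw [← le_rootMultiplicity_iff H.ne_zero]; omega
  have h3 : (X - C r) * (X - C r) ∣ (h ^ M * a) * (X - C r) := by
    rw [← pow_two, mul_assoc]; exact h2.trans hM
  have h4 := (mul_dvd_mul_iff_right (X_sub_C_ne_zero r)).1 h3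
  rw [dvd_iff_isRoot, IsRoot.def, eval_mul, eval_pow] at h4
  exact mul_ne_zero (pow_ne_zero _ (H.eval_ne_zero hr)) ha h4

/-- At a simple root, the scheme of zeros is regular. -/
lemma isRegularLocalRing (hs : F.rootMultiplicity r = 1) :
    IsRegularLocalRing (Localization.AtPrime p) := by
  obtain ⟨u, hu, hur⟩ := exists_eq_pow_rootMultiplicity_mul_and_not_dvd F H.ne_zero r
  -- Here `F = (X - r) u`, so `u(x) ∉ p` kills the generator `x - r` of `p`.
  refine isRegularLocalRing_of_mul_eq_zero p (H.eq_span hr) (s := aeval x u) ?_ ?_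
  · rw [aeval_mem_iff hr]; rwa [dvd_iff_isRoot] at hur
  · have := H.aeval_eq_zero
    rw [hu, hs] at this
    rw [mul_comm]
    simpa using this

end IsLineModel

end LineModel

/-! ### The fibre `Y = 0` of a plane model. -/

section Bar

variable {k : Type u} [Field k] {K : Type u} [CommRing K] [Algebra k K]
  {B : Subalgebra k K} {x y : K} {F h : k[X][X]}

lemma biAeval_zero_right' {R : Type*} [CommRing R] [Algebra k R] (x : R) (a : k[X][X]) :
    biAeval x 0 a = aeval x (a.map (evalRingHom 0)) := by
  obtain ⟨G, hG⟩ := exists_eq_map_C_add a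
  conv_lhs => rw [hG]
  simp [biAeval_map_C]

lemma IsPlaneModel.isLineModel (H : IsPlaneModel B x y F h) :
    IsLineModel (B ⧸ Ideal.span {(⟨y, H.y_mem⟩ : B)}) (Ideal.Quotient.mk _ (⟨x, H.x_mem⟩ : B))
      (F.map (evalRingHom 0)) (h.map (evalRingHom 0)) := by
  let I := Ideal.span {(⟨y, H.y_mem⟩ : B)}
  let x' : B := ⟨x, H.x_mem⟩
  let y' : B := ⟨y, H.y_mem⟩
  have hB : ∀ a : k[X][X], (biAeval x' y' a : K) = biAeval x y a :=
    fun a => map_biAeval B.val x' y' a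
  have hbar : ∀ a : k[X][X], Ideal.Quotient.mk I (biAeval x' y' a) =
      aeval (Ideal.Quotient.mk I x') (a.map (evalRingHom 0)) := by
    intro a
    have hy : Ideal.Quotient.mkₐ k I y' = 0 :=
      Ideal.Quotient.eq_zero_iff_mem.2 (Ideal.mem_span_singleton_self _)
    have := map_biAeval (Ideal.Quotient.mkₐ k I) x' y' a
    rw [hy, biAeval_zero_right'] at this
    exact this
  refine ⟨H.restr_ne_zero, ?_, ?_, ?_, ?_⟩
  · obtain ⟨c, hc⟩ := H.exists_inv'
    rw [← hbar]
    exact (IsUnit.of_mul_eq_one c hc).map (Ideal.Quotient.mk I)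
  · rw [← hbar]
    have : biAeval x' y' F = 0 := Subtype.val_injective ((hB F).trans H.eval_eq_zero)
    rw [this, map_zero]
  · intro b
    obtain ⟨b, rfl⟩ := Ideal.Quotient.mk_surjective b
    obtain ⟨N, a, e⟩ := H.le_fracSub b.2
    refine ⟨N, a.map (evalRingHom 0), ?_⟩
    rw [← hbar, ← hbar, ← map_pow, ← map_mul]
    congr 1
    apply Subtype.val_injective
    rw [hB, ← e, ← hB]
    rfl
  · intro a ha
    have h1 : Ideal.Quotient.mk I (biAeval x' y' (a.map C)) = 0 := by
      rw [biAeval_map_C, ← ha]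
      exact (aeval_algHom_apply (Ideal.Quotient.mkₐ k I) x' a).symm
    rw [Ideal.Quotient.eq_zero_iff_mem, Ideal.mem_span_singleton] at h1
    obtain ⟨b, hb⟩ := h1
    obtain ⟨N, c, e⟩ := H.le_fracSub b.2
    -- As `a(x) = y b` and `h^N b = c(x, y)`, the polynomial `h^N a - Y c` vanishes at `(x, y)`.
    -- Hence `F` divides its product with `h^M`; reducing modulo `Y` removes the term with `c`.
    obtain ⟨M, hM⟩ := H.dvd_of_eval_eq_zero (h ^ N * a.map C - C X * c) (by
      have hb' : biAeval x y (a.map C) = y * b := by rw [← hB, hb]; rfl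
      simp only [map_sub, map_mul, map_pow, hb', biAeval_C, aeval_X, ← e]
      ring)
    refine ⟨M + N, ?_⟩
    have := map_dvd (mapRingHom (evalRingHom (0 : k))) hM
    have hid : (evalRingHom (0 : k)).comp C = RingHom.id k := by ext; simp
    simp only [map_mul, map_pow, map_sub, coe_mapRingHom, Polynomial.map_map, hid,
      Polynomial.map_id, Polynomial.map_C] at this
    simpa [pow_add, mul_assoc] using this

end Bar

/-! ### Plane models for the first charts, for `α̃` and for the blown-up charts. -/

section Constructions

variable {k : Type u} [Field k] {K : Type u} [CommRing K] [Algebra k K]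

/-- The model of the curve `F(x, y) = 0` in `k[x^±, y]`. -/
lemma IsPlaneModel.base {B : Subalgebra k K} (x : Kˣ) {y : K} {F : k[X][X]}
    (hx : (x : K) ∈ B) (hx' : (↑x⁻¹ : K) ∈ B) (hy : y ∈ B)
    (hB : ∀ S : Subalgebra k K, (x : K) ∈ S → (↑x⁻¹ : K) ∈ S → y ∈ S → B ≤ S)
    (hF0 : biAeval (x : K) y F = 0) (hF : F.map (evalRingHom 0) ≠ 0)
    (hker : ∀ a : k[X][X], biAeval (x : K) y a = 0 →
      (biAeval xVar yVar F : Laurent k 2) ∣ biAeval xVar yVar a) :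
    IsPlaneModel B x y F X where
  x_mem := hx
  y_mem := hy
  eval_eq_zero := hF0
  exists_inv := ⟨_, hx', by simp⟩
  X_dvd := dvd_rfl
  restr_ne_zero := hF
  le_fracSub := hB _ (left_mem_fracSub _ _ _) (inv_mem_fracSub (k := k) (g := X) (h := X) dvd_rfl (by simp))
    (right_mem_fracSub _ _ _)
  dvd_of_eval_eq_zero := fun a ha => dvd_of_biAeval_vars_dvd hF dvd_rfl (hker a ha)
  ne_zero_of_simple := fun r hr _ => by simpa using hr

variable {B : Subalgebra k K} {x y : K} {F h : k[X][X]}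

/-- Removing the points with `x = q(y)` from a model. -/
lemma IsPlaneModel.remove (H : IsPlaneModel B x y F h) {B' : Subalgebra k K} {ι : Type*}
    (S : Finset ι) (q : ι → k[X]) (G : Kˣ) (hG : (G : K) = ∏ i ∈ S, (x - aeval y (q i)))
    (hBB' : B ≤ B') (hG' : (↑G⁻¹ : K) ∈ B')
    (hB' : ∀ S : Subalgebra k K, B ≤ S → (G : K) ∈ S → (↑G⁻¹ : K) ∈ S → B' ≤ S)
    (hS : ∀ i ∈ S, (F.map (evalRingHom 0)).rootMultiplicity ((q i).eval 0) ≠ 1) :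
    IsPlaneModel B' x y F (h * ∏ i ∈ S, (X - C (q i))) := by
  have hGe : biAeval x y (∏ i ∈ S, (X - C (q i))) = G := by
    rw [hG, map_prod]; simp
  have hle : fracSub x y h ≤ fracSub x y (h * ∏ i ∈ S, (X - C (q i))) := by
    rintro b ⟨N, a, e⟩
    refine ⟨N, a * (∏ i ∈ S, (X - C (q i))) ^ N, ?_⟩
    rw [map_mul, map_mul, ← e, map_pow]
    ring
  refine ⟨hBB' H.x_mem, hBB' H.y_mem, H.eval_eq_zero, ?_, H.X_dvd.mul_right _, H.restr_ne_zero,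
    ?_, ?_, ?_⟩
  · obtain ⟨c, hc, e⟩ := H.exists_inv
    refine ⟨c * ↑G⁻¹, B'.mul_mem (hBB' hc) hG', ?_⟩
    rw [map_mul, hGe, mul_mul_mul_comm, e]
    simp
  · refine hB' _ (H.le_fracSub.trans hle) ?_ ?_
    · rw [← hGe]; exact biAeval_mem_fracSub _ _ _ _
    · exact inv_mem_fracSub (Dvd.intro_left _ rfl) (by rw [hGe]; simp)
  · intro a ha
    obtain ⟨N, hN⟩ := H.dvd_of_eval_eq_zero a ha
    refine ⟨N, hN.trans ?_⟩
    rw [mul_pow, mul_right_comm]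
    exact Dvd.intro _ rfl
  -- A new factor vanishes at `(r, 0)` only if `r = q_i(0)`, and by `hS` this is not a simple root.
  · intro r hr hs
    rw [map_mul, map_prod]
    refine mul_ne_zero (H.ne_zero_of_simple r hr hs) (Finset.prod_ne_zero_iff.2 fun i hi h0 => ?_)
    simp only [map_sub, biAeval_X, biAeval_C, sub_eq_zero] at h0
    rw [aeval_zero_eq] at h0
    exact hS i hi (h0 ▸ hs)

/-- Clearing denominators after the substitution `x = z^a w^b + q(y)`, `y = z^c w^d`. -/
lemma exists_substitution (h : k[X][X]) (q : k[X]) (a c : ℤ) (b d : ℕ) :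
    ∃ (N : ℕ) (A : k[X][X]), ∀ (R : Type u) [CommRing R] [Algebra k R] (z : Rˣ) (w : R),
      biAeval (z : R) w A = (z : R) ^ N *
        biAeval ((↑(z ^ a) : R) * w ^ b + aeval ((↑(z ^ c) : R) * w ^ d) q)
          ((↑(z ^ c) : R) * w ^ d) h := by
  -- The computation is made once in the universal case `k[w][z^±]` and then specialized. The
  -- exponents `b`, `d` of `w` are natural numbers so that `w = 0` is also allowed.
  let T := LaurentPolynomial k[X]
  let W : T := LaurentPolynomial.C X
  let y : T := LaurentPolynomial.T c * W ^ d
  let x : T := LaurentPolynomial.T a * W ^ b + aeval y q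
  obtain ⟨N, A, hA⟩ := LaurentPolynomial.exists_T_pow (biAeval x y h)
  refine ⟨N, A, fun R _ _ z w => ?_⟩
  let φ : T →ₐ[k] R :=
    { LaurentPolynomial.eval₂ (aeval (R := k) w : k[X] →ₐ[k] R).toRingHom z with
      commutes' := fun r => by
        have : algebraMap k T r = LaurentPolynomial.C (C r) := rfl
        rw [this]
        refine (LaurentPolynomial.eval₂_C _ _ _).trans ?_
        exact (aeval (R := k) w).commutes r }
  have hT : ∀ n : ℤ, φ (LaurentPolynomial.T n) = (↑(z ^ n) : R) :=
    fun n => LaurentPolynomial.eval₂_T _ _ n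
  have hW : φ W = w := by
    refine (LaurentPolynomial.eval₂_C _ _ _).trans ?_
    exact aeval_X (R := k) w
  have hy : φ y = (↑(z ^ c) : R) * w ^ d := by rw [map_mul, map_pow, hT, hW]
  have hx : φ x = (↑(z ^ a) : R) * w ^ b + aeval ((↑(z ^ c) : R) * w ^ d) q := by
    rw [map_add, map_mul, map_pow, hT, hW, ← hy, aeval_algHom_apply]
  have hA' : φ (toLaurent A) = biAeval (z : R) w A := LaurentPolynomial.eval₂_toLaurent _ _ _
  rw [← hA', hA, map_mul, map_biAeval, hx, hy, hT, mul_comm]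
  simp

/-- The model of the blown-up chart with coordinates `z, w`, where `x - q(y)` and `y` are
monomials in `z` and `w`. -/
lemma IsPlaneModel.blowup (H : IsPlaneModel B x y F h) {B' : Subalgebra k K} {q : k[X]}
    {z w : Kˣ} {N : Matrix.SpecialLinearGroup (Fin 2) ℤ} (hN : IsPositivePrimitive (N.1 1))
    (hx : x - aeval y q = (↑(z ^ N.1 0 0 * w ^ N.1 1 0) : K))
    (hy : y = (↑(z ^ N.1 0 1 * w ^ N.1 1 1) : K))
    {F' : k[X][X]} {n : Fin 2 → ℤ}
    (hF' : biAeval (mono fun t => N.1 t 0) (mono fun t => N.1 t 1) (F.comp (X + C q)) =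
      (mono n * biAeval xVar yVar F' : Laurent k 2))
    (hF'0 : F'.map (evalRingHom 0) ≠ 0)
    (hh : biAeval (q.eval 0) (0 : k) h ≠ 0)
    (hBB' : B ≤ B') (hz : (z : K) ∈ B') (hz' : (↑z⁻¹ : K) ∈ B') (hw : (w : K) ∈ B')
    (hB' : ∀ S : Subalgebra k K, B ≤ S → (z : K) ∈ S → (↑z⁻¹ : K) ∈ S → (w : K) ∈ S → B' ≤ S) :
    ∃ h', IsPlaneModel B' z w F' h' := by
  obtain ⟨b, hb⟩ := Int.eq_ofNat_of_zero_le hN.2.1.le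
  obtain ⟨d, hd⟩ := Int.eq_ofNat_of_zero_le hN.2.2.le
  have hb0 : b ≠ 0 := by have := hN.2.1; omega
  have hd0 : d ≠ 0 := by have := hN.2.2; omega
  -- `A` is `h` written in the coordinates `z`, `w`. It is specialized three times: to `K`, to the
  -- Laurent ring, and to `k` with `w = 0`.
  obtain ⟨M, A, hA⟩ := exists_substitution h q (N.1 0 0) (N.1 0 1) b d
  have hyd : (↑(z ^ N.1 0 1) : K) * (w : K) ^ d = y := by
    rw [hy, hd]; simp
  have hxb : (↑(z ^ N.1 0 0) : K) * (w : K) ^ b + aeval y q = x := by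
    have h1 : (↑(z ^ N.1 0 0 * w ^ N.1 1 0) : K) = (↑(z ^ N.1 0 0) : K) * (w : K) ^ b := by
      rw [hb]; simp
    rw [← h1, ← hx]; ring
  have hAK : biAeval (z : K) (w : K) A = (z : K) ^ M * biAeval x y h := by
    rw [hA, hyd, hxb]
  -- the generic situation
  let tX : Laurent k 2 := mono fun t => N.1 t 0
  let tY : Laurent k 2 := mono fun t => N.1 t 1
  let zL : (Laurent k 2)ˣ := monoUnit (Pi.single 0 1)
  have htX : (↑(zL ^ N.1 0 0) : Laurent k 2) * yVar ^ b = tX := by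
    rw [monoUnit_zpow, val_monoUnit, yVar, mono_pow, mono_mul_mono]
    congr 1; ext t; fin_cases t <;> simp [hb]
  have htY : (↑(zL ^ N.1 0 1) : Laurent k 2) * yVar ^ d = tY := by
    rw [monoUnit_zpow, val_monoUnit, yVar, mono_pow, mono_mul_mono]
    congr 1; ext t; fin_cases t <;> simp [hd]
  have hAL : (biAeval xVar yVar A : Laurent k 2) = xVar ^ M * biAeval (tX + aeval tY q) tY h := by
    have := hA (Laurent k 2) zL yVar
    rw [htX, htY] at this
    exact this
  let ev : Laurent k 2 →ₐ[k] K := laurentEval ![z, w]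
  have evx : ev xVar = z := by
    rw [xVar, laurentEval_mono]; simp
  have evy : ev yVar = w := by
    rw [yVar, laurentEval_mono]; simp
  have evX : ev tX = x - aeval y q := by
    rw [hx, laurentEval_mono]; simp
  have evY : ev tY = y := by
    rw [hy, laurentEval_mono]; simp
  -- On the curve the left side of `hF'` becomes `F(x, y) = 0`, and the monomial on the right is a
  -- unit.
  have hF'K : biAeval (z : K) (w : K) F' = 0 := by
    have h1 := congr_arg ev hF'
    rw [map_biAeval, map_mul, map_biAeval, evx, evy, evX, evY, biAeval_comp] at h1
    simp only [map_add, biAeval_X, biAeval_C, sub_add_cancel, H.eval_eq_zero] at h1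
    rwa [eq_comm, IsUnit.mul_right_eq_zero] at h1
    exact (monoUnit n).isUnit.map ev
  have hX : X ∣ X * A := Dvd.intro _ rfl
  obtain ⟨c, hc, hc1⟩ := H.exists_inv
  have hinv : biAeval (z : K) (w : K) A * (↑z⁻¹ ^ M * c) = 1 := by
    rw [hAK, mul_mul_mul_comm, hc1, ← mul_pow]
    simp
  -- Inverting `X * A` inverts both `z` and the old `h(x, y)`.
  refine ⟨X * A, hz, hw, hF'K, ?_, hX, hF'0, ?_, ?_, ?_⟩
  · refine ⟨↑z⁻¹ * (↑z⁻¹ ^ M * c), B'.mul_mem hz' (B'.mul_mem (B'.pow_mem hz' _) (hBB' hc)), ?_⟩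
    rw [map_mul, biAeval_X, mul_mul_mul_comm, hinv]
    simp
  · let S := fracSub (z : K) (w : K) (X * A)
    have sz : (z : K) ∈ S := left_mem_fracSub _ _ _
    have sw : (w : K) ∈ S := right_mem_fracSub _ _ _
    have sz' : (↑z⁻¹ : K) ∈ S := inv_mem_fracSub hX (by simp)
    have szn : ∀ n : ℤ, (↑(z ^ n) : K) ∈ S := by
      rintro (n | n)
      · simpa using S.pow_mem sz n
      · rw [zpow_negSucc, ← inv_pow, Units.val_pow_eq_pow_val]
        exact S.pow_mem sz' _
    have sy : y ∈ S := by
      rw [← hyd]; exact S.mul_mem (szn _) (S.pow_mem sw _)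
    have sx : x ∈ S := by
      rw [← hxb]
      refine S.add_mem (S.mul_mem (szn _) (S.pow_mem sw _)) ?_
      exact aeval_mem_adjoin_singleton k y |> (Algebra.adjoin_le (by simpa using sy) ·)
    have sc : c ∈ S := by
      have h1 : (↑z⁻¹ ^ M * c : K) ∈ S := inv_mem_fracSub (Dvd.intro_left _ rfl) hinv
      have h2 := S.mul_mem (S.pow_mem sz M) h1
      rwa [← mul_assoc, ← mul_pow, Units.mul_inv, one_pow, one_mul] at h2
    refine hB' S (fun e he => ?_) sz sz' sw
    obtain ⟨L, a, ha⟩ := H.le_fracSub he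
    have : e = c ^ L * biAeval x y a := by
      rw [← ha, ← mul_assoc, ← mul_pow, mul_comm c, hc1, one_pow, one_mul]
    rw [this]
    exact S.mul_mem (S.pow_mem sc _) (biAeval_mem sx sy a)
  · intro a ha
    -- To use the old model, a relation `a(z, w) = 0` is turned into one between `x - q(y)` and `y`:
    -- in the Laurent ring the change of variables is invertible, and `a` becomes `A₁(tX, tY)` up to
    -- a monomial.
    obtain ⟨i, j, A₁, hA₁⟩ := exists_clear_denominators
      (laurentMap (N⁻¹).1 (biAeval xVar yVar a : Laurent k 2))
    have hNN : ∀ b : Laurent k 2, laurentMap N.1 (laurentMap (N⁻¹).1 b) = b := by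
      intro b
      induction b using AddMonoidAlgebra.induction_linear with
      | zero => simp
      | add b b' h1 h2 => rw [map_add, map_add, h1, h2]
      | single e c =>
        have : (AddMonoidAlgebra.single e c : Laurent k 2) = c • mono e := by simp [mono]
        rw [this, map_smul, map_smul, laurentMap_mono, laurentMap_mono, Matrix.mulVec_mulVec,
          ← Matrix.SpecialLinearGroup.coe_mul, mul_inv_cancel, Matrix.SpecialLinearGroup.coe_one,
          Matrix.one_mulVec]
    have θx : laurentMap N.1 (xVar : Laurent k 2) = tX := by
      rw [xVar, laurentMap_mono, Matrix.mulVec_single_one]; rfl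
    have θy : laurentMap N.1 (yVar : Laurent k 2) = tY := by
      rw [yVar, laurentMap_mono, Matrix.mulVec_single_one]; rfl
    have h1 : tX ^ i * tY ^ j * biAeval xVar yVar a = biAeval tX tY A₁ := by
      have := congr_arg (laurentMap N.1) hA₁
      rwa [map_mul, map_mul, map_pow, map_pow, hNN, map_biAeval, θx, θy] at this
    obtain ⟨L, e, he⟩ := H.dvd_of_eval_eq_zero (A₁.comp (X - C q)) (by
      have := congr_arg ev h1
      rw [map_mul, map_biAeval, map_biAeval, evx, evy, ha, mul_zero, evX, evY] at this
      rw [biAeval_comp, map_sub, biAeval_X, biAeval_C, ← this])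
    -- Back to the new variables: `F` turns into a monomial times `F'`, and `h` into `A` up to a
    -- power of `xVar`.
    have h2 := congr_arg (biAeval (tX + aeval tY q) tY) he
    have h3 : biAeval (tX + aeval tY q) tY F = biAeval tX tY (F.comp (X + C q)) := by
      rw [biAeval_comp]; simp
    rw [map_mul, map_mul, map_pow, biAeval_comp, map_sub, biAeval_X, biAeval_C, add_sub_cancel_right,
      ← h1, h3, hF'] at h2
    have h4 : (biAeval xVar yVar F' : Laurent k 2) ∣ biAeval xVar yVar (A ^ L * a) := by
      have hu : IsUnit (tX ^ i * tY ^ j) :=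
        ((monoUnit _).isUnit.pow i).mul ((monoUnit _).isUnit.pow j)
      rw [map_mul, map_pow, hAL, ← hu.dvd_mul_left]
      refine ⟨xVar ^ (M * L) * mono n * biAeval (tX + aeval tY q) tY e, ?_⟩
      linear_combination (xVar ^ (M * L)) * h2
    obtain ⟨m, hm⟩ := dvd_of_biAeval_vars_dvd hF'0 hX h4
    refine ⟨m + L, hm.trans ?_⟩
    rw [pow_add, mul_pow X A L]
    exact ⟨X ^ L, by ring⟩
  -- Because `b, d > 0`, the line `w = 0` is mapped to the single point `(q(0), 0)`, at which `h`
  -- does not vanish by `hh`. So `A(r, 0) = r^M h(q(0), 0)` is nonzero for every `r ≠ 0`.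
  · intro r hr _
    have h1 := hA k (Units.mk0 r hr) 0
    rw [zero_pow hb0, zero_pow hd0, mul_zero, mul_zero, zero_add] at h1
    rw [aeval_zero_eq] at h1
    rw [map_mul, biAeval_X]
    refine mul_ne_zero hr ?_
    rw [Units.val_mk0] at h1
    rw [h1]
    exact mul_ne_zero (pow_ne_zero _ hr) hh

end Constructions

/-! ### Monomials with exponents given by the columns of a matrix. -/

section MonomialAction

variable {ι G : Type*} [Fintype ι] [CommGroup G]

lemma zpow_sum_eq_prod_zpow {κ G : Type*} [CommGroup G] (z : G) (S : Finset κ) (e : κ → ℤ) :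
    z ^ (∑ i ∈ S, e i) = ∏ i ∈ S, z ^ e i := by
  classical
  induction S using Finset.induction_on with
  | empty => simp
  | insert a S ha h => rw [Finset.sum_insert ha, Finset.prod_insert ha, zpow_add, h]

/-- The monomials `Z • A`, whose exponents are the columns of the matrix `A`. -/
def monomials (Z : ι → G) (A : Matrix ι ι ℤ) (t : ι) : G := ∏ s, Z s ^ A s t

lemma prod_monomials (Z : ι → G) (A : Matrix ι ι ℤ) (e : ι → ℤ) :
    ∏ t, monomials Z A t ^ e t = ∏ s, Z s ^ (A.mulVec e) s := by
  simp only [monomials, ← Finset.prod_zpow, ← zpow_mul]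
  rw [Finset.prod_comm]
  refine Finset.prod_congr rfl fun s _ => ?_
  simp only [Matrix.mulVec, dotProduct]
  exact (zpow_sum_eq_prod_zpow _ _ _).symm

lemma monomials_monomials (Z : ι → G) (A B : Matrix ι ι ℤ) :
    monomials (monomials Z A) B = monomials Z (A * B) :=
  funext fun t => prod_monomials Z A fun s => B s t

lemma monomials_one [DecidableEq ι] (Z : ι → G) : monomials Z (1 : Matrix ι ι ℤ) = Z := by
  funext t
  rw [monomials, Finset.prod_eq_single t] <;> simp +contextual

end MonomialAction

/-! ### Coordinates of the new charts in terms of those of `C_α`. -/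

section Coordinates

variable {k : Type u} [Field k] {f : Laurent k 2}

namespace Omega

/-- The old coordinates `x₁, …, x_m, y` as invertible rational functions on `C₀`. -/
noncomputable def var (α : Omega f) (t : Fin (α.1.l + 2)) : (FunctionRing f)ˣ :=
  (α.isUnit_vars t).unit

lemma val_var (α : Omega f) (t : Fin (α.1.l + 2)) :
    (α.var t : FunctionRing f) = toFunction f (α.1.vars t) := rfl

lemma coord_eq_monomials (α : Omega f) : α.coord = monomials α.var (α.1.M⁻¹).1 := rfl

lemma monomials_coord (α : Omega f) : monomials α.coord α.1.M.1 = α.var := by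
  rw [coord_eq_monomials, monomials_monomials, ← Matrix.SpecialLinearGroup.coe_mul,
    inv_mul_cancel, Matrix.SpecialLinearGroup.coe_one, monomials_one]

/-- The coordinates are characterized by giving the old variables through `M_α`. This allows the
coordinates of new charts to be found without inverting the new matrices. -/
lemma coord_eq_of_monomials (α : Omega f) {Z : Fin (α.1.l + 2) → (FunctionRing f)ˣ}
    (h : monomials Z α.1.M.1 = α.var) : α.coord = Z := by
  rw [coord_eq_monomials, ← h, monomials_monomials, ← Matrix.SpecialLinearGroup.coe_mul,
    mul_inv_cancel, Matrix.SpecialLinearGroup.coe_one, monomials_one]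

lemma coord_castSucc_mem (α : Omega f) (t : Fin (α.1.l + 1)) :
    (α.coord t.castSucc : FunctionRing f) ∈ α.ring :=
  Algebra.subset_adjoin (Or.inl ⟨t, Or.inl rfl⟩)

lemma coord_castSucc_inv_mem (α : Omega f) (t : Fin (α.1.l + 1)) :
    (↑(α.coord t.castSucc)⁻¹ : FunctionRing f) ∈ α.ring :=
  Algebra.subset_adjoin (Or.inl ⟨t, Or.inr rfl⟩)

lemma coord_last_mem (α : Omega f) :
    (α.coord (Fin.last _) : FunctionRing f) ∈ α.ring :=
  Algebra.subset_adjoin (Or.inr rfl)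

lemma ring_le (α : Omega f) {S : Subalgebra k (FunctionRing f)}
    (h : ∀ t : Fin (α.1.l + 1), (α.coord t.castSucc : FunctionRing f) ∈ S ∧
      (↑(α.coord t.castSucc)⁻¹ : FunctionRing f) ∈ S)
    (h' : (α.coord (Fin.last _) : FunctionRing f) ∈ S) : α.ring ≤ S := by
  refine Algebra.adjoin_le ?_
  rintro z (⟨t, rfl | rfl⟩ | rfl)
  exacts [(h t).1, (h t).2, h']

lemma laurentEval_aeval (α : Omega f) (g : MvPolynomial (Fin (α.1.l + 2)) k) :
    laurentEval α.var (MvPolynomial.aeval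
      (fun t => (mono (Pi.single t 1) : Laurent k (α.1.l + 2))) g) =
    toFunction f (MvPolynomial.aeval α.1.vars g) := by
  have : ((laurentEval α.var).comp (MvPolynomial.aeval
      (fun t => (mono (Pi.single t 1) : Laurent k (α.1.l + 2))))) =
      (toFunction f).comp (MvPolynomial.aeval α.1.vars) := by
    refine MvPolynomial.algHom_ext fun t => ?_
    simp only [AlgHom.comp_apply, MvPolynomial.aeval_X, laurentEval_mono]
    rw [Finset.prod_eq_single t] <;> simp +contextual [val_var]
  exact congr($this g)

/-- On the curve, `g` and `X_{j_α} - q(Y)` differ by a monomial in invertible functions, so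
inverting one inverts the other. -/
lemma toFunction_aeval_of_isRelated (α : Omega f) {q : k[X]} {s : Fin (α.1.l + 2) → ℤ}
    {g : MvPolynomial (Fin (α.1.l + 2)) k} (h : α.1.IsRelated q s g) :
    toFunction f (MvPolynomial.aeval α.1.vars g) = ((∏ t, α.var t ^ s t : (FunctionRing f)ˣ) :
      FunctionRing f) * (α.coord α.1.j.castSucc - aeval (α.coord (Fin.last _) : FunctionRing f) q) := by
  rw [← laurentEval_aeval, h.1, map_mul, map_sub, ← aeval_algHom_apply, laurentEval_mono,
    laurentEval_mono, laurentEval_mono]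
  rfl

end Omega

lemma newPos_succAbove_castSucc {l : ℕ} (t : Fin (l + 1)) :
    (newPos l).succAbove t.castSucc = t.castSucc.castSucc := by
  apply Fin.succAbove_of_castSucc_lt
  have := t.2
  simp only [newPos, Fin.lt_def, Fin.val_castSucc, Fin.val_last]
  omega

lemma newPos_succAbove_last {l : ℕ} : (newPos l).succAbove (Fin.last (l + 1)) = Fin.last _ := by
  rw [Fin.succAbove_of_le_castSucc]
  · simp
  · simp [newPos]

/-- Translates the layout of the variables of a new chart into the insertion used in
`borderedMatrix`. -/
lemma snoc_cons_snoc {R : Type*} {l : ℕ} (x a y : R) (v : Fin l → R) :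
    Fin.snoc (α := fun _ => R) (Fin.cons (α := fun _ => R) x (Fin.snoc (α := fun _ => R) v a)) y =
      (newPos l).insertNth (α := fun _ => R) a
        (Fin.snoc (α := fun _ => R) (Fin.cons (α := fun _ => R) x v) y) := by
  refine (Fin.insertNth_eq_iff.2 ⟨?_, ?_⟩).symm
  · rw [newPos, Fin.snoc_castSucc, ← Fin.succ_last, Fin.cons_succ, Fin.snoc_last]
  · funext i
    rw [Fin.removeNth_apply]
    induction i using Fin.lastCases with
    | last => rw [newPos_succAbove_last, Fin.snoc_last, Fin.snoc_last]
    | cast i =>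
      rw [newPos_succAbove_castSucc, Fin.snoc_castSucc, Fin.snoc_castSucc]
      induction i using Fin.cases with
      | zero => rfl
      | succ i => rw [Fin.cons_succ, ← Fin.succ_castSucc, Fin.cons_succ, Fin.snoc_castSucc]

/-- The new row is a unit vector, so the old monomials do not see `a`, and `a` enters the new one
with exponent one. -/
lemma monomials_bordered {G : Type*} [CommGroup G] {l : ℕ} (Z : Fin (l + 2) → G) (a : G)
    (M : Matrix (Fin (l + 2)) (Fin (l + 2)) ℤ) (c : Fin (l + 2) → ℤ) :
    monomials ((newPos l).insertNth (α := fun _ => G) a Z) (borderedMatrix M c) =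
      (newPos l).insertNth (α := fun _ => G) (a * ∏ i, Z i ^ c i) (monomials Z M) := by
  funext t
  rw [monomials, Fin.prod_univ_succAbove _ (newPos l)]
  induction t using (newPos l).succAboveCases with
  | x => simp [borderedMatrix]
  | p i => simp [borderedMatrix, monomials]

namespace Chart

lemma vars_remove (α : Chart k) (g : MvPolynomial (Fin (α.l + 2)) k) (s : Fin (α.l + 2) → ℤ) :
    (α.remove g s).vars = (newPos α.l).insertNth (α := fun _ => Laurent k 2)
      (MvPolynomial.aeval α.vars g) α.vars :=
  snoc_cons_snoc _ _ _ _

end Chart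

namespace Omega

variable (α : Omega f) {g : MvPolynomial (Fin (α.1.l + 2)) k} {s : Fin (α.1.l + 2) → ℤ}

/-- The element `(0, 1) ∘_g α` of `Ω`. -/
noncomputable abbrev remove (g : MvPolynomial (Fin (α.1.l + 2)) k) (s : Fin (α.1.l + 2) → ℤ)
    (h : ∀ i, Ideal.Quotient.mk (Ideal.span {f}) ((α.1.remove g s).g i) ∈
      nonZeroDivisors (CoordRing f)) : Omega f := ⟨α.1.remove g s, h⟩

/-- The element `β ∘_g α` of `Ω`. -/
noncomputable abbrev blowup (g : MvPolynomial (Fin (α.1.l + 2)) k) (s : Fin (α.1.l + 2) → ℤ)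
    (N : Matrix.SpecialLinearGroup (Fin 2) ℤ) (F : k[X][X])
    (h : ∀ i, Ideal.Quotient.mk (Ideal.span {f}) ((α.1.blowup g s N F).g i) ∈
      nonZeroDivisors (CoordRing f)) : Omega f := ⟨α.1.blowup g s N F, h⟩

/-- The coordinates of the chart `(0, 1) ∘_g α`. -/
lemma coord_remove (h : ∀ i, Ideal.Quotient.mk (Ideal.span {f}) ((α.1.remove g s).g i) ∈
      nonZeroDivisors (CoordRing f)) {G : (FunctionRing f)ˣ}
    (hG : toFunction f (MvPolynomial.aeval α.1.vars g) =
      ((∏ t, α.var t ^ s t : (FunctionRing f)ˣ) : FunctionRing f) * G) :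
    (α.remove g s h).coord =
      (newPos α.1.l).insertNth (α := fun _ => (FunctionRing f)ˣ) G α.coord := by
  refine coord_eq_of_monomials _ ((monomials_bordered _ _ _ _).trans (funext fun t => ?_))
  apply Units.ext
  refine Eq.trans ?_ (congr_arg (toFunction f) (congr_fun (Chart.vars_remove α.1 g s) t)).symm
  induction t using (newPos α.1.l).succAboveCases with
  | x => rw [Fin.insertNth_apply_same, Fin.insertNth_apply_same, hG, ← prod_monomials,
      monomials_coord, Units.val_mul, mul_comm]
  | p i => rw [Fin.insertNth_apply_succAbove, Fin.insertNth_apply_succAbove, monomials_coord,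
      val_var]

/-- The charts `β ∘_g α` and `(0, 1) ∘_g α` have the same tuple of functions, and their matrices
differ by the left factor `I_m ⊕ N`. -/
lemma monomials_coord_blowup {N : Matrix.SpecialLinearGroup (Fin 2) ℤ} {F : k[X][X]}
    (h : ∀ i, Ideal.Quotient.mk (Ideal.span {f}) ((α.1.blowup g s N F).g i) ∈
      nonZeroDivisors (CoordRing f)) :
    monomials (α.blowup g s N F h).coord (idBlock α.1.l N).1 =
      (α.remove g s h).coord := by
  symm
  refine coord_eq_of_monomials _ ?_
  refine (monomials_monomials (ι := Fin (α.1.l + 3)) _ _ _).trans ?_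
  exact monomials_coord (α.blowup g s N F h)

end Omega

lemma monomials_idBlock {G : Type*} [CommGroup G] {l : ℕ} (Z : Fin (l + 3) → G)
    (N : Matrix.SpecialLinearGroup (Fin 2) ℤ) :
    (∀ t : Fin (l + 1), monomials Z (idBlock l N).1 t.castSucc.castSucc = Z t.castSucc.castSucc) ∧
    monomials Z (idBlock l N).1 (newPos l) = Z (newPos l) ^ N.1 0 0 * Z (Fin.last _) ^ N.1 1 0 ∧
    monomials Z (idBlock l N).1 (Fin.last _) =
      Z (newPos l) ^ N.1 0 1 * Z (Fin.last _) ^ N.1 1 1 := by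
  have key : ∀ t, monomials Z (idBlock l N).1 (finSumFinEquiv (m := l + 1) (n := 2) t) =
      (∏ i : Fin (l + 1), Z (finSumFinEquiv (m := l + 1) (n := 2) (.inl i)) ^
        (Matrix.fromBlocks (1 : Matrix (Fin (l + 1)) (Fin (l + 1)) ℤ) 0 0 N.1 (.inl i) t : ℤ)) *
      (Z (newPos l) ^ (Matrix.fromBlocks (1 : Matrix (Fin (l + 1)) (Fin (l + 1)) ℤ) 0 0 N.1
          (.inr 0) t : ℤ) *
        Z (Fin.last _) ^ (Matrix.fromBlocks (1 : Matrix (Fin (l + 1)) (Fin (l + 1)) ℤ) 0 0 N.1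
          (.inr 1) t : ℤ)) := by
    intro t
    have h1 := Fin.prod_univ_two fun i : Fin 2 => Z (finSumFinEquiv (m := l + 1) (n := 2) (.inr i)) ^
      (Matrix.fromBlocks (1 : Matrix (Fin (l + 1)) (Fin (l + 1)) ℤ) 0 0 N.1 (.inr i) t : ℤ)
    have h2 : monomials Z (idBlock l N).1 (finSumFinEquiv (m := l + 1) (n := 2) t) =
      ∏ s, Z (finSumFinEquiv (m := l + 1) (n := 2) s) ^
        (idBlock l N).1 (finSumFinEquiv (m := l + 1) (n := 2) s)
          (finSumFinEquiv (m := l + 1) (n := 2) t) :=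
      ((finSumFinEquiv (m := l + 1) (n := 2)).prod_comp _).symm
    rw [h2, Fintype.prod_sum_type]
    simp only [idBlock, Matrix.reindex_apply, Matrix.submatrix_apply, Equiv.symm_apply_apply]
    rw [h1]
    rfl
  refine ⟨fun t => ?_, ?_, ?_⟩
  · refine (key (.inl t)).trans ?_
    rw [Finset.prod_eq_single t]
    · simp; rfl
    · intro b _ hb; simp [hb]
    · simp
  · refine (key (.inr 0)).trans ?_
    simp
  · refine (key (.inr 1)).trans ?_
    simp

end Coordinates

/-! ### Separation of rational points of different charts. -/

section Joint

variable {k : Type u} [Field k] {K : Type u} [CommRing K] [Algebra k K]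

/-- Two rational points, of charts with coordinate rings `B`, `B' ⊆ K`, are joint if the elements of `B`
and `B'` are regular functions on a common neighbourhood, on which both points are given by the same
point. -/
def Joint {B B' : Subalgebra k K} (Q : B →ₐ[k] k) (Q' : B' →ₐ[k] k) : Prop :=
  ∃ (D : Type u) (_ : CommRing D) (ρ : D →+* K) (T : D →+* k) (φ : B →+* D) (φ' : B' →+* D),
    Function.Injective ρ ∧ (∀ b, ρ (φ b) = b) ∧ (∀ b, ρ (φ' b) = b) ∧ (∀ b, T (φ b) = Q b) ∧
      ∀ b, T (φ' b) = Q' b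

namespace Joint

variable {B B' : Subalgebra k K} {Q : B →ₐ[k] k} {Q' : B' →ₐ[k] k}

lemma symm (h : Joint Q Q') : Joint Q' Q := by
  obtain ⟨D, i, ρ, T, φ, φ', h1, h2, h3, h4, h5⟩ := h
  exact ⟨D, i, ρ, T, φ', φ, h1, h3, h2, h5, h4⟩

lemma restrict_left (h : Joint Q Q') {C : Subalgebra k K} (hC : C ≤ B) :
    Joint (Q.comp (Subalgebra.inclusion hC)) Q' := by
  obtain ⟨D, i, ρ, T, φ, φ', h1, h2, h3, h4, h5⟩ := h
  exact ⟨D, i, ρ, T, φ.comp (Subalgebra.inclusion hC).toRingHom, φ', h1, fun b => h2 _, h3,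
    fun b => h4 _, h5⟩

lemma restrict_right (h : Joint Q Q') {C : Subalgebra k K} (hC : C ≤ B') :
    Joint Q (Q'.comp (Subalgebra.inclusion hC)) := (h.symm.restrict_left hC).symm

lemma apply_eq (h : Joint Q Q') {a : K} (ha : a ∈ B) (ha' : a ∈ B') : Q ⟨a, ha⟩ = Q' ⟨a, ha'⟩ := by
  obtain ⟨D, i, ρ, T, φ, φ', h1, h2, h3, h4, h5⟩ := h
  rw [← h4, ← h5]
  congr 1
  apply h1
  rw [h2, h3]

/-- The relation `a c = 1` descends from `K` to the common ring `D`, as `ρ` is injective, and is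
then evaluated at the common point. -/
lemma mul_eq_one (h : Joint Q Q') {a c : K} (ha : a ∈ B) (hc : c ∈ B') (hac : a * c = 1) :
    Q ⟨a, ha⟩ * Q' ⟨c, hc⟩ = 1 := by
  obtain ⟨D, i, ρ, T, φ, φ', h1, h2, h3, h4, h5⟩ := h
  rw [← h4, ← h5, ← map_mul]
  have : φ ⟨a, ha⟩ * φ' ⟨c, hc⟩ = 1 := h1 (by rw [map_mul, h2, h3, hac, map_one])
  rw [this, map_one]

end Joint

lemma zpow_mem_of_inv_mem {B : Subalgebra k K} {z : Kˣ} (hz : (z : K) ∈ B) (hz' : (↑z⁻¹ : K) ∈ B)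
    (n : ℤ) : (↑(z ^ n) : K) ∈ B := by
  obtain ⟨n, rfl | rfl⟩ := n.eq_nat_or_neg
  · simpa using B.pow_mem hz n
  · rw [zpow_neg, ← inv_zpow, zpow_natCast, Units.val_pow_eq_pow_val]
    exact B.pow_mem hz' n

/-- The function `z^i w^m` vanishes at `Q`. If `m' ≤ 0`, its inverse `z'^{-i'} w'^{-m'}` would be
regular on the other chart. -/
lemma Joint.exponent_pos {B B' : Subalgebra k K} {Q : B →ₐ[k] k} {Q' : B' →ₐ[k] k}
    (h : Joint Q Q') {z w z' w' : Kˣ} (hz : (z : K) ∈ B) (hzi : (↑z⁻¹ : K) ∈ B) (hw : (w : K) ∈ B)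
    (hz' : (z' : K) ∈ B') (hzi' : (↑z'⁻¹ : K) ∈ B') (hw' : (w' : K) ∈ B')
    (hQ : Q ⟨w, hw⟩ = 0) {i m i' m' : ℤ} (e : z ^ i * w ^ m = z' ^ i' * w' ^ m') (hm : 0 < m) :
    0 < m' := by
  by_contra hm'
  obtain ⟨n, rfl⟩ := Int.eq_ofNat_of_zero_le hm.le
  obtain ⟨n', hn'⟩ := Int.eq_ofNat_of_zero_le (show 0 ≤ -m' by omega)
  have h1 : (↑(z ^ i) * (w : K) ^ n) * (↑(z' ^ (-i')) * (w' : K) ^ n') = 1 := by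
    have : (z ^ i * w ^ n) * (z' ^ (-i') * w' ^ n') = 1 := by
      rw [← zpow_natCast, ← zpow_natCast, ← hn', e, mul_mul_mul_comm]
      simp
    simpa using congr_arg Units.val this
  have ha : (↑(z ^ i) * (w : K) ^ n) ∈ B := B.mul_mem (zpow_mem_of_inv_mem hz hzi _) (B.pow_mem hw _)
  have h2 := h.mul_eq_one ha (B'.mul_mem (zpow_mem_of_inv_mem hz' hzi' _) (B'.pow_mem hw' _)) h1
  have h3 : (⟨_, ha⟩ : B) = ⟨_, zpow_mem_of_inv_mem hz hzi i⟩ * ⟨w, hw⟩ ^ n := rfl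
  have hn : n ≠ 0 := by omega
  rw [h3, map_mul, map_pow, hQ, zero_pow hn, mul_zero, zero_mul] at h2
  exact zero_ne_one h2

end Joint

/-- A primitive vector is determined by its open half-plane: `w = c v` with `c > 0`, and `c` is a
unit because `w` is primitive. -/
lemma eq_of_forall_pos_iff {v w : Fin 2 → ℤ} (hv : IsCoprime (v 0) (v 1)) (hw : IsCoprime (w 0) (w 1))
    (h : ∀ a b, 0 < v 0 * a + v 1 * b ↔ 0 < w 0 * a + w 1 * b) : v = w := by
  obtain ⟨a, b, hab⟩ := hv
  have hc := (h a b).1 (by rw [show v 0 * a + v 1 * b = 1 by rw [← hab]; ring]; exact one_pos)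
  set c := w 0 * a + w 1 * b with hcdef
  -- Both directions of the line orthogonal to `v` are tested, so `w` vanishes on this line.
  have h1 := (h (-v 1) (v 0)).not.1 (by rw [not_lt]; apply le_of_eq; ring)
  have h2 := (h (v 1) (-v 0)).not.1 (by rw [not_lt]; apply le_of_eq; ring)
  have h3 : w 1 * v 0 = w 0 * v 1 := by linarith
  have e0 : w 0 = c * v 0 := by
    rw [hcdef]; linear_combination -(w 0) * hab - b * h3
  have e1 : w 1 = c * v 1 := by
    rw [hcdef]; linear_combination -(w 1) * hab + a * h3
  rw [e0, e1] at hw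
  have hu : IsUnit c := by
    obtain ⟨r, s, hrs⟩ := hw
    exact IsUnit.of_mul_eq_one (r * v 0 + s * v 1) (by rw [← hrs]; ring)
  have hc1 : c = 1 := by
    rcases Int.isUnit_iff.1 hu with h | h
    · exact h
    · omega
  funext t
  fin_cases t
  · simp [e0, hc1]
  · simp [e1, hc1]

/-! ### The rings of the charts `(0, 1) ∘_g α` and `β ∘_g α` over the ring of `C_α`. -/

section ChartModels

variable {k : Type u} [Field k] {f : Laurent k 2}

namespace Omega

/-- The chart has a plane model with equation `ℱ_α`. -/
def HasPlaneModel (α : Omega f) : Prop :=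
  ∃ h, IsPlaneModel α.ring (α.coord α.1.j.castSucc : FunctionRing f) (α.coord (Fin.last _)) α.1.F h

variable {α : Omega f} {g : MvPolynomial (Fin (α.1.l + 2)) k} {s : Fin (α.1.l + 2) → ℤ}

/-- Membership of the new chart in `Ω` makes `g` invertible in `k(C₀)`, and with it the factor `e`;
only then can `e` serve as a coordinate. -/
lemma exists_unit_of_mem_nonZeroDivisors
    (h : ∀ i, Ideal.Quotient.mk (Ideal.span {f}) ((α.1.remove g s).g i) ∈
      nonZeroDivisors (CoordRing f)) {e : FunctionRing f} {u : (FunctionRing f)ˣ}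
    (he : toFunction f (MvPolynomial.aeval α.1.vars g) = u * e) :
    ∃ G : (FunctionRing f)ˣ, (G : FunctionRing f) = e := by
  have h1 := h (Fin.last _)
  have h2 : (α.1.remove g s).g (Fin.last _) = MvPolynomial.aeval α.1.vars g :=
    Fin.snoc_last (α := fun _ => Laurent k 2) _ _
  rw [h2] at h1
  have h3 : IsUnit (toFunction f (MvPolynomial.aeval α.1.vars g)) :=
    IsLocalization.map_units (FunctionRing f) (⟨_, h1⟩ : nonZeroDivisors (CoordRing f))
  rw [he, Units.isUnit_units_mul] at h3
  exact h3

section Remove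

variable {h : ∀ i, Ideal.Quotient.mk (Ideal.span {f}) ((α.1.remove g s).g i) ∈
      nonZeroDivisors (CoordRing f)} {G : (FunctionRing f)ˣ}
    (hG : toFunction f (MvPolynomial.aeval α.1.vars g) =
      ((∏ t, α.var t ^ s t : (FunctionRing f)ˣ) : FunctionRing f) * G)
include hG

lemma coord_remove_castSucc (t : Fin (α.1.l + 1)) :
    (α.remove g s h).coord t.castSucc.castSucc = α.coord t.castSucc := by
  rw [coord_remove α h hG, ← newPos_succAbove_castSucc]
  exact Fin.insertNth_apply_succAbove (α := fun _ => (FunctionRing f)ˣ) _ _ _ _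

lemma coord_remove_newPos : (α.remove g s h).coord (newPos _) = G := by
  rw [coord_remove α h hG]
  exact Fin.insertNth_apply_same (α := fun _ => (FunctionRing f)ˣ) _ _ _

lemma coord_remove_last : (α.remove g s h).coord (Fin.last _) = α.coord (Fin.last _) := by
  rw [coord_remove α h hG]
  refine Eq.trans ?_
    (Fin.insertNth_apply_succAbove (α := fun _ => (FunctionRing f)ˣ) (newPos _) G α.coord _)
  congr 1
  exact newPos_succAbove_last.symm

lemma ring_le_remove : α.ring ≤ (α.remove g s h).ring := by
  refine α.ring_le (fun t => ?_) ?_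
  · rw [← coord_remove_castSucc (h := h) hG]
    exact ⟨coord_castSucc_mem _ _, coord_castSucc_inv_mem _ _⟩
  · rw [← coord_remove_last (h := h) hG]
    exact coord_last_mem _

lemma inv_mem_remove : (↑G⁻¹ : FunctionRing f) ∈ (α.remove g s h).ring := by
  rw [← coord_remove_newPos (h := h) hG]
  exact coord_castSucc_inv_mem _ (Fin.last _)

/-- With `ring_le_remove` and `inv_mem_remove`, this identifies the ring as that of `C_α` with `G`
inverted, in the form required by `IsPlaneModel.remove`. -/
lemma remove_le {S : Subalgebra k (FunctionRing f)} (h1 : α.ring ≤ S) (h2 : (G : FunctionRing f) ∈ S)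
    (h3 : (↑G⁻¹ : FunctionRing f) ∈ S) : (α.remove g s h).ring ≤ S := by
  refine ring_le _ (fun t => ?_) ?_
  · induction t using Fin.lastCases with
    | last =>
      have := coord_remove_newPos (h := h) hG
      rw [newPos] at this
      erw [this]
      exact ⟨h2, h3⟩
    | cast t =>
      have := coord_remove_castSucc (h := h) hG t
      erw [this]
      exact ⟨h1 (coord_castSucc_mem _ _), h1 (coord_castSucc_inv_mem _ _)⟩
  · rw [coord_remove_last (h := h) hG]
    exact h1 (coord_last_mem _)

end Remove

section Blowup

variable {N : Matrix.SpecialLinearGroup (Fin 2) ℤ} {F : k[X][X]}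
    {h : ∀ i, Ideal.Quotient.mk (Ideal.span {f}) ((α.1.blowup g s N F).g i) ∈
      nonZeroDivisors (CoordRing f)} {G : (FunctionRing f)ˣ}
    (hG : toFunction f (MvPolynomial.aeval α.1.vars g) =
      ((∏ t, α.var t ^ s t : (FunctionRing f)ˣ) : FunctionRing f) * G)
include hG

lemma coord_blowup_castSucc (t : Fin (α.1.l + 1)) :
    (α.blowup g s N F h).coord t.castSucc.castSucc = α.coord t.castSucc := by
  rw [← coord_remove_castSucc (h := h) hG, ← monomials_coord_blowup α h]
  exact ((monomials_idBlock _ N).1 t).symm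

lemma eq_coord_blowup : G = (α.blowup g s N F h).coord (newPos _) ^ N.1 0 0 *
    (α.blowup g s N F h).coord (Fin.last _) ^ N.1 1 0 := by
  conv_lhs => rw [← coord_remove_newPos (h := h) hG, ← monomials_coord_blowup α h]
  exact (monomials_idBlock _ N).2.1

lemma coord_last_eq_coord_blowup : α.coord (Fin.last _) =
    (α.blowup g s N F h).coord (newPos _) ^ N.1 0 1 *
    (α.blowup g s N F h).coord (Fin.last _) ^ N.1 1 1 := by
  conv_lhs => rw [← coord_remove_last (h := h) hG, ← monomials_coord_blowup α h]
  exact (monomials_idBlock _ N).2.2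

/-- On the new chart only the last coordinate `w` need not be invertible, so the old `Y = z^*
w^{β₂}` is regular because `β₂ > 0`. -/
lemma ring_le_blowup (hN : IsPositivePrimitive (N.1 1)) : α.ring ≤ (α.blowup g s N F h).ring := by
  refine α.ring_le (fun t => ?_) ?_
  · rw [← coord_blowup_castSucc (h := h) hG]
    exact ⟨coord_castSucc_mem _ _, coord_castSucc_inv_mem _ _⟩
  · rw [coord_last_eq_coord_blowup (h := h) hG, Units.val_mul]
    obtain ⟨n, hn⟩ := Int.eq_ofNat_of_zero_le hN.2.2.le
    refine Subalgebra.mul_mem _ (zpow_mem_of_inv_mem (coord_castSucc_mem _ (Fin.last _))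
      (coord_castSucc_inv_mem _ (Fin.last _)) _) ?_
    rw [hn, zpow_natCast, Units.val_pow_eq_pow_val]
    exact Subalgebra.pow_mem _ (coord_last_mem _) _

lemma blowup_le {S : Subalgebra k (FunctionRing f)} (h1 : α.ring ≤ S)
    (h2 : ((α.blowup g s N F h).coord (newPos _) : FunctionRing f) ∈ S)
    (h3 : (↑((α.blowup g s N F h).coord (newPos _))⁻¹ : FunctionRing f) ∈ S)
    (h4 : ((α.blowup g s N F h).coord (Fin.last _) : FunctionRing f) ∈ S) :
    (α.blowup g s N F h).ring ≤ S := by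
  refine ring_le _ (fun t => ?_) h4
  induction t using Fin.lastCases with
  | last => exact ⟨h2, h3⟩
  | cast t =>
    have := coord_blowup_castSucc (h := h) hG t
    erw [this]
    exact ⟨h1 (coord_castSucc_mem _ _), h1 (coord_castSucc_inv_mem _ _)⟩

end Blowup

end Omega

end ChartModels

/-! ### Induction along the resolution. -/

section Induction

variable {k : Type u} [Field k] {f : Laurent k 2}

lemma toFunction_mono (x y : (FunctionRing f)ˣ) (hx : (x : FunctionRing f) = toFunction f xVar)
    (hy : (y : FunctionRing f) = toFunction f yVar) (e : Fin 2 → ℤ) :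
    toFunction f (mono e) = ((x ^ e 0 * y ^ e 1 : (FunctionRing f)ˣ) : FunctionRing f) := by
  let φ : (Laurent k 2)ˣ →* (FunctionRing f)ˣ := Units.map (toFunction f : Laurent k 2 →* FunctionRing f)
  have h1 : φ (monoUnit (Pi.single 0 1)) = x := Units.ext hx.symm
  have h2 : φ (monoUnit (Pi.single 1 1)) = y := Units.ext hy.symm
  have h3 : (monoUnit e : (Laurent k 2)ˣ) =
      monoUnit (Pi.single 0 1) ^ e 0 * monoUnit (Pi.single 1 1) ^ e 1 := by
    apply Units.ext
    rw [monoUnit_zpow, monoUnit_zpow, Units.val_mul, val_monoUnit, val_monoUnit, val_monoUnit,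
      mono_mul_mono]
    congr 1
    ext t
    fin_cases t <;> simp
  have h4 := congr_arg φ h3
  rw [map_mul, map_zpow, map_zpow, h1, h2] at h4
  rw [← h4]
  rfl

/-- The properties of the sets of charts that are proved by induction. -/
structure IsGoodSet (Sig : Set (Omega f)) : Prop where
  hasPlaneModel : ∀ γ ∈ Sig, γ.HasPlaneModel
  exists_unit : ∀ γ ∈ Sig, ∃ u : (Laurent k 2)ˣ, ∃ b ∈ γ.ring,
    toFunction f u = γ.coord (Fin.last _) * b
  eq_of_joint : ∀ γ ∈ Sig, ∀ γ' ∈ Sig, ∀ (Q : γ.ring →ₐ[k] k) (Q' : γ'.ring →ₐ[k] k),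
    Q γ.Y = 0 → Q' γ'.Y = 0 → Joint Q Q' → γ = γ'

namespace FirstChoice

variable (c : FirstChoice f)

/-- The element `(v, ())` of `Ω`. -/
def omega (v : Fin 2 → ℤ) : Omega f := ⟨c.chart v, fun i => Fin.elim0 i⟩

lemma val_var_omega_zero (v : Fin 2 → ℤ) :
    ((c.omega v).var (0 : Fin 2) : FunctionRing f) = toFunction f xVar := rfl

lemma val_var_omega_one (v : Fin 2 → ℤ) :
    ((c.omega v).var (1 : Fin 2) : FunctionRing f) = toFunction f yVar := rfl

lemma coord_omega (v : Fin 2 → ℤ) (t : Fin 2) : ((c.omega v).coord t : FunctionRing f) =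
    toFunction f (mono fun s => ((c.M v)⁻¹).1 s t) := by
  rw [toFunction_mono _ _ (c.val_var_omega_zero v) (c.val_var_omega_one v)]
  congr 1
  exact Fin.prod_univ_two _

/-- There are only the two coordinates `X₁`, `Y`, both monomials in `x₁`, `y`. A relation between
them on `C₀` is a multiple of `f`, which is `ℱ` up to a monomial. -/
lemma hasPlaneModel_omega {v : Fin 2 → ℤ} (hv : IsEdgeNormal (newtonPolygon f) v) :
    (c.omega v).HasPlaneModel := by
  obtain ⟨s, hs⟩ := c.eq v hv
  let X' : Laurent k 2 := mono fun t => ((c.M v)⁻¹).1 t 0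
  let Y' : Laurent k 2 := mono fun t => ((c.M v)⁻¹).1 t 1
  have hX : ((c.omega v).coord (0 : Fin 2) : FunctionRing f) = toFunction f X' := c.coord_omega v 0
  have hY : ((c.omega v).coord (1 : Fin 2) : FunctionRing f) = toFunction f Y' := c.coord_omega v 1
  have hmap : ∀ a : k[X][X], biAeval ((c.omega v).coord (0 : Fin 2) : FunctionRing f)
      ((c.omega v).coord (1 : Fin 2)) a = toFunction f (biAeval X' Y' a) := by
    intro a
    rw [map_biAeval, hX, hY]
  have hz : ∀ a : Laurent k 2, toFunction f a = 0 ↔ f ∣ a := by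
    intro a
    rw [← Ideal.mem_span_singleton, ← Ideal.Quotient.eq_zero_iff_mem]
    exact map_eq_zero_iff _ (IsFractionRing.injective (CoordRing f) (FunctionRing f))
  have hu : IsUnit (mono s : Laurent k 2) := (monoUnit s).isUnit
  refine ⟨X, IsPlaneModel.base ((c.omega v).coord (0 : Fin 2)) ?_ ?_ ?_ ?_ ?_ (c.not_dvd v hv) ?_⟩
  · exact (c.omega v).coord_castSucc_mem (0 : Fin 1)
  · exact (c.omega v).coord_castSucc_inv_mem (0 : Fin 1)
  · exact (c.omega v).coord_last_mem
  · intro S h1 h2 h3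
    refine (c.omega v).ring_le (fun t => ?_) h3
    have : t = (0 : Fin 1) := Subsingleton.elim (α := Fin 1) _ _
    subst this
    exact ⟨h1, h2⟩
  · refine (hmap _).trans ((hz _).2 ?_)
    rw [← hu.dvd_mul_left]
    exact dvd_of_eq hs
  · intro a ha
    have h1 := (hz _).1 ((hmap a).symm.trans ha)
    have h2 : biAeval X' Y' (c.F v) ∣ biAeval X' Y' a := by
      refine Dvd.dvd.trans ?_ h1
      exact Dvd.intro_left _ hs.symm
    -- The substitution by `M` takes the monomials `X₁`, `Y` back to the two variables of the
    -- Laurent ring.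
    have h3 := map_dvd (laurentMap (c.M v).1) h2
    have hcol : ∀ t : Fin 2, laurentMap (c.M v).1
        (mono fun s => ((c.M v)⁻¹).1 s t : Laurent k 2) = mono (Pi.single t 1) := by
      intro t
      rw [laurentMap_mono]
      congr 1
      have h4 : ((c.M v).1 * ((c.M v)⁻¹).1) = 1 := by
        rw [← Matrix.SpecialLinearGroup.coe_mul, mul_inv_cancel, Matrix.SpecialLinearGroup.coe_one]
      ext i
      have h5 := congr_fun (congr_fun h4 i) t
      rw [Matrix.mul_apply] at h5
      refine h5.trans ?_
      rw [Matrix.one_apply, Pi.single_apply]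
    rw [map_biAeval, map_biAeval, hcol 0, hcol 1] at h3
    exact h3

lemma eq_omega {γ : Omega f} {v : Fin 2 → ℤ} (h : γ.1 = c.chart v) : γ = c.omega v :=
  Subtype.ext h

/-- When `M` is attached to `v`, its last row is `v`, so the exponent of `Y` in the monomial with
exponent vector `e` is `v · e`. -/
lemma prod_var_omega (v : Fin 2 → ℤ) (e : Fin 2 → ℤ) :
    ∏ t : Fin 2, (c.omega v).var t ^ e t =
      (c.omega v).coord (0 : Fin 2) ^ ((c.M v).1.mulVec e) 0 *
        (c.omega v).coord (1 : Fin 2) ^ ((c.M v).1.mulVec e) 1 := by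
  have h1 := prod_monomials (ι := Fin 2) (c.omega v).coord (c.M v).1 e
  have h2 : monomials (ι := Fin 2) (c.omega v).coord (c.M v).1 = (c.omega v).var :=
    Omega.monomials_coord _
  rw [h2, Fin.prod_univ_two (fun t => (c.omega v).coord t ^ _)] at h1
  exact h1

lemma isGoodSet_charts : IsGoodSet c.charts := by
  refine ⟨?_, ?_, ?_⟩
  · rintro γ ⟨v, hv, h⟩
    obtain rfl := c.eq_omega h
    exact c.hasPlaneModel_omega hv
  · rintro γ ⟨v, hv, h⟩
    obtain rfl := c.eq_omega h
    exact ⟨monoUnit fun s => ((c.M v)⁻¹).1 s 1, 1, Subalgebra.one_mem _, by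
      rw [mul_one]; exact (c.coord_omega v 1).symm⟩
  · rintro γ ⟨v, hv, h⟩ γ' ⟨v', hv', h'⟩
    obtain rfl := c.eq_omega h
    obtain rfl := c.eq_omega h'
    intro Q Q' hQ hQ' hJ
    -- A monomial in `x₁`, `y` with positive exponent of `Y` at one point must have positive
    -- exponent of `Y` at the joint point; so the two vectors define the same half-plane.
    have key : ∀ {v v' : Fin 2 → ℤ} (_ : IsEdgeNormal (newtonPolygon f) v)
        (_ : IsEdgeNormal (newtonPolygon f) v') {Q : (c.omega v).ring →ₐ[k] k}
        {Q' : (c.omega v').ring →ₐ[k] k} (_ : Q (c.omega v).Y = 0) (_ : Joint Q Q') (a b : ℤ),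
        0 < v 0 * a + v 1 * b → 0 < v' 0 * a + v' 1 * b := by
      intro v v' hv hv' Q Q' hQ hJ a b hab
      have e := (c.prod_var_omega v ![a, b]).symm.trans (c.prod_var_omega v' ![a, b])
      have hm : ∀ {v : Fin 2 → ℤ} (_ : IsEdgeNormal (newtonPolygon f) v),
          ((c.M v).1.mulVec ![a, b]) 1 = v 0 * a + v 1 * b := by
        intro v hv
        have h1 := c.attached v hv
        simp only [Matrix.mulVec, dotProduct, Fin.sum_univ_two, h1]
        simp
      rw [← hm hv] at hab
      rw [← hm hv']
      exact hJ.exponent_pos ((c.omega v).coord_castSucc_mem (0 : Fin 1))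
        ((c.omega v).coord_castSucc_inv_mem (0 : Fin 1)) (c.omega v).coord_last_mem
        ((c.omega v').coord_castSucc_mem (0 : Fin 1))
        ((c.omega v').coord_castSucc_inv_mem (0 : Fin 1)) (c.omega v').coord_last_mem hQ e hab
    have := eq_of_forall_pos_iff hv.1 hv'.1 fun a b =>
      ⟨key hv hv' hQ hJ a b, key hv' hv hQ' hJ.symm a b⟩
    rw [this]

end FirstChoice

namespace ResolvingData

variable {Sig : Set (Omega f)} (d : ResolvingData Sig)

lemma isLineModel_bar {α : Omega f} {h : k[X][X]}
    (H : IsPlaneModel α.ring (α.coord α.1.j.castSucc : FunctionRing f) (α.coord (Fin.last _)) α.1.F h) :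
    IsLineModel α.barRing (Ideal.Quotient.mk _ α.Xj) α.1.restr (h.map (evalRingHom 0)) :=
  H.isLineModel

lemma sub_mem {p : PrimeSpectrum d.α.barRing} (hp : p ∈ d.S) :
    Ideal.Quotient.mk _ d.α.Xj - algebraMap k d.α.barRing ((d.q p).eval 0) ∈ p.asIdeal := by
  have := d.q_spec p hp
  rwa [map_sub] at this

/-- A simple root would give a regular point, whereas the centres are singular. Hence passing to
`α̃` discards no simple root. -/
lemma rootMultiplicity_ne_one (hα : d.α.HasPlaneModel) {p : PrimeSpectrum d.α.barRing}
    (hp : p ∈ d.S) : d.α.1.restr.rootMultiplicity ((d.q p).eval 0) ≠ 1 := by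
  obtain ⟨h, H⟩ := hα
  exact fun h1 => d.singular p hp ((isLineModel_bar H).isRegularLocalRing (d.sub_mem hp) h1)

/-- The prime `p` is generated by `X_{j_α} - q_p(0)`. -/
lemma injOn_eval (hα : d.α.HasPlaneModel) {p p' : PrimeSpectrum d.α.barRing} (hp : p ∈ d.S)
    (hp' : p' ∈ d.S) (e : (d.q p).eval 0 = (d.q p').eval 0) : p = p' := by
  obtain ⟨h, H⟩ := hα
  have h1 := (isLineModel_bar H).eq_span (d.sub_mem hp)
  have h2 := (isLineModel_bar H).eq_span (d.sub_mem hp')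
  ext1
  rw [h1, h2, e]

/-- The function `G̃_p = X_{j_α} - q_p(Y)` on the chart `C_α`. -/
noncomputable def center (p : PrimeSpectrum d.α.barRing) : FunctionRing f :=
  d.α.coord d.α.1.j.castSucc - aeval (d.α.coord (Fin.last _) : FunctionRing f) (d.q p)

lemma toFunction_g {p : PrimeSpectrum d.α.barRing} (hp : p ∈ d.S) :
    toFunction f (MvPolynomial.aeval d.α.1.vars (d.g p)) =
      ((∏ t, d.α.var t ^ d.s p t : (FunctionRing f)ˣ) : FunctionRing f) * d.center p :=
  d.α.toFunction_aeval_of_isRelated (d.related p hp)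

lemma toFunction_prod_g :
    toFunction f (MvPolynomial.aeval d.α.1.vars (∏ p ∈ d.S, d.g p)) =
      ((∏ t, d.α.var t ^ (∑ p ∈ d.S, d.s p) t : (FunctionRing f)ˣ) : FunctionRing f) *
        ∏ p ∈ d.S, d.center p := by
  rw [map_prod, map_prod, Finset.prod_congr rfl fun p hp => d.toFunction_g hp,
    Finset.prod_mul_distrib, ← Units.coe_prod, Finset.prod_comm]
  congr 3
  funext t
  rw [Finset.sum_apply, zpow_sum_eq_prod_zpow]

lemma center_mem (p : PrimeSpectrum d.α.barRing) : d.center p ∈ d.α.ring :=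
  (d.α.Xj - aeval d.α.Y (d.q p)).2 |> fun h => by
    have e : ((d.α.Xj - aeval d.α.Y (d.q p) : d.α.ring) : FunctionRing f) = d.center p := by
      rw [Subalgebra.coe_sub, center]
      congr 1
      exact (aeval_algHom_apply d.α.ring.val d.α.Y (d.q p)).symm
    rwa [e] at h

lemma apply_center (p : PrimeSpectrum d.α.barRing) (Q : d.α.ring →ₐ[k] k) (hQ : Q d.α.Y = 0) :
    Q ⟨d.center p, d.center_mem p⟩ = Q d.α.Xj - (d.q p).eval 0 := by
  have e : (⟨d.center p, d.center_mem p⟩ : d.α.ring) = d.α.Xj - aeval d.α.Y (d.q p) := by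
    apply Subtype.ext
    rw [Subalgebra.coe_sub]
    change d.center p = _
    rw [center]
    congr 1
    exact aeval_algHom_apply d.α.ring.val d.α.Y (d.q p)
  rw [e, map_sub, ← aeval_algHom_apply, hQ, aeval_zero_eq]

/-- The chart `C_α̃` is the part of `C_α` where the `G̃_p` are invertible. -/
lemma tilde_spec (hα : d.α.HasPlaneModel) {γ : Omega f} (hγ : γ.1 = d.tilde) :
    γ.HasPlaneModel ∧ d.α.ring ≤ γ.ring ∧
      (γ.coord (Fin.last _) : FunctionRing f) = d.α.coord (Fin.last _) ∧
      ∀ p ∈ d.S, ∃ c ∈ γ.ring, d.center p * c = 1 := by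
  obtain ⟨γ, hΩ⟩ := γ
  change γ = d.tilde at hγ
  subst hγ
  obtain ⟨G, hG⟩ := Omega.exists_unit_of_mem_nonZeroDivisors hΩ d.toFunction_prod_g
  have hG' := d.toFunction_prod_g
  rw [← hG] at hG'
  let γ : Omega f := d.α.remove (∏ p ∈ d.S, d.g p) (∑ p ∈ d.S, d.s p) hΩ
  have hle : d.α.ring ≤ γ.ring := Omega.ring_le_remove hG'
  have hinv : (↑G⁻¹ : FunctionRing f) ∈ γ.ring := Omega.inv_mem_remove hG'
  have hlast : γ.coord (Fin.last _) = d.α.coord (Fin.last _) := Omega.coord_remove_last hG'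
  refine ⟨?_, hle, congr_arg Units.val hlast, ?_⟩
  · obtain ⟨h, H⟩ := hα
    refine ⟨h * ∏ p ∈ d.S, (X - C (d.q p)), ?_⟩
    have h1 := H.remove d.S d.q G hG hle hinv (fun S => Omega.remove_le hG')
      (fun p hp => d.rootMultiplicity_ne_one ⟨h, H⟩ hp)
    have h2 : γ.coord d.α.1.j.castSucc.castSucc = d.α.coord d.α.1.j.castSucc :=
      Omega.coord_remove_castSucc hG' _
    rw [← h2, ← hlast] at h1
    exact h1
  · intro p hp
    have : DecidableEq (PrimeSpectrum d.α.barRing) := Classical.decEq _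
    -- Only the product of the centres is a coordinate; one factor is inverted with the help of the
    -- others.
    refine ⟨(∏ p' ∈ d.S.erase p, d.center p') * ↑G⁻¹, Subalgebra.mul_mem _
      (Subalgebra.prod_mem _ fun p' _ => hle (d.center_mem p')) hinv, ?_⟩
    rw [← mul_assoc, Finset.mul_prod_erase _ _ hp, ← hG, Units.mul_inv]

/-- The coordinates of the chart `C_γ`, for `γ = β ∘_{g_p} α`. -/
lemma blowup_spec (hα : d.α.HasPlaneModel) {p : PrimeSpectrum d.α.barRing} (hp : p ∈ d.S)
    {β : Fin 2 → ℤ} (hβ : IsPositivePrimitive β) {γ : Omega f} (hγ : γ.1 = d.blowup p β) :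
    γ.HasPlaneModel ∧ d.α.ring ≤ γ.ring ∧ ∃ z : (FunctionRing f)ˣ,
      (z : FunctionRing f) ∈ γ.ring ∧ (↑z⁻¹ : FunctionRing f) ∈ γ.ring ∧
      ∃ G : (FunctionRing f)ˣ, (G : FunctionRing f) = d.center p ∧
        G = z ^ (d.M p β).1 0 0 * γ.coord (Fin.last _) ^ β 0 ∧
        d.α.coord (Fin.last _) = z ^ (d.M p β).1 0 1 * γ.coord (Fin.last _) ^ β 1 := by
  have hβ' := d.attached p hp β hβ
  have hN : IsPositivePrimitive ((d.M p β).1 1) := by rwa [hβ']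
  obtain ⟨γ, hΩ⟩ := γ
  change γ = d.blowup p β at hγ
  subst hγ
  obtain ⟨G, hG⟩ := Omega.exists_unit_of_mem_nonZeroDivisors (s := d.s p) hΩ
    (d.toFunction_g hp)
  have hG' := d.toFunction_g hp
  rw [← hG] at hG'
  let γ : Omega f := d.α.blowup (d.g p) (d.s p) (d.M p β) (d.F p β) hΩ
  have hle : d.α.ring ≤ γ.ring := Omega.ring_le_blowup hG' hN
  have hz : (γ.coord (newPos _) : FunctionRing f) ∈ γ.ring :=
    Omega.coord_castSucc_mem γ (Fin.last _)
  have hz' : (↑(γ.coord (newPos _))⁻¹ : FunctionRing f) ∈ γ.ring :=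
    Omega.coord_castSucc_inv_mem γ (Fin.last _)
  have e1 : G = γ.coord (newPos _) ^ (d.M p β).1 0 0 *
    γ.coord (Fin.last _) ^ (d.M p β).1 1 0 := Omega.eq_coord_blowup hG'
  have e2 : d.α.coord (Fin.last _) = γ.coord (newPos _) ^ (d.M p β).1 0 1 *
    γ.coord (Fin.last _) ^ (d.M p β).1 1 1 := Omega.coord_last_eq_coord_blowup hG'
  refine ⟨?_, hle, γ.coord (newPos _), hz, hz', G, hG, ?_, ?_⟩
  · obtain ⟨h, H⟩ := hα
    obtain ⟨n, hn⟩ := d.eq p hp β hβ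
    -- The point `p` lies on `C̄_α`, where `h` is invertible.
    have hh : biAeval ((d.q p).eval 0) (0 : k) h ≠ 0 := by
      rw [biAeval_zero_right]
      exact (isLineModel_bar H).eval_ne_zero (d.sub_mem hp)
    exact H.blowup hN (hG.symm.trans (congr_arg Units.val e1)) (congr_arg Units.val e2) hn
      (d.not_Y_dvd p hp β hβ) hh hle hz hz' γ.coord_last_mem (fun S => Omega.blowup_le hG')
  · rw [e1, hβ']; rfl
  · rw [e2, hβ']; rfl

/-- On a point of `C̄_γ`, for `γ = β ∘_{g_p} α`, the functions `Y` and `G̃_p` vanish. -/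
lemma blowup_apply (hα : d.α.HasPlaneModel) {p : PrimeSpectrum d.α.barRing} (hp : p ∈ d.S)
    {β : Fin 2 → ℤ} (hβ : IsPositivePrimitive β) {γ : Omega f} (hγ : γ.1 = d.blowup p β)
    (hle : d.α.ring ≤ γ.ring) {Q : γ.ring →ₐ[k] k} (hQ : Q γ.Y = 0) :
    Q (Subalgebra.inclusion hle d.α.Y) = 0 ∧
      Q (Subalgebra.inclusion hle d.α.Xj) = (d.q p).eval 0 := by
  obtain ⟨-, -, z, hz, hz', G, hG, e1, e2⟩ := d.blowup_spec hα hp hβ hγ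
  -- Both `Y_α` and the centre are monomials with positive exponent in the last coordinate of the
  -- new chart, since both entries of `β` are positive.
  have key : ∀ (i m : ℤ) (_ : 0 < m) (a : γ.ring),
      (a : FunctionRing f) = ((z ^ i * γ.coord (Fin.last _) ^ m : (FunctionRing f)ˣ) : FunctionRing f) →
      Q a = 0 := by
    intro i m hm a ha
    obtain ⟨n, rfl⟩ := Int.eq_ofNat_of_zero_le hm.le
    have : a = ⟨_, zpow_mem_of_inv_mem hz hz' i⟩ * γ.Y ^ n := by
      apply Subtype.ext
      rw [ha]
      simp [Omega.Y]
    rw [this, map_mul, map_pow, hQ, zero_pow (by omega), mul_zero]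
  have hY : Q (Subalgebra.inclusion hle d.α.Y) = 0 :=
    key _ _ hβ.2.2 _ (congr_arg Units.val e2)
  refine ⟨hY, ?_⟩
  have h1 := d.apply_center p (Q.comp (Subalgebra.inclusion hle)) hY
  have h2 : Q (Subalgebra.inclusion hle ⟨d.center p, d.center_mem p⟩) = 0 :=
    key _ _ hβ.2.1 _ (hG.symm.trans (congr_arg Units.val e1))
  exact (sub_eq_zero.1 (h1.symm.trans h2))

/-- A new chart maps to `C_α`, and its points with `Y = 0` map to points of `C̄_α`. Coincidences
with old charts are thus excluded by the induction hypothesis, and new charts are compared through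
the images of their points in `C̄_α`. -/
lemma isGoodSet_next (H : IsGoodSet Sig) : IsGoodSet d.next := by
  have hα := H.hasPlaneModel _ d.α_mem
  -- the charts over `C_α`
  have hover : ∀ γ ∈ d.next, γ ∈ Sig ∧ γ ≠ d.α ∨ (γ.HasPlaneModel ∧ ∃ hle : d.α.ring ≤ γ.ring,
      (∃ b ∈ γ.ring, (d.α.coord (Fin.last _) : FunctionRing f) = γ.coord (Fin.last _) * b) ∧
      ∀ Q : γ.ring →ₐ[k] k, Q γ.Y = 0 → Q (Subalgebra.inclusion hle d.α.Y) = 0 ∧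
        (γ.1 = d.tilde ∧ (∀ p ∈ d.S, Q (Subalgebra.inclusion hle d.α.Xj) ≠ (d.q p).eval 0) ∨
          ∃ p ∈ d.S, Q (Subalgebra.inclusion hle d.α.Xj) = (d.q p).eval 0 ∧
            ∃ β, IsPositivePrimitive β ∧ γ.1 = d.blowup p β)) := by
    rintro γ ((⟨h1, h2⟩ | hγ) | ⟨p, hp, β, hβ, hγ, -⟩)
    · exact Or.inl ⟨h1, h2⟩
    · obtain ⟨hm, hle, hY, hc⟩ := d.tilde_spec hα hγ
      refine Or.inr ⟨hm, hle, ⟨1, Subalgebra.one_mem _, by rw [mul_one, hY]⟩, fun Q hQ => ?_⟩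
      have hYQ : Q (Subalgebra.inclusion hle d.α.Y) = 0 := by
        rw [← hQ]; congr 1; exact Subtype.ext hY.symm
      refine ⟨hYQ, Or.inl ⟨hγ, fun p hp h0 => ?_⟩⟩
      obtain ⟨c, hc, e⟩ := hc p hp
      have h1 := d.apply_center p (Q.comp (Subalgebra.inclusion hle)) hYQ
      have h2 : Q.comp (Subalgebra.inclusion hle) d.α.Xj = (d.q p).eval 0 := h0
      rw [h2, sub_self] at h1
      have h3 : (Subalgebra.inclusion hle ⟨d.center p, d.center_mem p⟩) * (⟨c, hc⟩ : γ.ring) = 1 :=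
        Subtype.ext e
      have h4 := congr_arg Q h3
      rw [map_mul, map_one] at h4
      have h5 : Q (Subalgebra.inclusion hle ⟨d.center p, d.center_mem p⟩) = 0 := h1
      rw [h5, zero_mul] at h4
      exact zero_ne_one h4
    · obtain ⟨hm, hle, z, hz, hz', G, hG, e1, e2⟩ := d.blowup_spec hα hp hβ hγ
      refine Or.inr ⟨hm, hle, ?_, fun Q hQ => ?_⟩
      · obtain ⟨n, hn⟩ := Int.eq_ofNat_of_zero_le hβ.2.2.le
        have h0 := hβ.2.2
        -- As `β₂ ≥ 1`, one factor `w` can be split off from `Y_α = z^* w^{β₂}`.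
        obtain ⟨n, rfl⟩ : ∃ n', n = n' + 1 := ⟨n - 1, by omega⟩
        refine ⟨(↑(z ^ (d.M p β).1 0 1) : FunctionRing f) * (γ.coord (Fin.last _)) ^ n,
          Subalgebra.mul_mem _ (zpow_mem_of_inv_mem hz hz' _)
            (Subalgebra.pow_mem _ γ.coord_last_mem _), ?_⟩
        rw [e2, hn, zpow_natCast, Units.val_mul, Units.val_pow_eq_pow_val]
        ring
      · obtain ⟨h1, h2⟩ := d.blowup_apply hα hp hβ hγ hle hQ
        exact ⟨h1, Or.inr ⟨p, hp, h2, β, hβ, hγ⟩⟩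
  refine ⟨fun γ hγ => ?_, fun γ hγ => ?_, ?_⟩
  · rcases hover γ hγ with h | h
    · exact H.hasPlaneModel γ h.1
    · exact h.1
  · rcases hover γ hγ with h | ⟨-, hle, ⟨b, hb, e⟩, -⟩
    · exact H.exists_unit γ h.1
    · obtain ⟨u, b', hb', e'⟩ := H.exists_unit _ d.α_mem
      exact ⟨u, b * b', Subalgebra.mul_mem _ hb (hle hb'), by rw [e', e, mul_assoc]⟩
  · have hold : ∀ γ ∈ Sig, γ ≠ d.α → ∀ γ' : Omega f, ∀ hle : d.α.ring ≤ γ'.ring,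
        ∀ (Q : γ.ring →ₐ[k] k) (Q' : γ'.ring →ₐ[k] k), Q γ.Y = 0 →
        Q' (Subalgebra.inclusion hle d.α.Y) = 0 → ¬ Joint Q Q' := by
      intro γ hγ hne γ' hle Q Q' hQ hQ' hJ
      exact hne (H.eq_of_joint _ hγ _ d.α_mem Q _ hQ hQ' (hJ.restrict_right hle))
    intro γ hγ γ' hγ' Q Q' hQ hQ' hJ
    rcases hover γ hγ with h | ⟨-, hle, -, h⟩ <;> rcases hover γ' hγ' with h' | ⟨-, hle', -, h'⟩
    · exact H.eq_of_joint _ h.1 _ h'.1 Q Q' hQ hQ' hJ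
    · exact absurd hJ (hold _ h.1 h.2 _ hle' Q Q' hQ (h' Q' hQ').1)
    · exact absurd hJ.symm (hold _ h'.1 h'.2 _ hle Q' Q hQ' (h Q hQ).1)
    -- The value of `X_{j_α}` is the same at joint points. It avoids all `q_p(0)` on `α̃` and equals
    -- `q_p(0)` on the charts of `Σ_p`, so it tells which kind of chart and which `p` is involved.
    · have hX : Q (Subalgebra.inclusion hle d.α.Xj) = Q' (Subalgebra.inclusion hle' d.α.Xj) :=
        hJ.apply_eq _ _
      obtain ⟨-, ⟨e, h⟩ | ⟨p, hp, h, β, hβ, e⟩⟩ := h Q hQ <;>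
        obtain ⟨-, ⟨e', h'⟩ | ⟨p', hp', h', β', hβ', e'⟩⟩ := h' Q' hQ'
      · exact Subtype.ext (e.trans e'.symm)
      · exact absurd (hX.trans h') (h p' hp')
      · exact absurd (hX.symm.trans h) (h' p hp)
      · obtain rfl := d.injOn_eval hα hp hp' (h.symm.trans (hX.trans h'))
        obtain ⟨-, -, z, hz, hzi, G, hG, e1, e2⟩ := d.blowup_spec hα hp hβ e
        obtain ⟨-, -, z', hz', hzi', G', hG', e1', e2'⟩ := d.blowup_spec hα hp hβ' e'
        obtain rfl : G = G' := Units.ext (hG.trans hG'.symm)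
        have hexp : ∀ (z w : (FunctionRing f)ˣ) (m n : ℤ) (β : Fin 2 → ℤ) (a b : ℤ),
            (z ^ m * w ^ β 0) ^ a * (z ^ n * w ^ β 1) ^ b =
              z ^ (m * a + n * b) * w ^ (β 0 * a + β 1 * b) := by
          intro z w m n β a b
          rw [mul_zpow, mul_zpow, mul_mul_mul_comm, ← zpow_mul, ← zpow_mul, ← zpow_mul, ← zpow_mul,
            ← zpow_add, ← zpow_add]
        have hββ' : β = β' := by
          refine eq_of_forall_pos_iff hβ.1 hβ'.1 fun a b => ?_
          -- The same monomial in the centre `G` and `Y_α`, rewritten on each side in the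
          -- coordinates of one chart; its exponents in the two last coordinates are `β · (a, b)`
          -- and `β' · (a, b)`.
          have e3 : G ^ a * d.α.coord (Fin.last _) ^ b = G ^ a * d.α.coord (Fin.last _) ^ b := rfl
          conv_lhs at e3 => rw [e1, e2, hexp]
          conv_rhs at e3 => rw [e1', e2', hexp]
          exact ⟨hJ.exponent_pos hz hzi γ.coord_last_mem hz' hzi' γ'.coord_last_mem hQ e3,
            hJ.symm.exponent_pos hz' hzi' γ'.coord_last_mem hz hzi γ.coord_last_mem hQ' e3.symm⟩
        rw [hββ'] at e
        exact Subtype.ext (e.trans e'.symm)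

end ResolvingData

lemma SimpleBakerResolution.isGoodSet (R : SimpleBakerResolution f) {n : ℕ} (hn : 1 ≤ n) :
    IsGoodSet (R.Sig n) := by
  induction n, hn using Nat.le_induction with
  | base =>
    obtain ⟨c, hc⟩ := R.first
    rw [hc]
    exact c.isGoodSet_charts
  | succ n hn ih =>
    obtain ⟨d, hd⟩ := R.step n hn
    rw [hd]
    exact d.isGoodSet_next ih

end Induction

/-! ### Rational points of the glued scheme. -/

section GluedPoints

variable {k K : Type u} [Field k] [CommRing K] [Algebra k K]
variable {J : Type u} {B : J → Subalgebra k K}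

/-- The inclusion of a dense open subscheme of a chart in the glued scheme. -/
noncomputable def Piece.toGlued (P : Piece B) : P.U.toScheme ⟶ glued B :=
  Limits.colimit.ι (diagram B) P

instance (P : Piece B) : IsOpenImmersion P.toGlued :=
  inferInstanceAs (IsOpenImmersion (Limits.colimit.ι (diagram B) P))

lemma Piece.hom_toGlued {P Q : Piece B} (f : P ⟶ Q) : f.hom ≫ Q.toGlued = P.toGlued :=
  Limits.colimit.w (diagram B) f

lemma ι_eq_topIso_inv_comp (i : J) :
    ι B i = (chart B i).topIso.inv ≫ (Piece.whole B i).toGlued := rfl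

instance isOpenImmersion_ι (i : J) : IsOpenImmersion (ι B i) := by
  rw [ι_eq_topIso_inv_comp]
  infer_instance

lemma Piece.toGlued_eq (P : Piece B) : P.toGlued = P.U.ι ≫ ι B P.idx := by
  let F : P ⟶ Piece.whole B P.idx := ⟨(chart B P.idx).homOfLE le_top, inferInstance, by
    rw [← cancel_mono (Piece.whole B P.idx).U.ι, Piece.gen_ι, Category.assoc]
    simp only [Scheme.homOfLE_ι]
    exact Piece.gen_ι P⟩
  rw [← Piece.hom_toGlued F]
  have h : (Piece.whole B P.idx).toGlued = (Piece.whole B P.idx).U.ι ≫ ι B P.idx :=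
    (whole_ι B P.idx).symm
  rw [h, ← Category.assoc]
  congr 1
  exact Scheme.homOfLE_ι (chart B P.idx) (le_top : P.U ≤ ⊤)

lemma Piece.toGlued_over (P : Piece B) : P.toGlued ≫ gluedOver B = P.U.ι ≫ chartOver B P.idx :=
  Limits.colimit.ι_desc _ _

lemma ι_over (i : J) : ι B i ≫ gluedOver B = chartOver B i := by
  rw [ι_eq_topIso_inv_comp, Category.assoc, Piece.toGlued_over]
  exact (chart B i).topIso.inv_hom_id_assoc _

lemma exists_ι_apply_eq (x : glued B) : ∃ i y, ι B i y = x := by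
  obtain ⟨P, (y : P.U.toScheme), (hy : P.toGlued y = x)⟩ :=
    Scheme.IsLocallyDirected.ι_jointly_surjective (diagram B) x
  refine ⟨P.idx, P.U.ι y, ?_⟩
  rw [← Scheme.Hom.comp_apply, ← Piece.toGlued_eq]
  exact hy

/-- Charts have the same morphism to the glued scheme on a common dense open subscheme. -/
lemma comp_ι_eq_comp_ι {i j : J} {Z : Scheme.{u}} (F : Z ⟶ chart B i) (G : Z ⟶ chart B j)
    [IsOpenImmersion F] [IsOpenImmersion G] (w : Spec (CommRingCat.of K) ⟶ Z)
    (hF : w ≫ F = generic B i) (hG : w ≫ G = generic B j) : F ≫ ι B i = G ≫ ι B j := by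
  have hU : Set.range (generic B i) ⊆ F.opensRange := by
    rw [← hF]
    rintro _ ⟨x, rfl⟩
    exact ⟨w x, rfl⟩
  let P : Piece B := ⟨i, F.opensRange, hU⟩
  have hP : P.gen = w ≫ F.isoOpensRange.hom := by
    rw [← cancel_mono P.U.ι, Piece.gen_ι, Category.assoc]
    refine hF.symm.trans ?_
    congr 1
    exact (Scheme.Hom.isoOpensRange_hom_ι F).symm
  let a : P ⟶ Piece.whole B i := ⟨F.isoOpensRange.inv ≫ F ≫ (chart B i).topIso.inv, inferInstance, by
    rw [← cancel_mono (Piece.whole B i).U.ι, Piece.gen_ι, hP]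
    simp only [Category.assoc, Iso.hom_inv_id_assoc]
    erw [Iso.inv_hom_id]
    rw [Category.comp_id, hF]⟩
  let b : P ⟶ Piece.whole B j := ⟨F.isoOpensRange.inv ≫ G ≫ (chart B j).topIso.inv, inferInstance, by
    rw [← cancel_mono (Piece.whole B j).U.ι, Piece.gen_ι, hP]
    simp only [Category.assoc, Iso.hom_inv_id_assoc]
    erw [Iso.inv_hom_id]
    rw [Category.comp_id, hG]⟩
  have h1 := (Piece.hom_toGlued a).trans (Piece.hom_toGlued b).symm
  simp only [a, b, Category.assoc, cancel_epi] at h1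
  exact h1

/-- The rational point of a chart given by a homomorphism of algebras. -/
noncomputable abbrev specPoint {C : Subalgebra k K} (Q : C →ₐ[k] k) :
    Spec (CommRingCat.of k) ⟶ Spec (CommRingCat.of C) :=
  Spec.map (CommRingCat.ofHom Q.toRingHom)

lemma specPoint_over {i : J} (Q : B i →ₐ[k] k) : specPoint Q ≫ chartOver B i = 𝟙 _ := by
  rw [specPoint, chartOver, ← Spec.map_comp, ← CommRingCat.ofHom_comp]
  have : Q.toRingHom.comp (algebraMap k (B i)) = RingHom.id k := RingHom.ext Q.commutes
  rw [this]
  exact Spec.map_id _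

lemma specPoint_comp_ι_over {i : J} (Q : B i →ₐ[k] k) : (specPoint Q ≫ ι B i) ≫ gluedOver B = 𝟙 _ := by
  rw [Category.assoc, ι_over, specPoint_over]

lemma exists_eq_specPoint {i : J} (P : Spec (CommRingCat.of k) ⟶ chart B i)
    (hP : P ≫ chartOver B i = 𝟙 _) : ∃ Q : B i →ₐ[k] k, P = specPoint Q := by
  obtain ⟨φ, rfl⟩ := Spec.map_surjective P
  rw [chartOver, ← Spec.map_comp, ← Spec.map_id, Spec.map_inj] at hP
  refine ⟨{ φ.hom with commutes' := fun c => ?_ }, rfl⟩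
  exact congr($hP c)

/-- Every rational point of the glued scheme lies in one of the charts. -/
lemma exists_specPoint_comp_ι_eq (P : Spec (CommRingCat.of k) ⟶ glued B)
    (hP : P ≫ gluedOver B = 𝟙 _) : ∃ (i : J) (Q : B i →ₐ[k] k), specPoint Q ≫ ι B i = P := by
  let x : Spec (CommRingCat.of k) := default
  obtain ⟨i, y, hy⟩ := exists_ι_apply_eq (P x)
  -- `Spec k` has one point, so `P` factors through any chart that contains its image.
  have hr : Set.range P ⊆ Set.range (ι B i) := by
    rintro _ ⟨x', rfl⟩
    rw [Subsingleton.elim x' x]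
    exact ⟨y, hy⟩
  have h1 : IsOpenImmersion.lift (ι B i) P hr ≫ ι B i = P := IsOpenImmersion.lift_fac _ _ _
  obtain ⟨Q, hQ⟩ := exists_eq_specPoint (IsOpenImmersion.lift (ι B i) P hr) (by
    rw [← ι_over, ← Category.assoc, h1, hP])
  exact ⟨i, Q, by rw [← hQ, h1]⟩

/-- The kernel of `Q` contains `b - Q(b)` for all `b`, hence determines `Q`. -/
lemma specPoint_apply_eq_iff {C : Subalgebra k K} (Q Q' : C →ₐ[k] k) (x : Spec (CommRingCat.of k))
    (h : specPoint Q x = specPoint Q' x) : Q = Q' := by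
  ext b
  have hb : b - algebraMap k C (Q b) ∈ (specPoint Q x).asIdeal := by
    change Q (b - algebraMap k C (Q b)) ∈ x.asIdeal
    rw [map_sub, Q.commutes]
    simp
  rw [h] at hb
  change Q' (b - algebraMap k C (Q b)) ∈ x.asIdeal at hb
  rw [map_sub, Q'.commutes] at hb
  by_contra hne
  exact x.2.ne_top (Ideal.eq_top_of_isUnit_mem _ hb
    (isUnit_iff_ne_zero.2 (sub_ne_zero.2 fun h => hne h.symm)))

/-- Rational points of charts that coincide in the glued scheme are joint. -/
lemma joint_of_comp_ι_eq {i j : J} {Q : B i →ₐ[k] k} {Q' : B j →ₐ[k] k}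
    (h : specPoint Q ≫ ι B i = specPoint Q' ≫ ι B j) : Joint Q Q' := by
  let x : Spec (CommRingCat.of k) := default
  have h1 : ι B i (specPoint Q x) = ι B j (specPoint Q' x) := by
    rw [← Scheme.Hom.comp_apply, ← Scheme.Hom.comp_apply, h]
  obtain ⟨U, hU, φ, hx, -, hφ, hy⟩ := (ι_eq_ι_iff B i j _ _).1 h1
  let P : Piece B := ⟨i, U, hU⟩
  have hr : Set.range (specPoint Q) ⊆ Set.range U.ι := by
    rintro _ ⟨x', rfl⟩
    rw [Subsingleton.elim x' x, Scheme.Opens.range_ι]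
    exact hx
  let u : Spec (CommRingCat.of k) ⟶ U.toScheme := IsOpenImmersion.lift U.ι (specPoint Q) hr
  have hu : u ≫ U.ι = specPoint Q := IsOpenImmersion.lift_fac _ _ _
  -- It is enough to compare on `Spec K`. Being over `k`, the composite `u ≫ φ` is a rational point,
  -- hence equal to the one given by `Q'`, which has the same image.
  have hover : φ ≫ chartOver B j = U.ι ≫ chartOver B i := by
    apply P.hom_unique
    rw [Piece.gen_ι_assoc, reassoc_of% hφ, generic_chartOver, generic_chartOver]
  obtain ⟨Q₁, hQ₁⟩ := exists_eq_specPoint (u ≫ φ) (by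
    rw [Category.assoc, hover, reassoc_of% hu, specPoint_over])
  have hux : u x = ⟨specPoint Q x, hx⟩ := by
    apply U.ι.isOpenEmbedding.injective
    rw [← Scheme.Hom.comp_apply, hu]
    rfl
  obtain rfl : Q₁ = Q' := by
    refine specPoint_apply_eq_iff _ _ x ?_
    rw [← hQ₁, Scheme.Hom.comp_apply, hux, hy]
  -- the ring of sections on `U`
  let sec : ∀ {R : CommRingCat.{u}} {Z : Scheme.{u}} (_ : Z ⟶ Spec R), R ⟶ Γ(Z, ⊤) :=
    fun {R Z} F => (Scheme.ΓSpecIso R).inv ≫ F.appTop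
  have hsec : ∀ {R : CommRingCat.{u}} {Z W : Scheme.{u}} (F : Z ⟶ Spec R) (G : W ⟶ Z),
      sec (G ≫ F) = sec F ≫ G.appTop := by
    intro R Z W F G
    simp [sec]
  have hmap : ∀ {R S : CommRingCat.{u}} (F : R ⟶ S),
      sec (Spec.map F) ≫ (Scheme.ΓSpecIso S).hom = F := by
    intro R S F
    simp [sec]
  let ρ : Γ(U.toScheme, ⊤) ⟶ CommRingCat.of K := P.gen.appTop ≫ (Scheme.ΓSpecIso _).hom
  let T : Γ(U.toScheme, ⊤) ⟶ CommRingCat.of k := u.appTop ≫ (Scheme.ΓSpecIso _).hom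
  have e1 : sec U.ι ≫ ρ = CommRingCat.ofHom (B i).val.toRingHom := by
    rw [← hmap (CommRingCat.ofHom (B i).val.toRingHom), ← Category.assoc]
    congr 1
    exact (hsec U.ι P.gen).symm.trans (congr_arg sec (P.gen_ι))
  have e2 : sec φ ≫ ρ = CommRingCat.ofHom (B j).val.toRingHom := by
    rw [← hmap (CommRingCat.ofHom (B j).val.toRingHom), ← Category.assoc]
    congr 1
    exact (hsec φ P.gen).symm.trans (congr_arg sec hφ)
  have e3 : sec U.ι ≫ T = CommRingCat.ofHom Q.toRingHom := by
    rw [← hmap (CommRingCat.ofHom Q.toRingHom), ← Category.assoc]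
    congr 1
    exact (hsec U.ι u).symm.trans (congr_arg sec hu)
  have e4 : sec φ ≫ T = CommRingCat.ofHom Q₁.toRingHom := by
    rw [← hmap (CommRingCat.ofHom Q₁.toRingHom), ← Category.assoc]
    congr 1
    exact (hsec φ u).symm.trans (congr_arg sec hQ₁)
  -- The common ring consists of the sections on `U`; restriction to `Spec K` is injective since `U`
  -- is schematically dominated by it.
  refine ⟨Γ(U.toScheme, ⊤), inferInstance, ρ.hom, T.hom, (sec U.ι).hom, (sec φ).hom, ?_,
    fun b => congr($e1 b), fun b => congr($e2 b), fun b => congr($e3 b), fun b => congr($e4 b)⟩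
  have hinj : Function.Injective P.gen.appTop := P.gen.app_injective ⊤
  exact (Scheme.ΓSpecIso (CommRingCat.of K)).commRingCatIsoToRingEquiv.injective.comp hinj

end GluedPoints

/-! ### Glueing along a common localization. -/

section Away

variable {k K : Type u} [Field k] [CommRing K] [Algebra k K]

/-- The elements of `K` that become elements of `C` after multiplication by a power of `y ∈ C`. -/
def awaySub (C : Subalgebra k K) {y : K} (hy : y ∈ C) : Subalgebra k K where
  carrier := {b | ∃ N : ℕ, y ^ N * b ∈ C}
  mul_mem' := by
    rintro b b' ⟨N, h⟩ ⟨N', h'⟩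
    exact ⟨N + N', by rw [pow_add, mul_mul_mul_comm]; exact C.mul_mem h h'⟩
  add_mem' := by
    rintro b b' ⟨N, h⟩ ⟨N', h'⟩
    refine ⟨N + N', ?_⟩
    have : y ^ (N + N') * (b + b') = y ^ N' * (y ^ N * b) + y ^ N * (y ^ N' * b') := by ring
    rw [this]
    exact C.add_mem (C.mul_mem (C.pow_mem hy _) h) (C.mul_mem (C.pow_mem hy _) h')
  algebraMap_mem' c := ⟨0, by simp⟩

lemma le_awaySub (C : Subalgebra k K) {y : K} (hy : y ∈ C) : C ≤ awaySub C hy :=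
  fun b hb => ⟨0, by simpa using hb⟩

lemma inv_mem_awaySub (C : Subalgebra k K) {y c : K} (hy : y ∈ C) (hc : y * c = 1) :
    c ∈ awaySub C hy := ⟨1, by rw [pow_one, hc]; exact C.one_mem⟩

/-- The hypotheses say that `L = C[1/y]` inside `K`; elements with equal images in `L` are equal as
everything lies in `K`. -/
lemma isLocalization_inclusion {C L : Subalgebra k K} (hCL : C ≤ L) {y : K} (hy : y ∈ C)
    (hu : ∃ c ∈ L, y * c = 1) (hL : L ≤ awaySub C hy) :
    let := (Subalgebra.inclusion hCL).toRingHom.toAlgebra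
    IsLocalization.Away (⟨y, hy⟩ : C) L := by
  let := (Subalgebra.inclusion hCL).toRingHom.toAlgebra
  obtain ⟨c, hc, e⟩ := hu
  refine ⟨⟨?_, ?_, ?_⟩⟩
  · rintro ⟨_, N, rfl⟩
    rw [map_pow]
    exact (IsUnit.of_mul_eq_one (⟨c, hc⟩ : L) (Subtype.ext e)).pow N
  · intro z
    obtain ⟨N, h⟩ := hL z.2
    refine ⟨⟨⟨_, h⟩, ⟨_, N, rfl⟩⟩, ?_⟩
    rw [mul_comm]
    apply Subtype.ext
    rw [map_pow]
    rfl
  · intro a b h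
    have h' : (a : K) = b := congr_arg (Subtype.val : L → K) h
    exact ⟨1, by rw [Subtype.ext h']⟩

/-- The morphism of spectra given by an inclusion of subalgebras. -/
noncomputable abbrev specInclusion {C L : Subalgebra k K} (h : C ≤ L) :
    Spec (CommRingCat.of L) ⟶ Spec (CommRingCat.of C) :=
  Spec.map (CommRingCat.ofHom (Subalgebra.inclusion h).toRingHom)

lemma isOpenImmersion_specInclusion {C L : Subalgebra k K} (hCL : C ≤ L) {y : K} (hy : y ∈ C)
    (hu : ∃ c ∈ L, y * c = 1) (hL : L ≤ awaySub C hy) :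
    IsOpenImmersion (specInclusion hCL) := by
  let := (Subalgebra.inclusion hCL).toRingHom.toAlgebra
  have := isLocalization_inclusion hCL hy hu hL
  exact IsOpenImmersion.of_isLocalization (⟨y, hy⟩ : C)

lemma mem_range_specInclusion {C L : Subalgebra k K} (hCL : C ≤ L) {y : K} (hy : y ∈ C)
    (hu : ∃ c ∈ L, y * c = 1) (hL : L ≤ awaySub C hy) (p : Spec (CommRingCat.of C))
    (hp : (⟨y, hy⟩ : C) ∉ p.asIdeal) : p ∈ Set.range (specInclusion hCL) := by
  let := (Subalgebra.inclusion hCL).toRingHom.toAlgebra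
  have := isLocalization_inclusion hCL hy hu hL
  have h := PrimeSpectrum.localization_away_comap_range L (⟨y, hy⟩ : C)
  have h2 : p ∈ (PrimeSpectrum.basicOpen (⟨y, hy⟩ : C) : Set (PrimeSpectrum C)) := hp
  rw [← h] at h2
  exact h2

/-- A rational point of a chart `B i` at which `y` does not vanish lies in the chart `B j` if `B i` and
`B j` have a common localization, which is the localization of `B i` at `y`. -/
lemma exists_comp_ι_eq {J : Type u} {B : J → Subalgebra k K} {i j : J} {L : Subalgebra k K}
    (hi : B i ≤ L) (hj : B j ≤ L) {y : K} (hy : y ∈ B i) (hu : ∃ c ∈ L, y * c = 1)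
    (hL : L ≤ awaySub (B i) hy) {y' : K} (hy' : y' ∈ B j) (hu' : ∃ c ∈ L, y' * c = 1)
    (hL' : L ≤ awaySub (B j) hy') (Q : B i →ₐ[k] k) (hQ : Q ⟨y, hy⟩ ≠ 0) :
    ∃ P : Spec (CommRingCat.of k) ⟶ chart B j, P ≫ ι B j = specPoint Q ≫ ι B i := by
  have h1 := isOpenImmersion_specInclusion hi hy hu hL
  have h2 := isOpenImmersion_specInclusion hj hy' hu' hL'
  have hr : Set.range (specPoint Q) ⊆ Set.range (specInclusion hi) := by
    rintro _ ⟨x, rfl⟩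
    refine mem_range_specInclusion hi hy hu hL _ fun h => ?_
    change Q ⟨y, hy⟩ ∈ x.asIdeal at h
    exact x.2.ne_top (Ideal.eq_top_of_isUnit_mem _ h (isUnit_iff_ne_zero.2 hQ))
  refine ⟨IsOpenImmersion.lift (specInclusion hi) (specPoint Q) hr ≫ specInclusion hj, ?_⟩
  -- `Spec L` is a dense open part of both charts, so they are glued along it.
  have h3 : specInclusion hi ≫ ι B i = specInclusion hj ≫ ι B j :=
    comp_ι_eq_comp_ι (specInclusion hi) (specInclusion hj)
      (Spec.map (CommRingCat.ofHom L.val.toRingHom)) (Spec.map_comp _ _).symm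
      (Spec.map_comp _ _).symm
  rw [Category.assoc, ← h3, IsOpenImmersion.lift_fac_assoc]

end Away

/-! ### `C_{0,α}` as a common open subscheme of `C_α` and `C₀`. -/

section OpenRing

variable {k : Type u} [Field k] {f : Laurent k 2} (α : Omega f)

namespace Omega

lemma prod_zpow_mem {ι : Type*} [Fintype ι] {S : Subalgebra k (FunctionRing f)}
    (z : ι → (FunctionRing f)ˣ) (hz : ∀ i, (z i : FunctionRing f) ∈ S)
    (hz' : ∀ i, (↑(z i)⁻¹ : FunctionRing f) ∈ S) (e : ι → ℤ) :
    ((∏ i, z i ^ e i : (FunctionRing f)ˣ) : FunctionRing f) ∈ S := by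
  rw [Units.coe_prod]
  exact S.prod_mem fun i _ => zpow_mem_of_inv_mem (hz i) (hz' i) _

lemma coord_mem_openRing (t : Fin (α.1.l + 2)) : (α.coord t : FunctionRing f) ∈ α.openRing :=
  Algebra.subset_adjoin ⟨t, Or.inl rfl⟩

lemma coord_inv_mem_openRing (t : Fin (α.1.l + 2)) :
    (↑(α.coord t)⁻¹ : FunctionRing f) ∈ α.openRing :=
  Algebra.subset_adjoin ⟨t, Or.inr rfl⟩

lemma ring_le_openRing : α.ring ≤ α.openRing :=
  α.ring_le (fun _ => ⟨α.coord_mem_openRing _, α.coord_inv_mem_openRing _⟩) (α.coord_mem_openRing _)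

/-- `Y` is the only coordinate whose inverse is not among the generators of the ring of `C_α`. -/
lemma openRing_le_awaySub_ring : α.openRing ≤ awaySub α.ring α.coord_last_mem := by
  refine Algebra.adjoin_le ?_
  rintro _ ⟨t, rfl | rfl⟩ <;> induction t using Fin.lastCases with
  | last => first
    | exact le_awaySub _ _ α.coord_last_mem
    | exact inv_mem_awaySub _ _ (Units.mul_inv _)
  | cast t => first
    | exact le_awaySub _ _ (α.coord_castSucc_mem t)
    | exact le_awaySub _ _ (α.coord_castSucc_inv_mem t)

lemma var_mem_openRing (t : Fin (α.1.l + 2)) : (α.var t : FunctionRing f) ∈ α.openRing := by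
  rw [← monomials_coord]
  exact prod_zpow_mem _ α.coord_mem_openRing α.coord_inv_mem_openRing _

lemma var_inv_mem_openRing (t : Fin (α.1.l + 2)) :
    (↑(α.var t)⁻¹ : FunctionRing f) ∈ α.openRing := by
  rw [← monomials_coord, monomials, ← Finset.prod_inv_distrib]
  simp only [← zpow_neg]
  exact prod_zpow_mem _ α.coord_mem_openRing α.coord_inv_mem_openRing _

lemma val_var_zero : (α.var (0 : Fin (α.1.l + 1)).castSucc : FunctionRing f) = toFunction f xVar := by
  rw [val_var, Chart.vars, Fin.snoc_castSucc, Fin.cons_zero]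

lemma val_var_last : (α.var (Fin.last _) : FunctionRing f) = toFunction f yVar := by
  rw [val_var, Chart.vars, Fin.snoc_last]

lemma val_var_succ (i : Fin α.1.l) :
    (α.var i.succ.castSucc : FunctionRing f) = toFunction f (α.1.g i) := by
  rw [val_var, Chart.vars, Fin.snoc_castSucc, Fin.cons_succ]

lemma range_le_openRing : (toFunction f).range ≤ α.openRing := by
  rintro _ ⟨a, rfl⟩
  change toFunction f a ∈ _
  induction a using AddMonoidAlgebra.induction_linear with
  | zero => simp
  | add a b ha hb => rw [map_add]; exact Subalgebra.add_mem _ ha hb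
  | single e c =>
    have : (AddMonoidAlgebra.single e c : Laurent k 2) = c • mono e := by simp [mono]
    rw [this, map_smul, toFunction_mono _ _ α.val_var_zero α.val_var_last, Units.val_mul]
    refine Subalgebra.smul_mem _ (Subalgebra.mul_mem _ ?_ ?_) c
    · exact zpow_mem_of_inv_mem (α.var_mem_openRing _) (α.var_inv_mem_openRing _) _
    · exact zpow_mem_of_inv_mem (α.var_mem_openRing _) (α.var_inv_mem_openRing _) _

lemma prod_g_mem : (∏ i, toFunction f (α.1.g i)) ∈ (toFunction f).range :=
  Subalgebra.prod_mem _ fun _ _ => ⟨_, rfl⟩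

lemma exists_inv_prod_g : ∃ c ∈ α.openRing, (∏ i, toFunction f (α.1.g i)) * c = 1 := by
  refine ⟨∏ i : Fin α.1.l, (↑(α.var i.succ.castSucc)⁻¹ : FunctionRing f),
    Subalgebra.prod_mem _ fun i _ => α.var_inv_mem_openRing _, ?_⟩
  rw [← Finset.prod_mul_distrib]
  exact Finset.prod_eq_one fun _ _ => by rw [← val_var_succ, Units.mul_inv]

lemma inv_mem_range_of_isUnit {u : (FunctionRing f)ˣ} {a : Laurent k 2} (ha : IsUnit a)
    (hu : (u : FunctionRing f) = toFunction f a) : (↑u⁻¹ : FunctionRing f) ∈ (toFunction f).range := by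
  obtain ⟨b, hb⟩ := ha.exists_right_inv
  refine ⟨b, ?_⟩
  change toFunction f b = _
  exact (Units.inv_eq_of_mul_eq_one_right (by rw [hu, ← map_mul, hb, map_one])).symm

/-- The coordinates are monomials in `x₁, g₂, …, g_m, y`; here `x₁` and `y` are units on `C₀`, and
inverting the product of the `g_i` inverts each of them. -/
lemma openRing_le_awaySub_range : α.openRing ≤ awaySub (toFunction f).range α.prod_g_mem := by
  have h1 : ∀ t, (α.var t : FunctionRing f) ∈ awaySub (toFunction f).range α.prod_g_mem :=
    fun t => le_awaySub _ _ ⟨_, rfl⟩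
  have h2 : ∀ t, (↑(α.var t)⁻¹ : FunctionRing f) ∈ awaySub (toFunction f).range α.prod_g_mem := by
    intro t
    induction t using Fin.lastCases with
    | last => exact le_awaySub _ _ (inv_mem_range_of_isUnit (isUnit_mono _) α.val_var_last)
    | cast t =>
      induction t using Fin.cases with
      | zero => exact le_awaySub _ _ (inv_mem_range_of_isUnit (isUnit_mono _) α.val_var_zero)
      | succ i =>
        refine ⟨1, ∏ j ∈ Finset.univ.erase i, α.1.g j, ?_⟩
        change toFunction f _ = _
        rw [pow_one, ← Finset.mul_prod_erase _ _ (Finset.mem_univ i), mul_comm, ← val_var_succ,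
          Units.inv_mul_cancel_left, map_prod]
  refine Algebra.adjoin_le ?_
  rintro _ ⟨t, rfl | rfl⟩
  · exact prod_zpow_mem _ h1 h2 _
  · rw [coord_eq_monomials, monomials, ← Finset.prod_inv_distrib]
    simp only [← zpow_neg]
    exact prod_zpow_mem _ h1 h2 _

end Omega

end OpenRing

/-! ### The bijection with the simple roots. -/

section Bijection

variable {k : Type u} [Field k] {f : Laurent k 2} {Sig : Set (Omega f)}

/-- The locus `Y ≠ 0` of `C_γ` is `C_{0,γ}`, which is also the locus of `C₀` where the product of
the `g_i` does not vanish. -/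
lemma inC₀_of_apply_Y_ne_zero (γ : Sig) (Q : γ.1.ring →ₐ[k] k) (hQ : Q γ.1.Y ≠ 0) :
    ∃ P : Spec (CommRingCat.of k) ⟶ chart (chartRing Sig) none,
      P ≫ ι (chartRing Sig) none = chartPoint γ Q :=
  exists_comp_ι_eq (B := chartRing Sig) (i := some γ) (j := none) γ.1.ring_le_openRing
    γ.1.range_le_openRing γ.1.coord_last_mem
    ⟨_, γ.1.coord_inv_mem_openRing _, Units.mul_inv _⟩ γ.1.openRing_le_awaySub_ring γ.1.prod_g_mem
    γ.1.exists_inv_prod_g γ.1.openRing_le_awaySub_range Q hQ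

lemma chartPoint_over (γ : Sig) (Q : γ.1.ring →ₐ[k] k) :
    chartPoint γ Q ≫ curveOver Sig = 𝟙 _ :=
  specPoint_comp_ι_over (B := chartRing Sig) (i := some γ) Q

/-- A unit on `C₀` that is a multiple of `Y` vanishes at `Q`, which is impossible at a point that
also lies on `C₀`. -/
lemma IsGoodSet.not_inC₀ (H : IsGoodSet Sig) (γ : Sig) (Q : γ.1.ring →ₐ[k] k) (hQ : Q γ.1.Y = 0)
    (P : curvePoints Sig) (hP : P.1 = chartPoint γ Q) : ¬ InC₀ P := by
  rintro ⟨P₀, h0⟩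
  obtain ⟨Q₀, rfl⟩ := exists_eq_specPoint (B := chartRing Sig) P₀ (by
    rw [← ι_over, ← Category.assoc, h0]
    exact P.2)
  have hJ : Joint (B := γ.1.ring) (B' := (toFunction f).range) Q Q₀ :=
    joint_of_comp_ι_eq (B := chartRing Sig) (i := some γ) (j := none) (hP.symm.trans h0.symm)
  obtain ⟨u, b, hb, e⟩ := H.exists_unit γ.1 γ.2
  have h1 := hJ.mul_eq_one (a := γ.1.coord (Fin.last _) * b) (c := toFunction f ↑u⁻¹)
    (Subalgebra.mul_mem _ γ.1.coord_last_mem hb) ⟨_, rfl⟩ (by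
      rw [← e, ← map_mul, Units.mul_inv, map_one])
  have h2 : Q ⟨γ.1.coord (Fin.last _) * b, Subalgebra.mul_mem _ γ.1.coord_last_mem hb⟩ = 0 := by
    have : (⟨γ.1.coord (Fin.last _) * b, Subalgebra.mul_mem _ γ.1.coord_last_mem hb⟩ : γ.1.ring) =
      γ.1.Y * ⟨b, hb⟩ := rfl
    rw [this, map_mul, hQ, zero_mul]
  rw [h2, zero_mul] at h1
  exact zero_ne_one h1

lemma IsGoodSet.exists_simpleRoot (H : IsGoodSet Sig) (hreg : OuterRegular Sig) (γ : Sig)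
    (Q : γ.1.ring →ₐ[k] k) (hQ : Q γ.1.Y = 0) : ∃ r : γ.1.SimpleRoots, Q γ.1.Xj = r := by
  obtain ⟨h, hH⟩ := H.hasPlaneModel γ.1 γ.2
  have hne : Q γ.1.Xj ≠ 0 := by
    have : γ.1.Xj * ⟨_, γ.1.coord_castSucc_inv_mem γ.1.1.j⟩ = 1 := Subtype.ext (Units.mul_inv _)
    have h1 := congr_arg Q this
    rw [map_mul, map_one] at h1
    exact left_ne_zero_of_mul_eq_one h1
  -- The point lies on `C̄_γ`; its kernel there is a prime modulo which `X_{j_γ}` is the constant `Q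
  -- γ.1.Xj`, so regularity at this prime gives a simple root.
  let Qbar : γ.1.barRing →+* k := Ideal.Quotient.lift _ Q.toRingHom (by
    intro a ha
    obtain ⟨b, rfl⟩ := Ideal.mem_span_singleton.1 ha
    change Q (γ.1.Y * b) = 0
    rw [map_mul, hQ, zero_mul])
  have hprime : (RingHom.ker Qbar).IsPrime := RingHom.ker_isPrime _
  have hmem : Ideal.Quotient.mk _ γ.1.Xj - algebraMap k γ.1.barRing (Q γ.1.Xj) ∈ RingHom.ker Qbar := by
    rw [RingHom.mem_ker]
    change Q (γ.1.Xj - algebraMap k γ.1.ring (Q γ.1.Xj)) = 0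
    rw [map_sub, Q.commutes]
    exact sub_self _
  exact ⟨⟨Q γ.1.Xj, hne, (ResolvingData.isLineModel_bar hH).rootMultiplicity_eq_one hmem
    ((hreg γ.1 γ.2).isRegularLocalRing_localization _)⟩, rfl⟩

lemma IsGoodSet.existsUnique_hom (H : IsGoodSet Sig) (γ : Sig) (r : γ.1.SimpleRoots) :
    ∃ Q : γ.1.ring →ₐ[k] k, Q γ.1.Y = 0 ∧ Q γ.1.Xj = r ∧
      ∀ Q' : γ.1.ring →ₐ[k] k, Q' γ.1.Y = 0 → Q' γ.1.Xj = r → Q' = Q := by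
  obtain ⟨h, hH⟩ := H.hasPlaneModel γ.1 γ.2
  obtain ⟨Q, h1, h2⟩ := hH.exists_hom r.2.1 r.2.2
  exact ⟨Q, h1, h2, fun Q' h1' h2' => hH.hom_ext (h1'.trans h1.symm) (h2'.trans h2.symm)⟩

lemma IsGoodSet.exists_bijection (H : IsGoodSet Sig) (hreg : OuterRegular Sig) :
    ∃ Φ : (Σ γ : Sig, γ.1.SimpleRoots) ≃ {P : curvePoints Sig // ¬ InC₀ P},
      ∀ (γ : Sig) (r : γ.1.SimpleRoots),
        (∃ Q : γ.1.ring →ₐ[k] k, Q γ.1.Y = 0 ∧ Q γ.1.Xj = r) ∧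
        ∀ Q : γ.1.ring →ₐ[k] k, Q γ.1.Y = 0 → Q γ.1.Xj = r →
          (Φ ⟨γ, r⟩).1.1 = chartPoint γ Q := by
  choose pt hY hX huniq using H.existsUnique_hom
  let φ : (Σ γ : Sig, γ.1.SimpleRoots) → {P : curvePoints Sig // ¬ InC₀ P} := fun x =>
    ⟨⟨chartPoint x.1 (pt x.1 x.2), chartPoint_over _ _⟩, H.not_inC₀ _ _ (hY x.1 x.2) _ rfl⟩
  refine ⟨Equiv.ofBijective φ ⟨?_, ?_⟩, fun γ r => ⟨⟨pt γ r, hY γ r, hX γ r⟩, fun Q h1 h2 => ?_⟩⟩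
  -- Equal images are joint points: this forces equal charts, and then equal values of `X_{j_γ}`.
  · rintro ⟨γ, r⟩ ⟨γ', r'⟩ e
    have e' : chartPoint γ (pt γ r) = chartPoint γ' (pt γ' r') :=
      congr_arg (fun x : {P : curvePoints Sig // ¬ InC₀ P} => x.1.1) e
    have hJ : Joint (pt γ r) (pt γ' r') :=
      joint_of_comp_ι_eq (B := chartRing Sig) (i := some γ) (j := some γ') e'
    obtain rfl : γ = γ' := Subtype.ext (H.eq_of_joint _ γ.2 _ γ'.2 _ _ (hY _ _) (hY _ _) hJ)
    obtain rfl : r = r' := Subtype.ext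
      ((hX γ r).symm.trans ((hJ.apply_eq γ.1.Xj.2 γ.1.Xj.2).trans (hX γ r')))
    rfl
  -- A point outside `C₀` lies on some `C_γ`, necessarily with `Y = 0`.
  · rintro ⟨⟨P, hP⟩, hP'⟩
    obtain ⟨i, Q, hQ⟩ := exists_specPoint_comp_ι_eq (B := chartRing Sig) P hP
    obtain _ | γ := i
    · exact absurd ⟨_, hQ⟩ hP'
    · change γ.1.ring →ₐ[k] k at Q
      have hQY : Q γ.1.Y = 0 := by
        by_contra hne
        obtain ⟨P₀, h0⟩ := inC₀_of_apply_Y_ne_zero γ Q hne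
        exact hP' ⟨P₀, h0.trans hQ⟩
      obtain ⟨r, hr⟩ := H.exists_simpleRoot hreg γ Q hQY
      refine ⟨⟨γ, r⟩, Subtype.ext (Subtype.ext ?_)⟩
      refine Eq.trans ?_ hQ
      rw [huniq γ r Q hQY hr]
      rfl
  · rw [huniq γ r Q h1 h2]
    rfl

end Bijection

end BakerModel

theorem theorem4p12 {k : Type u} [Field k] [IsAlgClosed k] (f : BakerModel.Laurent k 2) (hf : f ≠ 0)
    (hsmooth : Algebra.Smooth k (BakerModel.CoordRing f))
    (R : BakerModel.SimpleBakerResolution f) (n : ℕ) (hn : 1 ≤ n)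
    (hreg : BakerModel.OuterRegular (R.Sig n)) :
    ∃ Φ : (Σ γ : R.Sig n, γ.1.SimpleRoots) ≃
        {P : BakerModel.curvePoints (R.Sig n) // ¬ BakerModel.InC₀ P},
      ∀ (γ : R.Sig n) (r : γ.1.SimpleRoots),
        (∃ Q : γ.1.ring →ₐ[k] k, Q γ.1.Y = 0 ∧ Q γ.1.Xj = r) ∧
        ∀ Q : γ.1.ring →ₐ[k] k, Q γ.1.Y = 0 → Q γ.1.Xj = r →
          (Φ ⟨γ, r⟩).1.1 = BakerModel.chartPoint γ Q := by
  exact (R.isGoodSet hn).exists_bijection hreg
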